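/- Let $f\in C^2([0,1])$ be of concave KPP type: $f(0)=f(1)=0$, $f'(0)=1$ and $f''<0$ on $[0,1]$. There is a constant $C>0$, depending only on $f$, such that the following holds for all $\kappa,v_0,H>0$. Let $u\in C^1([0,H])$ with $\int_0^H u(y)\,dy=0$, put $\Omega=\mathbb R\times[0,H]$, and let $T(x,y,t)$, $0\le T\le 1$, be a classical solution of $$T_t+u(y)T_x=\kappa\Delta T+\frac{v_0^2}{4\kappa}f(T),\qquad (x,y)\in\Omega,\ t>0,$$ continuous up to $t=0$ (with $T_t,T_x,T_y,T_{xx},T_{yy}$ continuous on $\Omega\times(0,\infty)$, up to the boundary $y=0,H$), satisfying either the Neumann conditions $T_y(x,0,t)=T_y(x,H,t)=0$ or the condition of $H$-periodicity in $y$ (i.e. $T$ and $T_y$ take equal values at $y=0$ and $y=H$). Assume that the initial datum $T_0=T(\cdot,\cdot,0)$ is front-like: for some $\lambda>0$, $T_0=1-O(e^{\lambda x})$ for $x<0$, $T_0=O(e^{-\lambda x})$ for $x>0$, and $|\nabla T_0|=O(e^{-\lambda|x|})$, uniformly in $y$. Let $$V(t)=\int_\Omega T_t(x,y,t)\,\frac{dx\,dy}{H},\qquad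 \langle V\rangle_\tau=\frac1\tau\int_0^\tau V(t)\,dt,\qquad l=\frac{\kappa}{v_0}.$$ Let $I_j=[c_j-h_j,c_j+h_j]$, $h_j>0$, be any (finite or countable) partition of $[0,H]$ into intervals on which $u$ does not change sign, or more generally any family of non-overlapping intervals in $[0,H]$. Let $D_+$ and $D_-$ be unions of disjoint subfamilies of the $I_j$ such that $u\ge0$ on the intervals of $D_+$ and $u\le0$ on those of $D_-$. Set $$c_\pm=\Bigl(\sum_{I_j\subset D_\mp}\frac{h_j^3}{h_j^2+l^2}\Bigr)\Bigl(\sum_{I_j}\frac{h_j^3}{h_j^2+l^2}\Bigr)^{-1}$$ (read as $0$ if the family is empty). Then for every $\tau\ge\max\{\kappa/v_0^2,\,H/v_0\}$, $T_t(\cdot,\cdot,t)$ is integrable over $\Omega$ for almost every $t\in(0,\tau)$, $V$ is integrable on $(0,\tau)$, and $$\langle V\rangle_\tau\ \ge\ C\Bigl(c_+\sum_{I_j\subset D_+}\Bigl(1+\frac{l^2}{h_j^2}\Bigr)^{-1}\int_{c_j-h_j/2}^{c_j+h_j/2}|u(y)|\,\frac{dy}{H}+c_-\sum_{I_j\subset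 D_-}\Bigl(1+\frac{l^2}{h_j^2}\Bigr)^{-1}\int_{c_j-h_j/2}^{c_j+h_j/2}|u(y)|\,\frac{dy}{H}\Bigr).$$ -/

import Mathlib

open Set MeasureTheory

noncomputable section

namespace BulkBurning

/-- Concave KPP nonlinearity on `[0,1]`. -/
structure IsConcaveKPP (f : ℝ → ℝ) : Prop where
  contDiffOn : ContDiffOn ℝ 2 f (Icc 0 1)
  map_zero : f 0 = 0
  map_one : f 1 = 0
  deriv_zero : derivWithin f (Icc 0 1) 0 = 1
  second_deriv_neg : ∀ s ∈ Icc (0 : ℝ) 1, iteratedDerivWithin 2 f (Icc 0 1) s < 0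

/-- The closed strip `ℝ × [0,H]`. -/
def strip (H : ℝ) : Set (ℝ × ℝ) := univ ×ˢ Icc 0 H

/-- `T_t(x,y,t)`; a temperature is a function `T t x y`. -/
def dt (T : ℝ → ℝ → ℝ → ℝ) (t x y : ℝ) : ℝ := deriv (fun s => T s x y) t

/-- `T_x`. -/
def dx (T : ℝ → ℝ → ℝ → ℝ) (t x y : ℝ) : ℝ := deriv (fun z => T t z y) x

/-- `T_y`, one-sided at `y = 0` and `y = H`. -/
def dy (H : ℝ) (T : ℝ → ℝ → ℝ → ℝ) (t x y : ℝ) : ℝ :=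
  derivWithin (fun z => T t x z) (Icc 0 H) y

/-- Classical solution of `T_t + u(y) T_x = κ ΔT + (v₀² / 4κ) f(T)` in the closed strip for `t > 0`,
with values in `[0,1]` and continuous up to `t = 0`. -/
structure IsClassicalSolution (f : ℝ → ℝ) (κ v₀ H : ℝ) (u : ℝ → ℝ) (T : ℝ → ℝ → ℝ → ℝ) :
    Prop where
  mem_Icc : ∀ t, 0 ≤ t → ∀ x, ∀ y ∈ Icc 0 H, T t x y ∈ Icc (0 : ℝ) 1
  continuousOn : ContinuousOn (fun p : ℝ × ℝ × ℝ => T p.1 p.2.1 p.2.2)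
    (Ici 0 ×ˢ univ ×ˢ Icc 0 H)
  differentiable_t : ∀ t, 0 < t → ∀ x, ∀ y ∈ Icc 0 H,
    DifferentiableAt ℝ (fun s => T s x y) t
  differentiable_x : ∀ t, 0 < t → ∀ x, ∀ y ∈ Icc 0 H,
    DifferentiableAt ℝ (fun z => T t z y) x
  differentiable_xx : ∀ t, 0 < t → ∀ x, ∀ y ∈ Icc 0 H,
    DifferentiableAt ℝ (fun z => dx T t z y) x
  differentiable_y : ∀ t, 0 < t → ∀ x, ∀ y ∈ Icc 0 H,
    DifferentiableWithinAt ℝ (fun z => T t x z) (Icc 0 H) y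
  differentiable_yy : ∀ t, 0 < t → ∀ x, ∀ y ∈ Icc 0 H,
    DifferentiableWithinAt ℝ (fun z => dy H T t x z) (Icc 0 H) y
  continuousOn_dt : ContinuousOn (fun p : ℝ × ℝ × ℝ => dt T p.1 p.2.1 p.2.2)
    (Ioi 0 ×ˢ univ ×ˢ Icc 0 H)
  continuousOn_dx : ContinuousOn (fun p : ℝ × ℝ × ℝ => dx T p.1 p.2.1 p.2.2)
    (Ioi 0 ×ˢ univ ×ˢ Icc 0 H)
  continuousOn_dy : ContinuousOn (fun p : ℝ × ℝ × ℝ => dy H T p.1 p.2.1 p.2.2)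
    (Ioi 0 ×ˢ univ ×ˢ Icc 0 H)
  continuousOn_dxx : ContinuousOn (fun p : ℝ × ℝ × ℝ => dx (dx T) p.1 p.2.1 p.2.2)
    (Ioi 0 ×ˢ univ ×ˢ Icc 0 H)
  continuousOn_dyy : ContinuousOn (fun p : ℝ × ℝ × ℝ => dy H (dy H T) p.1 p.2.1 p.2.2)
    (Ioi 0 ×ˢ univ ×ˢ Icc 0 H)
  equation : ∀ t, 0 < t → ∀ x, ∀ y ∈ Icc 0 H,
    dt T t x y + u y * dx T t x y =
      κ * (dx (dx T) t x y + dy H (dy H T) t x y) + v₀ ^ 2 / (4 * κ) * f (T t x y)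

/-- Neumann condition on the walls `y = 0` and `y = H`. -/
def NeumannBC (H : ℝ) (T : ℝ → ℝ → ℝ → ℝ) : Prop :=
  ∀ t, 0 < t → ∀ x, dy H T t x 0 = 0 ∧ dy H T t x H = 0

/-- Periodicity in `y` with period `H`, expressed on the strip: the values and the normal
derivatives at `y = 0` and `y = H` agree. -/
def PeriodicBC (H : ℝ) (T : ℝ → ℝ → ℝ → ℝ) : Prop :=
  ∀ t, 0 < t → ∀ x, T t x 0 = T t x H ∧ dy H T t x 0 = dy H T t x H

/-- The initial datum is front-like: `T₀ = 1 - O(e^{λx})` for `x < 0`, `T₀ = O(e^{-λx})` for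
`x > 0` and `|∇T₀| = O(e^{-λ|x|})`, for some `λ > 0`. -/
def InitiallyLocalized (H : ℝ) (T : ℝ → ℝ → ℝ → ℝ) : Prop :=
  ∃ lam > 0, ∃ C₀ > 0, ∀ x, ∀ y ∈ Icc 0 H,
    (x < 0 → 1 - T 0 x y ≤ C₀ * Real.exp (lam * x)) ∧
    (0 < x → T 0 x y ≤ C₀ * Real.exp (-lam * x)) ∧
    DifferentiableAt ℝ (fun z => T 0 z y) x ∧
    DifferentiableWithinAt ℝ (fun z => T 0 x z) (Icc 0 H) y ∧
    Real.sqrt (dx T 0 x y ^ 2 + dy H T 0 x y ^ 2) ≤ C₀ * Real.exp (-lam * |x|)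

/-- Instantaneous bulk burning rate `V(t) = ∫_Ω T_t dx dy / H`. -/
def V (H : ℝ) (T : ℝ → ℝ → ℝ → ℝ) (t : ℝ) : ℝ :=
  (∫ p in strip H, dt T t p.1 p.2) / H

/-- Time average `⟨V⟩_τ`. -/
def avgV (H : ℝ) (T : ℝ → ℝ → ℝ → ℝ) (τ : ℝ) : ℝ :=
  (1 / τ) * ∫ t in (0 : ℝ)..τ, V H T t

/-- Non-overlapping intervals `I_j = [c_j - h_j, c_j + h_j]` of `[0,H]`, finitely or infinitely
many, with the choice of those that make up `D₊` (where `u ≥ 0`) and `D₋` (where `u ≤ 0`).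
A partition of `[0,H]` is a particular case: the intervals need not fill `[0,H]`. -/
structure SignedIntervals (H : ℝ) (u : ℝ → ℝ) (ι : Type) where
  c : ι → ℝ
  h : ι → ℝ
  Dplus : Set ι
  Dminus : Set ι
  h_pos : ∀ j, 0 < h j
  subset : ∀ j, Icc (c j - h j) (c j + h j) ⊆ Icc 0 H
  nonoverlapping : Pairwise fun i j =>
    Disjoint (Ioo (c i - h i) (c i + h i)) (Ioo (c j - h j) (c j + h j))
  disjoint : Disjoint Dplus Dminus
  nonneg_on_Dplus : ∀ j ∈ Dplus, ∀ y ∈ Icc (c j - h j) (c j + h j), 0 ≤ u y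
  nonpos_on_Dminus : ∀ j ∈ Dminus, ∀ y ∈ Icc (c j - h j) (c j + h j), u y ≤ 0

namespace SignedIntervals

variable {H : ℝ} {u : ℝ → ℝ} {ι : Type}

/-- `h_j³ / (h_j² + l²)`. -/
def weight (I : SignedIntervals H u ι) (l : ℝ) (j : ι) : ℝ :=
  I.h j ^ 3 / (I.h j ^ 2 + l ^ 2)

/-- `c₊`, with the sum over `D₋` in the numerator. -/
def cplus (I : SignedIntervals H u ι) (l : ℝ) : ℝ :=
  (∑' j : I.Dminus, I.weight l j) * (∑' j, I.weight l j)⁻¹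

/-- `c₋`, with the sum over `D₊` in the numerator. -/
def cminus (I : SignedIntervals H u ι) (l : ℝ) : ℝ :=
  (∑' j : I.Dplus, I.weight l j) * (∑' j, I.weight l j)⁻¹

/-- `(1 + l² / h_j²)⁻¹ ∫ |u| dy / H` over the middle half of `I_j`. -/
def term (I : SignedIntervals H u ι) (l : ℝ) (j : ι) : ℝ :=
  (1 + l ^ 2 / I.h j ^ 2)⁻¹ * ∫ y in (I.c j - I.h j / 2)..(I.c j + I.h j / 2), |u y| / H

end SignedIntervals

end BulkBurning

end

noncomputable section

namespace BulkBurning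

open Filter Topology

theorem IsConcaveKPP.exists_bounds {f : ℝ → ℝ} (hf : IsConcaveKPP f) :
    ∃ c > 0, ∃ L > 0, ∀ s ∈ Icc (0 : ℝ) 1,
      c * (s * (1 - s)) ≤ f s ∧ f s ≤ L * (s * (1 - s)) := by
  have hu : UniqueDiffOn ℝ (Icc (0 : ℝ) 1) := uniqueDiffOn_Icc one_pos
  have hcont : ContinuousOn (iteratedDerivWithin 2 f (Icc 0 1)) (Icc 0 1) :=
    hf.contDiffOn.continuousOn_iteratedDerivWithin le_rfl hu
  have hcont1 : ContinuousOn (iteratedDerivWithin 1 f (Icc 0 1)) (Icc 0 1) :=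
    hf.contDiffOn.continuousOn_iteratedDerivWithin (by norm_num) hu
  obtain ⟨z, hz, hzmax⟩ := isCompact_Icc.exists_isMaxOn (nonempty_Icc.2 zero_le_one) hcont
  set m := -iteratedDerivWithin 2 f (Icc 0 1) z with hm
  have hmpos : 0 < m := by have := hf.second_deriv_neg z hz; linarith
  have hdiff : DifferentiableOn ℝ f (Icc 0 1) := hf.contDiffOn.differentiableOn (by norm_num)
  have hd1 : ∀ s ∈ Ioo (0 : ℝ) 1, HasDerivAt f (iteratedDerivWithin 1 f (Icc 0 1) s) s := by
    intro s hs
    rw [iteratedDerivWithin_one]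
    exact (hdiff s (Ioo_subset_Icc_self hs)).hasDerivWithinAt.hasDerivAt (Icc_mem_nhds hs.1 hs.2)
  have hd2 : ∀ s ∈ Ioo (0 : ℝ) 1, HasDerivAt (iteratedDerivWithin 1 f (Icc 0 1))
      (iteratedDerivWithin 2 f (Icc 0 1) s) s := by
    intro s hs
    have h1 : DifferentiableOn ℝ (iteratedDerivWithin 1 f (Icc 0 1)) (Icc 0 1) :=
      hf.contDiffOn.differentiableOn_iteratedDerivWithin (by norm_num) hu
    rw [iteratedDerivWithin_succ (n := 1)]
    exact (h1 s (Ioo_subset_Icc_self hs)).hasDerivWithinAt.hasDerivAt (Icc_mem_nhds hs.1 hs.2)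
  have hconc : ConcaveOn ℝ (Icc (0 : ℝ) 1) fun s => f s - m / 2 * (s * (1 - s)) := by
    refine concaveOn_of_hasDerivWithinAt2_nonpos
      (f' := fun s => iteratedDerivWithin 1 f (Icc 0 1) s - m / 2 * (1 - 2 * s))
      (f'' := fun s => iteratedDerivWithin 2 f (Icc 0 1) s + m) (convex_Icc 0 1) ?_ ?_ ?_ ?_
    · exact hf.contDiffOn.continuousOn.sub (by fun_prop)
    · intro s hs
      rw [interior_Icc] at hs ⊢
      refine (((hd1 s hs).sub (((hasDerivAt_id s).mul
        ((hasDerivAt_id s).const_sub 1)).const_mul (m / 2))).congr_deriv ?_).hasDerivWithinAt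
      simp only [id]; ring
    · intro s hs
      rw [interior_Icc] at hs ⊢
      refine (((hd2 s hs).sub ((((hasDerivAt_id s).const_mul 2).const_sub 1).const_mul
        (m / 2))).congr_deriv ?_).hasDerivWithinAt
      ring
    · intro s hs
      rw [interior_Icc] at hs
      have : iteratedDerivWithin 2 f (Icc 0 1) s ≤ iteratedDerivWithin 2 f (Icc 0 1) z :=
        hzmax (Ioo_subset_Icc_self hs)
      linarith
  obtain ⟨K, hK⟩ := isCompact_Icc.exists_bound_of_continuousOn hcont1
  have hlip : ∀ s ∈ Icc (0 : ℝ) 1, ∀ r ∈ Icc (0 : ℝ) 1, |f r - f s| ≤ K * |r - s| := by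
    intro s hs r hr
    refine (convex_Icc (0 : ℝ) 1).norm_image_sub_le_of_norm_derivWithin_le hdiff ?_ hs hr
    intro x hx
    rw [← iteratedDerivWithin_one]
    exact hK x hx
  refine ⟨m / 2, by positivity, 2 * |K| + 1, by positivity, fun s hs => ⟨?_, ?_⟩⟩
  · have := hconc.2 (left_mem_Icc.2 zero_le_one) (right_mem_Icc.2 zero_le_one)
      (sub_nonneg.2 hs.2) hs.1 (by ring)
    simp only [hf.map_zero, hf.map_one, smul_eq_mul] at this
    ring_nf at this ⊢
    linarith
  · have h0 := hlip 0 (left_mem_Icc.2 zero_le_one) s hs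
    have h1 := hlip 1 (right_mem_Icc.2 zero_le_one) s hs
    rw [hf.map_zero, sub_zero, sub_zero, abs_of_nonneg hs.1] at h0
    rw [hf.map_one, sub_zero, abs_sub_comm, abs_of_nonneg (sub_nonneg.2 hs.2)] at h1
    have g0 := (le_abs_self _).trans h0
    have g1 := (le_abs_self _).trans h1
    have hKa := le_abs_self K
    have hs0 := hs.1
    have hs1 := sub_nonneg.2 hs.2
    have e0 : f s ≤ |K| * s := g0.trans (mul_le_mul_of_nonneg_right hKa hs0)
    have e1 : f s ≤ |K| * (1 - s) := g1.trans (mul_le_mul_of_nonneg_right hKa hs1)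
    have hprod : 0 ≤ s * (1 - s) := mul_nonneg hs0 hs1
    have hKn := abs_nonneg K
    rcases le_total s (1 / 2) with h | h
    · have : 0 ≤ |K| * s * (1 - 2 * s) := by
        apply mul_nonneg (mul_nonneg hKn hs0); linarith
      nlinarith
    · have : 0 ≤ |K| * (1 - s) * (2 * s - 1) := by
        apply mul_nonneg (mul_nonneg hKn hs1); linarith
      nlinarith

/-- Second derivative test at a maximum over a closed interval, endpoints included. -/
theorem second_deriv_nonpos_of_isMaxOn_Icc {a b y : ℝ} (hab : a < b) {g g' : ℝ → ℝ} {g'' : ℝ}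
    (hy : y ∈ Icc a b) (hg : ∀ z ∈ Icc a b, HasDerivWithinAt g (g' z) (Icc a b) z)
    (hg' : HasDerivWithinAt g' g'' (Icc a b) y) (h0 : g' y = 0) (hmax : IsMaxOn g (Icc a b) y) :
    g'' ≤ 0 := by
  by_contra! hpos
  have hcont : ContinuousOn g (Icc a b) := fun z hz => (hg z hz).continuousWithinAt
  have hslope := (hasDerivWithinAt_iff_tendsto_slope.1 hg').eventually (lt_mem_nhds hpos)
  rw [eventually_nhdsWithin_iff, Metric.eventually_nhds_iff] at hslope
  obtain ⟨δ, hδ, hs⟩ := hslope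
  have key : ∀ z ∈ Icc a b, |z - y| < δ → z ≠ y → 0 < (z - y)⁻¹ * g' z := by
    intro z hz hzy hne
    have := hs (y := z) (by rwa [Real.dist_eq]) ⟨hz, hne⟩
    simpa [slope_def_field, h0, div_eq_inv_mul] using this
  have hderiv : ∀ z ∈ Ioo a b, HasDerivAt g (g' z) z := fun z hz =>
    (hg z (Ioo_subset_Icc_self hz)).hasDerivAt (Icc_mem_nhds hz.1 hz.2)
  rcases hy.2.lt_or_eq with hlt | heq
  · set w := min b (y + δ / 2) with hw
    have hyw : y < w := lt_min hlt (by linarith)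
    have hwb : w ≤ b := min_le_left _ _
    have hwδ : w ≤ y + δ / 2 := min_le_right _ _
    obtain ⟨z, hz, hze⟩ := exists_hasDerivAt_eq_slope g g' hyw
      (hcont.mono (Icc_subset_Icc hy.1 hwb))
      (fun z hz => hderiv z ⟨hy.1.trans_lt hz.1, hz.2.trans_le hwb⟩)
    have h1 := key z ⟨hy.1.trans hz.1.le, hz.2.le.trans hwb⟩
      (by rw [abs_of_pos (sub_pos.2 hz.1)]; linarith [hz.2]) hz.1.ne'
    have h2 : 0 < g' z := (pos_iff_pos_of_mul_pos h1).1 (inv_pos.2 (sub_pos.2 hz.1))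
    have h3 : g w ≤ g y := hmax ⟨hy.1.trans hyw.le, hwb⟩
    rw [hze] at h2
    have := (div_pos_iff_of_pos_right (sub_pos.2 hyw)).1 h2
    linarith
  · subst heq
    set w := max a (y - δ / 2) with hw
    have hwy : w < y := max_lt hab (by linarith)
    have haw : a ≤ w := le_max_left _ _
    have hwδ : y - δ / 2 ≤ w := le_max_right _ _
    obtain ⟨z, hz, hze⟩ := exists_hasDerivAt_eq_slope g g' hwy
      (hcont.mono (Icc_subset_Icc haw le_rfl))
      (fun z hz => hderiv z ⟨haw.trans_lt hz.1, hz.2⟩)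
    have h1 := key z ⟨haw.trans hz.1.le, hz.2.le⟩
      (by rw [abs_of_neg (sub_neg.2 hz.2)]; linarith [hz.1]) hz.2.ne
    have h2 : g' z < 0 := (neg_iff_neg_of_mul_pos h1).1 (inv_lt_zero.2 (sub_neg.2 hz.2))
    have h3 : g w ≤ g y := hmax ⟨haw, hwy.le⟩
    rw [hze, div_neg_iff] at h2
    rcases h2 with h2 | h2 <;> linarith [h2.1, h2.2]

theorem deriv_nonneg_of_left_max {g : ℝ → ℝ} {g' s t : ℝ} (hst : s < t) (hg : HasDerivAt g g' t)
    (hmax : ∀ z ∈ Icc s t, g z ≤ g t) : 0 ≤ g' := by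
  have h := (hasDerivAt_iff_tendsto_slope_left_right.1 hg).1
  refine ge_of_tendsto h ?_
  filter_upwards [Ioo_mem_nhdsLT hst] with z hz
  rw [slope_def_field]
  exact div_nonneg_of_nonpos (by linarith [hmax z ⟨hz.1.le, hz.2.le⟩]) (by linarith [hz.2])

theorem deriv_nonpos_of_right_max {g : ℝ → ℝ} {g' s t : ℝ} (hst : s < t)
    (hg : HasDerivWithinAt g g' (Icc s t) s) (hmax : ∀ z ∈ Icc s t, g z ≤ g s) : g' ≤ 0 := by
  have h := hasDerivWithinAt_iff_tendsto_slope.1 hg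
  have : (𝓝[Icc s t \ {s}] s).NeBot := by
    rw [Icc_sdiff_left]
    exact left_nhdsWithin_Ioc_neBot hst
  refine le_of_tendsto h ?_
  filter_upwards [self_mem_nhdsWithin] with z hz
  rw [slope_def_field]
  exact div_nonpos_of_nonpos_of_nonneg (by linarith [hmax z hz.1]) (by linarith [hz.1.1])

theorem deriv_nonneg_of_left_max_within {g : ℝ → ℝ} {g' s t : ℝ} (hst : s < t)
    (hg : HasDerivWithinAt g g' (Icc s t) t) (hmax : ∀ z ∈ Icc s t, g z ≤ g t) : 0 ≤ g' := by
  have h := hasDerivWithinAt_iff_tendsto_slope.1 hg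
  have : (𝓝[Icc s t \ {t}] t).NeBot := by
    rw [Icc_sdiff_right]
    exact right_nhdsWithin_Ico_neBot hst
  refine ge_of_tendsto h ?_
  filter_upwards [self_mem_nhdsWithin] with z hz
  rw [slope_def_field]
  exact div_nonneg_of_nonpos (by linarith [hmax z hz.1]) (by linarith [hz.1.2])

/-- The two admissible boundary conditions on the walls, for a function `w` and its
`y`-derivative `wy`. -/
def WallBC (H : ℝ) (w wy : ℝ → ℝ → ℝ → ℝ) : Prop :=
  (∀ t, 0 < t → ∀ x, wy t x 0 = 0 ∧ wy t x H = 0) ∨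
    ∀ t, 0 < t → ∀ x, w t x 0 = w t x H ∧ wy t x 0 = wy t x H

theorem WallBC.deriv_eq_zero_of_isMax {H : ℝ} (hH : 0 < H) {w wy : ℝ → ℝ → ℝ → ℝ}
    (hbc : WallBC H w wy) {t x y : ℝ} (ht : 0 < t) (hy : y ∈ Icc 0 H)
    (hd : ∀ z ∈ Icc 0 H, HasDerivWithinAt (fun z => w t x z) (wy t x z) (Icc 0 H) z)
    (hmax : ∀ z ∈ Icc 0 H, w t x z ≤ w t x y) : wy t x y = 0 := by
  have h0 : (0 : ℝ) ∈ Icc 0 H := left_mem_Icc.2 hH.le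
  have h1 : H ∈ Icc 0 H := right_mem_Icc.2 hH.le
  by_cases hItg : y ∈ Ioo 0 H
  · refine IsLocalMax.hasDerivAt_eq_zero (f := fun z => w t x z) ?_
      ((hd y hy).hasDerivAt (Icc_mem_nhds hItg.1 hItg.2))
    filter_upwards [Icc_mem_nhds hItg.1 hItg.2] with z hz using hmax z hz
  · have hyend : y = 0 ∨ y = H := by
      rcases hy.1.eq_or_lt with h | h
      · exact Or.inl h.symm
      · exact Or.inr (le_antisymm hy.2 (not_lt.1 fun h' => hItg ⟨h, h'⟩))
    rcases hbc with hN | hP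
    · rcases hyend with rfl | rfl
      exacts [(hN t ht x).1, (hN t ht x).2]
    · obtain ⟨e1, e2⟩ := hP t ht x
      have hval : w t x y = w t x 0 ∧ w t x y = w t x H := by
        rcases hyend with rfl | rfl
        exacts [⟨rfl, e1⟩, ⟨e1.symm, rfl⟩]
      have l0 := deriv_nonpos_of_right_max hH (hd 0 h0) fun z hz => hval.1 ▸ hmax z hz
      have l1 := deriv_nonneg_of_left_max_within hH (hd H h1) fun z hz => hval.2 ▸ hmax z hz
      rcases hyend with rfl | rfl <;> linarith

/-- Maximum principle in the strip for bounded-above subsolutions. -/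
theorem nonpos_of_subsolution {κ H U K : ℝ} (hκ : 0 < κ) (hH : 0 < H) (hU : 0 ≤ U) (hK : 0 ≤ K)
    {u : ℝ → ℝ} (hu : ∀ y ∈ Icc 0 H, |u y| ≤ U) {w wt wx wy wxx wyy : ℝ → ℝ → ℝ → ℝ}
    (hcont : ContinuousOn (fun p : ℝ × ℝ × ℝ => w p.1 p.2.1 p.2.2) (Ici 0 ×ˢ univ ×ˢ Icc 0 H))
    (hle : ∀ t, 0 ≤ t → ∀ x, ∀ y ∈ Icc 0 H, w t x y ≤ 1)
    (hinit : ∀ x, ∀ y ∈ Icc 0 H, w 0 x y ≤ 0)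
    (ht : ∀ t, 0 < t → ∀ x, ∀ y ∈ Icc 0 H, HasDerivAt (fun s => w s x y) (wt t x y) t)
    (hx : ∀ t, 0 < t → ∀ x, ∀ y ∈ Icc 0 H, HasDerivAt (fun z => w t z y) (wx t x y) x)
    (hxx : ∀ t, 0 < t → ∀ x, ∀ y ∈ Icc 0 H, HasDerivAt (fun z => wx t z y) (wxx t x y) x)
    (hy : ∀ t, 0 < t → ∀ x, ∀ y ∈ Icc 0 H,
      HasDerivWithinAt (fun z => w t x z) (wy t x y) (Icc 0 H) y)
    (hyy : ∀ t, 0 < t → ∀ x, ∀ y ∈ Icc 0 H,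
      HasDerivWithinAt (fun z => wy t x z) (wyy t x y) (Icc 0 H) y)
    (hsub : ∀ t, 0 < t → ∀ x, ∀ y ∈ Icc 0 H, 0 < w t x y →
      wt t x y + u y * wx t x y ≤ κ * (wxx t x y + wyy t x y) + K * w t x y)
    (hbc : WallBC H w wy) :
    ∀ t, 0 ≤ t → ∀ x, ∀ y ∈ Icc 0 H, w t x y ≤ 0 := by
  intro t₀ ht₀ x₀ y₀ hy₀
  by_contra! hpos
  set M := K + U + 2 * κ + 1 with hM
  set ε := Real.exp (-M * t₀) * w t₀ x₀ y₀ / (2 * (1 + x₀ ^ 2)) with hε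
  have hεpos : 0 < ε := by positivity
  have hε0 : ε * (1 + x₀ ^ 2) < Real.exp (-M * t₀) * w t₀ x₀ y₀ := by
    have h1 : ε * (1 + x₀ ^ 2) = Real.exp (-M * t₀) * w t₀ x₀ y₀ / 2 := by
      rw [hε]; field_simp
    have h2 : 0 < Real.exp (-M * t₀) * w t₀ x₀ y₀ := by positivity
    linarith
  set X := |x₀| + 1 / ε + 1 with hX
  have hXpos : 0 < X := by positivity
  have hX1 : 1 < ε * (1 + X ^ 2) := by
    have h1 : 1 / ε ≤ X := by have := abs_nonneg x₀; linarith
    have h2 : 1 ≤ X := by have := abs_nonneg x₀; have : 0 < 1 / ε := by positivity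
                          linarith
    have h3 : 1 ≤ ε * X := by
      have := mul_le_mul_of_nonneg_left h1 hεpos.le
      rwa [mul_one_div_cancel hεpos.ne'] at this
    nlinarith
  let W : ℝ × ℝ × ℝ → ℝ := fun p => Real.exp (-M * p.1) * w p.1 p.2.1 p.2.2 - ε * (1 + p.2.1 ^ 2)
  set D : Set (ℝ × ℝ × ℝ) := Icc 0 t₀ ×ˢ Icc (-X) X ×ˢ Icc 0 H with hD
  have hDc : IsCompact D := isCompact_Icc.prod (isCompact_Icc.prod isCompact_Icc)
  have hDsub : D ⊆ Ici 0 ×ˢ univ ×ˢ Icc 0 H := fun p hp => ⟨hp.1.1, trivial, hp.2.2⟩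
  have hWc : ContinuousOn W D :=
    ((Continuous.continuousOn (by fun_prop)).mul (hcont.mono hDsub)).sub
      (Continuous.continuousOn (by fun_prop))
  have hmem₀ : (t₀, x₀, y₀) ∈ D := by
    refine ⟨⟨ht₀, le_rfl⟩, ⟨?_, ?_⟩, hy₀⟩
    · have := neg_abs_le x₀; have : 0 < 1 / ε := by positivity
      simp only [hX]; linarith
    · have := le_abs_self x₀; have : 0 < 1 / ε := by positivity
      simp only [hX]; linarith
  obtain ⟨⟨t, x, y⟩, hmem, hmax⟩ := hDc.exists_isMaxOn ⟨_, hmem₀⟩ hWc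
  have hmax' : ∀ s ∈ Icc 0 t₀, ∀ z ∈ Icc (-X) X, ∀ v ∈ Icc 0 H, W (s, z, v) ≤ W (t, x, y) :=
    fun s hs z hz v hv => hmax (show (s, z, v) ∈ D from ⟨hs, hz, hv⟩)
  obtain ⟨htm, hxm, hym⟩ : t ∈ Icc 0 t₀ ∧ x ∈ Icc (-X) X ∧ y ∈ Icc 0 H := hmem
  have hWpos : 0 < W (t, x, y) := by
    have := hmax' t₀ ⟨ht₀, le_rfl⟩ x₀ hmem₀.2.1 y₀ hy₀
    simp only [W] at this ⊢
    linarith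
  have hMpos : 0 < M := by positivity
  have htpos : 0 < t := by
    rcases htm.1.eq_or_lt with h | h
    · exfalso
      subst h
      have h1 := hinit x y hym
      have h2 : 0 < ε * (1 + x ^ 2) := by positivity
      simp only [W, mul_zero, Real.exp_zero, one_mul] at hWpos
      linarith
    · exact h
  have hwgt : ε * (1 + x ^ 2) < Real.exp (-M * t) * w t x y := by
    simp only [W] at hWpos; linarith
  have hexp : 0 < Real.exp (-M * t) := Real.exp_pos _
  have hwpos : 0 < w t x y := by
    have : 0 < Real.exp (-M * t) * w t x y := lt_trans (by positivity) hwgt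
    exact pos_of_mul_pos_right this hexp.le
  have hxint : x ∈ Ioo (-X) X := by
    have hx2 : x ^ 2 < X ^ 2 := by
      have h1 : Real.exp (-M * t) * w t x y ≤ 1 := by
        have e1 : Real.exp (-M * t) ≤ 1 := Real.exp_le_one_iff.2 (by nlinarith)
        have := hle t htpos.le x y hym
        nlinarith
      by_contra! h
      have := mul_le_mul_of_nonneg_left h hεpos.le
      linarith
    exact abs_lt.1 (abs_lt_of_sq_lt_sq hx2 hXpos.le)
  have dt' : HasDerivAt (fun s => W (s, x, y))
      (Real.exp (-M * t) * (wt t x y - M * w t x y)) t := by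
    have h1 : HasDerivAt (fun s : ℝ => Real.exp (-M * s)) (Real.exp (-M * t) * (-M * 1)) t :=
      ((hasDerivAt_id t).const_mul (-M)).exp
    refine ((h1.mul (ht t htpos x y hym)).sub_const (ε * (1 + x ^ 2))).congr_deriv ?_
    ring
  have it : 0 ≤ Real.exp (-M * t) * (wt t x y - M * w t x y) :=
    deriv_nonneg_of_left_max htpos dt' fun s hs => hmax' s ⟨hs.1, hs.2.trans htm.2⟩ x hxm y hym
  have dx' : ∀ z, HasDerivAt (fun z => W (t, z, y))
      (Real.exp (-M * t) * wx t z y - ε * (2 * z)) z := by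
    intro z
    refine (((hx t htpos z y hym).const_mul (Real.exp (-M * t))).sub
      ((((hasDerivAt_id z).pow 2).const_add 1).const_mul ε)).congr_deriv ?_
    simp
  have ix : Real.exp (-M * t) * wx t x y - ε * (2 * x) = 0 := by
    refine IsLocalMax.hasDerivAt_eq_zero ?_ (dx' x)
    filter_upwards [Icc_mem_nhds hxint.1 hxint.2] with z hz using hmax' t htm z hz y hym
  have ixx : Real.exp (-M * t) * wxx t x y - ε * 2 ≤ 0 := by
    refine second_deriv_nonpos_of_isMaxOn_Icc (by linarith : -X < X) hxm
      (fun z _ => (dx' z).hasDerivWithinAt) (HasDerivAt.hasDerivWithinAt ?_) ix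
      (fun z hz => hmax' t htm z hz y hym)
    refine (((hxx t htpos x y hym).const_mul (Real.exp (-M * t))).sub
      (((hasDerivAt_id x).const_mul 2).const_mul ε)).congr_deriv ?_
    simp
  have hymax : ∀ z ∈ Icc 0 H, w t x z ≤ w t x y := by
    intro z hz
    have := hmax' t htm x hxm z hz
    simp only [W] at this
    exact le_of_mul_le_mul_left (by linarith) hexp
  have iyy : wyy t x y ≤ 0 :=
    second_deriv_nonpos_of_isMaxOn_Icc hH hym (hy t htpos x) (hyy t htpos x y hym)
      (hbc.deriv_eq_zero_of_isMax hH htpos hym (hy t htpos x) hymax) hymax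
  have hs := mul_le_mul_of_nonneg_left (hsub t htpos x y hym hwpos) hexp.le
  have huy := abs_le.1 (hu y hym)
  have hux : -(U * (1 + x ^ 2)) ≤ 2 * (u y * x) := by
    have h1 : |2 * (u y * x)| ≤ U * (1 + x ^ 2) := by
      have h3 : |2 * x| ≤ 1 + x ^ 2 := by
        rw [abs_le]; constructor <;> nlinarith [sq_nonneg (x + 1), sq_nonneg (x - 1)]
      calc |2 * (u y * x)| = |u y| * |2 * x| := by rw [← abs_mul]; ring_nf
        _ ≤ U * (1 + x ^ 2) := mul_le_mul (hu y hym) h3 (abs_nonneg _) hU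
    exact (abs_le.1 h1).1
  have iyy' : κ * (Real.exp (-M * t) * wyy t x y) ≤ 0 :=
    mul_nonpos_of_nonneg_of_nonpos hκ.le (mul_nonpos_of_nonneg_of_nonpos hexp.le iyy)
  have ixx' := mul_le_mul_of_nonneg_left ixx hκ.le
  have eux : Real.exp (-M * t) * (u y * wx t x y) = ε * (2 * (u y * x)) := by
    have : Real.exp (-M * t) * wx t x y = ε * (2 * x) := by linarith
    calc _ = u y * (Real.exp (-M * t) * wx t x y) := by ring
      _ = _ := by rw [this]; ring
  have hux' := mul_le_mul_of_nonneg_left hux hεpos.le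
  have hMw : (U + 2 * κ + 1) * (ε * (1 + x ^ 2)) ≤
      (U + 2 * κ + 1) * (Real.exp (-M * t) * w t x y) :=
    mul_le_mul_of_nonneg_left hwgt.le (by positivity)
  have p1 : 0 < ε * (1 + x ^ 2) := by positivity
  have p2 : 0 ≤ ε * κ * x ^ 2 := by positivity
  simp only [hM] at *
  nlinarith

theorem exp_bound_of_subsolution {κ H U K A lam : ℝ} (hκ : 0 < κ) (hH : 0 < H) (hU : 0 ≤ U)
    (hK : 0 ≤ K) (hA : 0 ≤ A)
    {u : ℝ → ℝ} (hu : ∀ y ∈ Icc 0 H, |u y| ≤ U) {w wt wx wy wxx wyy : ℝ → ℝ → ℝ → ℝ}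
    (hcont : ContinuousOn (fun p : ℝ × ℝ × ℝ => w p.1 p.2.1 p.2.2) (Ici 0 ×ˢ univ ×ˢ Icc 0 H))
    (hle : ∀ t, 0 ≤ t → ∀ x, ∀ y ∈ Icc 0 H, w t x y ≤ 1)
    (hinit : ∀ x, ∀ y ∈ Icc 0 H, w 0 x y ≤ A * Real.exp (-lam * x))
    (ht : ∀ t, 0 < t → ∀ x, ∀ y ∈ Icc 0 H, HasDerivAt (fun s => w s x y) (wt t x y) t)
    (hx : ∀ t, 0 < t → ∀ x, ∀ y ∈ Icc 0 H, HasDerivAt (fun z => w t z y) (wx t x y) x)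
    (hxx : ∀ t, 0 < t → ∀ x, ∀ y ∈ Icc 0 H, HasDerivAt (fun z => wx t z y) (wxx t x y) x)
    (hy : ∀ t, 0 < t → ∀ x, ∀ y ∈ Icc 0 H,
      HasDerivWithinAt (fun z => w t x z) (wy t x y) (Icc 0 H) y)
    (hyy : ∀ t, 0 < t → ∀ x, ∀ y ∈ Icc 0 H,
      HasDerivWithinAt (fun z => wy t x z) (wyy t x y) (Icc 0 H) y)
    (hsub : ∀ t, 0 < t → ∀ x, ∀ y ∈ Icc 0 H,
      wt t x y + u y * wx t x y ≤ κ * (wxx t x y + wyy t x y) + K * w t x y)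
    (hbc : WallBC H w wy) :
    ∀ t, 0 ≤ t → ∀ x, ∀ y ∈ Icc 0 H,
      w t x y ≤ A * Real.exp (-lam * x + (K + |lam| * U + κ * lam ^ 2) * t) := by
  set μ := K + |lam| * U + κ * lam ^ 2 with hμ
  let E : ℝ → ℝ → ℝ := fun t x => A * Real.exp (-lam * x + μ * t)
  have hE : ∀ t x, 0 ≤ E t x := fun t x => by positivity
  have hEt : ∀ t x, HasDerivAt (fun s => E s x) (μ * E t x) t := by
    intro t x
    refine ((((hasDerivAt_id t).const_mul μ).const_add (-lam * x)).exp.const_mul A).congr_deriv ?_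
    simp only [E, id]; ring
  have hEx : ∀ t x, HasDerivAt (fun z => E t z) (-lam * E t x) x := by
    intro t x
    refine ((((hasDerivAt_id x).const_mul (-lam)).add_const (μ * t)).exp.const_mul
      A).congr_deriv ?_
    simp only [E, id]; ring
  have key := nonpos_of_subsolution (w := fun t x y => w t x y - E t x)
    (wt := fun t x y => wt t x y - μ * E t x) (wx := fun t x y => wx t x y - -lam * E t x)
    (wxx := fun t x y => wxx t x y - -lam * (-lam * E t x)) (wy := wy) (wyy := wyy)
    hκ hH hU hK hu (hcont.sub (Continuous.continuousOn (by fun_prop)))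
    (fun t h x y hy => by have := hle t h x y hy; have := hE t x; linarith)
    (fun x y hy => by have := hinit x y hy; simp only [E]; simpa using this)
    (fun t h x y hy => (ht t h x y hy).sub (hEt t x))
    (fun t h x y hy => (hx t h x y hy).sub (hEx t x))
    (fun t h x y hy => (hxx t h x y hy).sub ((hEx t x).const_mul _))
    (fun t h x y hyH => (hy t h x y hyH).sub_const _)
    hyy
    (fun t h x y hyH _ => by
      have h1 := hsub t h x y hyH
      have h2 : lam * u y ≤ |lam| * U := by
        calc lam * u y ≤ |lam * u y| := le_abs_self _
          _ = |lam| * |u y| := abs_mul _ _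
          _ ≤ |lam| * U := mul_le_mul_of_nonneg_left (hu y hyH) (abs_nonneg _)
      have h3 := mul_le_mul_of_nonneg_right h2 (hE t x)
      simp only [hμ]
      nlinarith)
    (by
      rcases hbc with h | h
      · exact Or.inl h
      · exact Or.inr fun t ht x => ⟨by simp only [(h t ht x).1], (h t ht x).2⟩)
  intro t ht x y hy
  have := key t ht x y hy
  simp only [E] at this
  linarith

theorem IsClassicalSolution.exists_decay {f u : ℝ → ℝ} {κ v₀ H L : ℝ} {T : ℝ → ℝ → ℝ → ℝ}
    (hκ : 0 < κ) (hH : 0 < H) (hu : ContinuousOn u (Icc 0 H))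
    (hL : 0 ≤ L) (hf0 : ∀ s ∈ Icc (0 : ℝ) 1, 0 ≤ f s) (hfL : ∀ s ∈ Icc (0 : ℝ) 1, f s ≤ L * s)
    (hT : IsClassicalSolution f κ v₀ H u T) (hbc : NeumannBC H T ∨ PeriodicBC H T)
    (hinit : InitiallyLocalized H T) (τ : ℝ) :
    ∃ A > 0, ∃ lam > 0, ∀ t, 0 ≤ t → t ≤ τ → ∀ x, ∀ y ∈ Icc 0 H,
      T t x y ≤ A * Real.exp (-lam * x) ∧ 1 - T t x y ≤ A * Real.exp (lam * x) := by
  obtain ⟨lam, hlam, C₀, hC₀, hloc⟩ := hinit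
  obtain ⟨U, hU⟩ := isCompact_Icc.exists_bound_of_continuousOn hu
  have hU0 : 0 ≤ U := (norm_nonneg _).trans (hU 0 (left_mem_Icc.2 hH.le))
  have hk : 0 ≤ v₀ ^ 2 / (4 * κ) := by positivity
  set K := v₀ ^ 2 / (4 * κ) * L with hKdef
  have hK : 0 ≤ K := mul_nonneg hk hL
  set μ := K + |lam| * U + κ * lam ^ 2 with hμ
  have hμ0 : 0 ≤ μ := by positivity
  have hwall : WallBC H T (dy H T) := hbc
  have hy : ∀ t, 0 < t → ∀ x, ∀ y ∈ Icc 0 H,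
      HasDerivWithinAt (fun z => T t x z) (dy H T t x y) (Icc 0 H) y := fun t h x y hy =>
    (hT.differentiable_y t h x y hy).hasDerivWithinAt
  have hyy : ∀ t, 0 < t → ∀ x, ∀ y ∈ Icc 0 H,
      HasDerivWithinAt (fun z => dy H T t x z) (dy H (dy H T) t x y) (Icc 0 H) y :=
    fun t h x y hy => (hT.differentiable_yy t h x y hy).hasDerivWithinAt
  have b1 := exp_bound_of_subsolution (A := C₀ + 1) (lam := lam) (K := K) hκ hH hU0 hK
    (by positivity) hU hT.continuousOn (fun t h x y hy => (hT.mem_Icc t h x y hy).2)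
    (fun x y hy => by
      rcases lt_or_ge 0 x with h | h
      · have := ((hloc x y hy).2.1 h)
        have e := Real.exp_pos (-lam * x)
        linarith
      · have h1 := (hT.mem_Icc 0 le_rfl x y hy).2
        have h2 : 1 ≤ Real.exp (-lam * x) := Real.one_le_exp (by nlinarith)
        nlinarith)
    (fun t h x y hy => (hT.differentiable_t t h x y hy).hasDerivAt)
    (fun t h x y hy => (hT.differentiable_x t h x y hy).hasDerivAt)
    (fun t h x y hy => (hT.differentiable_xx t h x y hy).hasDerivAt) hy hyy
    (fun t h x y hy => by
      have e := hT.equation t h x y hy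
      have := mul_le_mul_of_nonneg_left (hfL _ (hT.mem_Icc t h.le x y hy)) hk
      simp only [dx, dt] at e ⊢
      rw [e, hKdef]; linarith)
    hwall
  have b2 := exp_bound_of_subsolution (A := C₀ + 1) (lam := -lam) (K := K)
    (w := fun t x y => 1 - T t x y) (wt := fun t x y => -dt T t x y)
    (wx := fun t x y => -dx T t x y) (wxx := fun t x y => -dx (dx T) t x y)
    (wy := fun t x y => -dy H T t x y) (wyy := fun t x y => -dy H (dy H T) t x y)
    hκ hH hU0 hK (by positivity) hU (continuousOn_const.sub hT.continuousOn)
    (fun t h x y hy => by linarith [(hT.mem_Icc t h x y hy).1])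
    (fun x y hy => by
      rw [neg_neg]
      rcases lt_or_ge x 0 with h | h
      · have := ((hloc x y hy).1 h)
        have e := Real.exp_pos (lam * x)
        linarith
      · have h1 := (hT.mem_Icc 0 le_rfl x y hy).1
        have h2 : 1 ≤ Real.exp (lam * x) := Real.one_le_exp (by positivity)
        nlinarith)
    (fun t h x y hy => (hT.differentiable_t t h x y hy).hasDerivAt.const_sub 1)
    (fun t h x y hy => (hT.differentiable_x t h x y hy).hasDerivAt.const_sub 1)
    (fun t h x y hy => (hT.differentiable_xx t h x y hy).hasDerivAt.neg)
    (fun t h x y hyH => (hy t h x y hyH).const_sub 1)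
    (fun t h x y hyH => (hyy t h x y hyH).neg)
    (fun t h x y hy => by
      have e := hT.equation t h x y hy
      have h1 := mul_nonneg hk (hf0 _ (hT.mem_Icc t h.le x y hy))
      have h2 := mul_nonneg hK (sub_nonneg.2 (hT.mem_Icc t h.le x y hy).2)
      linarith)
    (by
      rcases hwall with h | h
      · exact Or.inl fun t ht x => by simpa using h t ht x
      · exact Or.inr fun t ht x => by simpa using h t ht x)
  refine ⟨(C₀ + 1) * Real.exp (μ * τ), by positivity, lam, hlam, fun t h0 hτ x y hy => ⟨?_, ?_⟩⟩
  · refine (b1 t h0 x y hy).trans ?_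
    rw [mul_assoc, ← Real.exp_add]
    refine mul_le_mul_of_nonneg_left (Real.exp_le_exp.2 ?_) (by positivity)
    have := mul_le_mul_of_nonneg_left hτ hμ0
    linarith
  · refine (b2 t h0 x y hy).trans ?_
    rw [mul_assoc, ← Real.exp_add, abs_neg, neg_neg, neg_sq, ← hμ]
    refine mul_le_mul_of_nonneg_left (Real.exp_le_exp.2 ?_) (by positivity)
    have := mul_le_mul_of_nonneg_left hτ hμ0
    linarith

/-- The rectangle `[-R, R] × [a, b]`. -/
def box (R a b : ℝ) : Set (ℝ × ℝ) := Icc (-R) R ×ˢ Icc a b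

theorem isCompact_box (R a b : ℝ) : IsCompact (box R a b) := isCompact_Icc.prod isCompact_Icc

theorem measurableSet_box (R a b : ℝ) : MeasurableSet (box R a b) :=
  measurableSet_Icc.prod measurableSet_Icc

theorem integrableOn_box {R a b : ℝ} {g : ℝ × ℝ → ℝ} (hg : Continuous g) :
    IntegrableOn g (box R a b) :=
  hg.continuousOn.integrableOn_compact (isCompact_box R a b)

theorem continuous_integral_box {X : Type*} [TopologicalSpace X] [FirstCountableTopology X]
    [LocallyCompactSpace X] {R a b : ℝ} {F : X → ℝ × ℝ → ℝ}
    (hF : Continuous fun q : X × ℝ × ℝ => F q.1 q.2) :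
    Continuous fun t => ∫ p in box R a b, F t p :=
  continuous_parametric_integral_of_continuous hF (isCompact_box R a b)

theorem integral_box_eq_iterated {R a b : ℝ} (hR : 0 ≤ R) (hab : a ≤ b) {g : ℝ × ℝ → ℝ}
    (hg : Continuous g) :
    ∫ p in box R a b, g p = ∫ x in (-R)..R, ∫ y in a..b, g (x, y) := by
  rw [intervalIntegral.integral_of_le (by linarith), ← integral_Icc_eq_integral_Ioc]
  simp_rw [intervalIntegral.integral_of_le hab, ← integral_Icc_eq_integral_Ioc]
  exact setIntegral_prod g (integrableOn_box hg)

theorem integral_box_eq_iterated_symm {R a b : ℝ} (hR : 0 ≤ R) (hab : a ≤ b) {g : ℝ × ℝ → ℝ}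
    (hg : Continuous g) :
    ∫ p in box R a b, g p = ∫ y in a..b, ∫ x in (-R)..R, g (x, y) := by
  rw [intervalIntegral.integral_of_le hab, ← integral_Icc_eq_integral_Ioc]
  simp_rw [intervalIntegral.integral_of_le (show -R ≤ R by linarith),
    ← integral_Icc_eq_integral_Ioc]
  have h := integrableOn_box (R := R) (a := a) (b := b) hg
  unfold box IntegrableOn at *
  rw [Measure.volume_eq_prod, ← Measure.prod_restrict] at *
  exact integral_prod_symm g h

theorem integral_box_divergence_eq_zero {R a b : ℝ} (hR : 0 ≤ R) (hab : a ≤ b)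
    {X Xx Y Yy : ℝ × ℝ → ℝ} (cXx : Continuous Xx) (cY : Continuous Y)
    (cYy : Continuous Yy)
    (hX : ∀ x y, HasDerivAt (fun z => X (z, y)) (Xx (x, y)) x)
    (hXb : ∀ y, X (-R, y) = X (R, y))
    (hY : ∀ x, ∀ y ∈ Ioo a b, HasDerivAt (fun z => Y (x, z)) (Yy (x, y)) y)
    (hYb : ∀ x, Y (x, a) = Y (x, b)) :
    ∫ p in box R a b, (Xx p + Yy p) = 0 := by
  rw [integral_add (integrableOn_box cXx) (integrableOn_box cYy),
    integral_box_eq_iterated_symm hR hab cXx, integral_box_eq_iterated hR hab cYy]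
  have h1 : ∀ y, ∫ x in (-R)..R, Xx (x, y) = 0 := by
    intro y
    rw [intervalIntegral.integral_eq_sub_of_hasDerivAt (fun x _ => hX x y)
      (Continuous.intervalIntegrable (by fun_prop) _ _), hXb, sub_self]
  have h2 : ∀ x, ∫ y in a..b, Yy (x, y) = 0 := by
    intro x
    rw [intervalIntegral.integral_eq_sub_of_hasDerivAt_of_le hab
      (Continuous.continuousOn (by fun_prop)) (hY x)
      (Continuous.intervalIntegrable (by fun_prop) _ _), hYb, sub_self]
  simp [h1, h2]

theorem integral_box_sub_eq_integral_deriv {R a b s t : ℝ} (hst : s ≤ t) {F Ft : ℝ × ℝ × ℝ → ℝ}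
    (cF : Continuous F) (cFt : Continuous Ft)
    (hF : ∀ r ∈ Ioo s t, ∀ p, HasDerivAt (fun z => F (z, p)) (Ft (r, p)) r) :
    (∫ p in box R a b, F (t, p)) - ∫ p in box R a b, F (s, p) =
      ∫ r in s..t, ∫ p in box R a b, Ft (r, p) := by
  rw [← integral_sub (integrableOn_box (by fun_prop)) (integrableOn_box (by fun_prop)),
    intervalIntegral_integral_swap]
  · refine integral_congr_ae (Eventually.of_forall fun p => ?_)
    exact (intervalIntegral.integral_eq_sub_of_hasDerivAt_of_le hst
      (Continuous.continuousOn (by fun_prop)) (fun r hr => hF r hr p)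
      (Continuous.intervalIntegrable (by fun_prop) _ _)).symm
  · rw [Measure.prod_restrict, uIoc_of_le hst]
    refine IntegrableOn.mono_set (t := Icc s t ×ˢ box R a b) ?_
      (prod_mono Ioc_subset_Icc_self le_rfl)
    exact cFt.continuousOn.integrableOn_compact (isCompact_Icc.prod (isCompact_box R a b))

/-- One-sided comparison: an increment bound with frozen first argument integrates along the
diagonal. -/
theorem sub_le_integral_diagonal {g : ℝ → ℝ} {m : ℝ × ℝ → ℝ} {a b : ℝ} (hab : a ≤ b)
    (hg : ContinuousOn g (Icc a b)) (hm : Continuous m)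
    (h : ∀ s ∈ Icc a b, ∀ t ∈ Icc a b, s ≤ t → g t - g s ≤ ∫ r in s..t, m (t, r)) :
    g b - g a ≤ ∫ r in a..b, m (r, r) := by
  have cd : Continuous fun r => m (r, r) := by fun_prop
  have key := image_le_of_liminf_slope_right_le_deriv_boundary (f := fun t => g t - g a) (a := a)
    (b := b) (hg.sub continuousOn_const) (B := fun t => ∫ r in a..t, m (r, r))
    (B' := fun t => m (t, t)) (by simp)
    (fun t _ => (cd.integral_hasStrictDerivAt a t).hasDerivAt.continuousAt.continuousWithinAt)
    (fun t _ => (cd.integral_hasStrictDerivAt a t).hasDerivAt.hasDerivWithinAt)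
    (by
      intro x hx r hr
      apply Eventually.frequently
      obtain ⟨q, hq1, hq2⟩ := exists_between hr
      have hev : ∀ᶠ p in 𝓝 (x, x), m p < q := hm.continuousAt.eventually (gt_mem_nhds hq1)
      rw [Metric.eventually_nhds_iff] at hev
      obtain ⟨δ, hδ, hev⟩ := hev
      have hlt : x < min b (x + δ) := lt_min hx.2 (by linarith)
      filter_upwards [Ioo_mem_nhdsGT hlt] with z hz
      have hzb : z < b := hz.2.trans_le (min_le_left _ _)
      have hzδ : z < x + δ := hz.2.trans_le (min_le_right _ _)
      have h1 := h x ⟨hx.1, hx.2.le⟩ z ⟨hx.1.trans hz.1.le, hzb.le⟩ hz.1.le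
      have h2 : ∫ r in x..z, m (z, r) ≤ ∫ _ in x..z, q := by
        refine intervalIntegral.integral_mono_on hz.1.le
          (Continuous.intervalIntegrable (by fun_prop) _ _) (by simp) fun s hs => ?_
        refine (hev ?_).le
        rw [Prod.dist_eq, Real.dist_eq, Real.dist_eq]
        refine max_lt ?_ ?_ <;> rw [abs_of_nonneg (by linarith [hz.1, hs.1])] <;>
          linarith [hs.2]
      rw [intervalIntegral.integral_const, smul_eq_mul] at h2
      rw [slope_def_field, div_lt_iff₀ (sub_pos.2 hz.1)]
      nlinarith [hz.1])
  exact key (right_mem_Icc.2 hab)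

theorem exists_mul_le_integral {g : ℝ → ℝ} (hg : Continuous g) {a b : ℝ} (hab : a < b) :
    ∃ t ∈ Icc a b, (b - a) * g t ≤ ∫ s in a..b, g s := by
  obtain ⟨t, ht, hmin⟩ := isCompact_Icc.exists_isMinOn (nonempty_Icc.2 hab.le) hg.continuousOn
  refine ⟨t, ht, ?_⟩
  have := intervalIntegral.integral_mono_on (f := fun _ => g t) (μ := volume) hab.le
    intervalIntegrable_const
    (hg.intervalIntegrable a b) fun s hs => hmin hs
  simpa using this

/-- A solution of `T_t + u T_x = κ (T_xx + T_yy) + r` in `[0,H]` for `t ≥ a`, extended to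
continuous functions on all of `ℝ³` together with its derivatives. Arguments are `(t, x, y)`. -/
structure IsExtendedSolution (κ H a : ℝ) (u : ℝ → ℝ) (r T Tt Tx Ty Txx Tyy : ℝ × ℝ × ℝ → ℝ) :
    Prop where
  cu : Continuous u
  cr : Continuous r
  cT : Continuous T
  cTt : Continuous Tt
  cTx : Continuous Tx
  cTy : Continuous Ty
  cTxx : Continuous Txx
  cTyy : Continuous Tyy
  mem : ∀ q, T q ∈ Icc (0 : ℝ) 1
  ht : ∀ t, a < t → ∀ p, HasDerivAt (fun s => T (s, p)) (Tt (t, p)) t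
  hx : ∀ t x y, HasDerivAt (fun z => T (t, z, y)) (Tx (t, x, y)) x
  hxx : ∀ t x y, HasDerivAt (fun z => Tx (t, z, y)) (Txx (t, x, y)) x
  hy : ∀ t x, ∀ y ∈ Ioo 0 H, HasDerivAt (fun z => T (t, x, z)) (Ty (t, x, y)) y
  hyy : ∀ t x, ∀ y ∈ Ioo 0 H, HasDerivAt (fun z => Ty (t, x, z)) (Tyy (t, x, y)) y
  eq : ∀ t x y, Tt (t, x, y) + u y * Tx (t, x, y) =
    κ * (Txx (t, x, y) + Tyy (t, x, y)) + r (t, x, y)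
  bc : (∀ t x, Ty (t, x, 0) = 0 ∧ Ty (t, x, H) = 0) ∨
    ∀ t x, T (t, x, 0) = T (t, x, H) ∧ Ty (t, x, 0) = Ty (t, x, H)

/-- A `C²` weight on `[-R, R]` vanishing to first order at the endpoints. -/
structure IsCutoff (R : ℝ) (ω ω' ω'' : ℝ → ℝ) : Prop where
  hd : ∀ x, HasDerivAt ω (ω' x) x
  hd' : ∀ x, HasDerivAt ω' (ω'' x) x
  cont'' : Continuous ω''
  left : ω (-R) = 0
  right : ω R = 0
  left' : ω' (-R) = 0
  right' : ω' R = 0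

theorem IsCutoff.cont {R : ℝ} {ω ω' ω'' : ℝ → ℝ} (h : IsCutoff R ω ω' ω'') : Continuous ω :=
  continuous_iff_continuousAt.2 fun x => (h.hd x).continuousAt

theorem IsCutoff.cont' {R : ℝ} {ω ω' ω'' : ℝ → ℝ} (h : IsCutoff R ω ω' ω'') : Continuous ω' :=
  continuous_iff_continuousAt.2 fun x => (h.hd' x).continuousAt

/-- A `C²` function with its first two derivatives. -/
structure IsC2 (φ φ' φ'' : ℝ → ℝ) : Prop where
  hd : ∀ s, HasDerivAt φ (φ' s) s
  hd' : ∀ s, HasDerivAt φ' (φ'' s) s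
  cont'' : Continuous φ''

theorem IsC2.cont {φ φ' φ'' : ℝ → ℝ} (h : IsC2 φ φ' φ'') : Continuous φ :=
  continuous_iff_continuousAt.2 fun x => (h.hd x).continuousAt

theorem IsC2.cont' {φ φ' φ'' : ℝ → ℝ} (h : IsC2 φ φ' φ'') : Continuous φ' :=
  continuous_iff_continuousAt.2 fun x => (h.hd' x).continuousAt

/-- The right-hand side obtained by testing the equation with `ω(x) G(y) φ'(T)` and integrating
by parts. -/
def testIntegrand (κ : ℝ) (u : ℝ → ℝ) (r T Tx Ty : ℝ × ℝ × ℝ → ℝ)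
    (ω ω' ω'' G G' φ φ' φ'' : ℝ → ℝ) (q : ℝ × ℝ × ℝ) : ℝ :=
  u q.2.2 * G q.2.2 * ω' q.2.1 * φ (T q) + κ * ω'' q.2.1 * G q.2.2 * φ (T q)
    - κ * ω q.2.1 * G q.2.2 * φ'' (T q) * (Tx q ^ 2 + Ty q ^ 2)
    - κ * ω q.2.1 * G' q.2.2 * φ' (T q) * Ty q + ω q.2.1 * G q.2.2 * φ' (T q) * r q

namespace IsExtendedSolution

variable {κ H a : ℝ} {u : ℝ → ℝ} {r T Tt Tx Ty Txx Tyy : ℝ × ℝ × ℝ → ℝ}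

theorem continuous_testIntegrand (h : IsExtendedSolution κ H a u r T Tt Tx Ty Txx Tyy)
    {R : ℝ} {ω ω' ω'' G G' φ φ' φ'' : ℝ → ℝ} (hω : IsCutoff R ω ω' ω'') (cG : Continuous G)
    (cG' : Continuous G') (hφ : IsC2 φ φ' φ'') :
    Continuous (testIntegrand κ u r T Tx Ty ω ω' ω'' G G' φ φ' φ'') := by
  have := h.cu; have := h.cr; have := h.cT; have := h.cTx; have := h.cTy
  have := hω.cont; have := hω.cont'; have := hω.cont''
  have := hφ.cont; have := hφ.cont'; have := hφ.cont''
  unfold testIntegrand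
  fun_prop

theorem integral_test (h : IsExtendedSolution κ H a u r T Tt Tx Ty Txx Tyy) {R α β : ℝ}
    (hR : 0 ≤ R) (hα : 0 ≤ α) (hαβ : α ≤ β) (hβ : β ≤ H) {ω ω' ω'' G G' φ φ' φ'' : ℝ → ℝ}
    (hω : IsCutoff R ω ω' ω'') (hG : ∀ y, HasDerivAt G (G' y) y) (cG' : Continuous G')
    (hφ : IsC2 φ φ' φ'') (t : ℝ)
    (hb : ∀ x, G α * φ' (T (t, x, α)) * Ty (t, x, α) = G β * φ' (T (t, x, β)) * Ty (t, x, β)) :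
    ∫ p in box R α β, ω p.1 * G p.2 * φ' (T (t, p)) * Tt (t, p) =
      ∫ p in box R α β, testIntegrand κ u r T Tx Ty ω ω' ω'' G G' φ φ' φ'' (t, p) := by
  have := h.cu; have := h.cT; have := h.cTx; have := h.cTy; have := h.cTt
  have := h.cTxx; have := h.cTyy
  have := hω.cont; have := hω.cont'; have := hω.cont''
  have := hφ.cont; have := hφ.cont'; have := hφ.cont''
  have cG : Continuous G := continuous_iff_continuousAt.2 fun y => (hG y).continuousAt
  have cI := h.continuous_testIntegrand hω cG cG' hφ
  rw [← sub_eq_zero, ← integral_sub (integrableOn_box (by fun_prop))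
    (integrableOn_box (by fun_prop))]
  have hdiv := integral_box_divergence_eq_zero (R := R) (a := α) (b := β) hR hαβ
    (X := fun p => κ * (ω p.1 * G p.2 * φ' (T (t, p)) * Tx (t, p) - ω' p.1 * G p.2 * φ (T (t, p)))
      - u p.2 * G p.2 * (ω p.1 * φ (T (t, p))))
    (Xx := fun p => κ * (ω p.1 * G p.2 * (φ'' (T (t, p)) * Tx (t, p) ^ 2 +
        φ' (T (t, p)) * Txx (t, p)) - ω'' p.1 * G p.2 * φ (T (t, p)))
      - u p.2 * G p.2 * (ω' p.1 * φ (T (t, p)) + ω p.1 * (φ' (T (t, p)) * Tx (t, p))))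
    (Y := fun p => κ * ω p.1 * (G p.2 * φ' (T (t, p)) * Ty (t, p)))
    (Yy := fun p => κ * ω p.1 * (G' p.2 * φ' (T (t, p)) * Ty (t, p) +
      G p.2 * φ'' (T (t, p)) * Ty (t, p) ^ 2 + G p.2 * φ' (T (t, p)) * Tyy (t, p)))
    (by fun_prop) (by fun_prop) (by fun_prop)
    (by
      intro x y
      have hT := h.hx t x y
      have e1 := (hφ.hd (T (t, x, y))).comp x hT
      have e2 := (hφ.hd' (T (t, x, y))).comp x hT
      refine ((((((hω.hd x).mul_const (G y)).mul e2).mul (h.hxx t x y)).sub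
        (((hω.hd' x).mul_const (G y)).mul e1)).const_mul κ).sub
        (((hω.hd x).mul e1).const_mul (u y * G y)) |>.congr_deriv ?_
      simp only [Function.comp, Pi.mul_apply]
      ring)
    (by intro y; simp only [hω.left, hω.right, hω.left', hω.right']; ring)
    (by
      intro x y hy
      have hyH : y ∈ Ioo 0 H := ⟨hα.trans_lt hy.1, hy.2.trans_le hβ⟩
      have e2 := (hφ.hd' (T (t, x, y))).comp y (h.hy t x y hyH)
      refine ((((hG y).mul e2).mul (h.hyy t x y hyH)).const_mul (κ * ω x)).congr_deriv ?_
      simp only [Function.comp, Pi.mul_apply]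
      ring)
    (by intro x; simp only [hb])
  rw [← hdiv]
  refine integral_congr_ae (Eventually.of_forall fun p => ?_)
  obtain ⟨x, y⟩ := p
  have e : Tt (t, x, y) = κ * (Txx (t, x, y) + Tyy (t, x, y)) + r (t, x, y) - u y * Tx (t, x, y) :=
    by linarith [h.eq t x y]
  simp only [testIntegrand, e]
  ring

theorem integral_test_time (h : IsExtendedSolution κ H a u r T Tt Tx Ty Txx Tyy) {R α β : ℝ}
    (hR : 0 ≤ R) (hα : 0 ≤ α) (hαβ : α ≤ β) (hβ : β ≤ H) {ω ω' ω'' G G' φ φ' φ'' : ℝ → ℝ}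
    (hω : IsCutoff R ω ω' ω'') (hG : ∀ y, HasDerivAt G (G' y) y) (cG' : Continuous G')
    (hφ : IsC2 φ φ' φ'') {s t : ℝ} (has : a ≤ s) (hst : s ≤ t)
    (hb : ∀ t x, G α * φ' (T (t, x, α)) * Ty (t, x, α) =
      G β * φ' (T (t, x, β)) * Ty (t, x, β)) :
    (∫ p in box R α β, ω p.1 * G p.2 * φ (T (t, p))) -
        ∫ p in box R α β, ω p.1 * G p.2 * φ (T (s, p)) =
      ∫ z in s..t, ∫ p in box R α β,
        testIntegrand κ u r T Tx Ty ω ω' ω'' G G' φ φ' φ'' (z, p) := by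
  have := h.cT; have := h.cTt
  have := hω.cont
  have := hφ.cont; have := hφ.cont'
  have cG : Continuous G := continuous_iff_continuousAt.2 fun y => (hG y).continuousAt
  rw [integral_box_sub_eq_integral_deriv hst
    (F := fun q => ω q.2.1 * G q.2.2 * φ (T q))
    (Ft := fun q => ω q.2.1 * G q.2.2 * φ' (T q) * Tt q) (by fun_prop) (by fun_prop)]
  · refine intervalIntegral.integral_congr fun z _ => ?_
    exact h.integral_test hR hα hαβ hβ hω hG cG' hφ z (hb z)
  · intro z hz p
    refine (((hφ.hd (T (z, p))).comp z (h.ht z (has.trans_lt hz.1) p)).const_mul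
      (ω p.1 * G p.2)).congr_deriv ?_
    ring

theorem isC2_mul_one_sub : IsC2 (fun s => s * (1 - s)) (fun s => 1 - 2 * s) (fun _ => -2) where
  hd s := ((hasDerivAt_id s).mul ((hasDerivAt_id s).const_sub 1)).congr_deriv
    (by simp only [id]; ring)
  hd' s := (((hasDerivAt_id s).const_mul 2).const_sub 1).congr_deriv (by ring)
  cont'' := continuous_const

theorem flux_eq (h : IsExtendedSolution κ H a u r T Tt Tx Ty Txx Tyy) (φ : ℝ → ℝ) (t x : ℝ) :
    φ (T (t, x, 0)) * Ty (t, x, 0) = φ (T (t, x, H)) * Ty (t, x, H) := by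
  rcases h.bc with hb | hb
  · simp [(hb t x).1, (hb t x).2]
  · rw [(hb t x).1, (hb t x).2]

/-- Energy identity for `T (1 - T)`. -/
theorem energy_identity (h : IsExtendedSolution κ H a u r T Tt Tx Ty Txx Tyy) (hH : 0 ≤ H) {R : ℝ}
    (hR : 0 ≤ R) {ω ω' ω'' : ℝ → ℝ} (hω : IsCutoff R ω ω' ω'') {s t : ℝ} (has : a ≤ s)
    (hst : s ≤ t) :
    (∫ p in box R 0 H, ω p.1 * (T (t, p) * (1 - T (t, p)))) -
        ∫ p in box R 0 H, ω p.1 * (T (s, p) * (1 - T (s, p))) =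
      ∫ z in s..t, ∫ p in box R 0 H,
        ((u p.2 * ω' p.1 + κ * ω'' p.1) * (T (z, p) * (1 - T (z, p)))
          + 2 * κ * (ω p.1 * (Tx (z, p) ^ 2 + Ty (z, p) ^ 2))
          + ω p.1 * (1 - 2 * T (z, p)) * r (z, p)) := by
  have := h.integral_test_time hR le_rfl hH le_rfl hω (G := fun _ => 1) (G' := fun _ => 0)
    (fun y => hasDerivAt_const y 1) continuous_const isC2_mul_one_sub has hst
    (fun t x => by simpa using h.flux_eq (fun s => 1 - 2 * s) t x)
  simp only [mul_one] at this
  rw [this]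
  refine intervalIntegral.integral_congr fun z _ => ?_
  refine integral_congr_ae (Eventually.of_forall fun p => ?_)
  simp only [testIntegrand]
  ring

theorem gradient_increment_le (h : IsExtendedSolution κ H a u r T Tt Tx Ty Txx Tyy) (hH : 0 ≤ H)
    {R : ℝ} (hR : 0 ≤ R) {W W' : ℝ → ℝ} (hW : ∀ x, HasDerivAt W (W' x) x) (cW' : Continuous W')
    (hW0 : ∀ x ∈ Icc (-R) R, 0 ≤ W x) (hl : W (-R) = 0) (hr : W R = 0)
    {s t : ℝ} (has : a ≤ s) (hst : s ≤ t) :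
    (∫ p in box R 0 H, W p.1 * (Tx (t, p) ^ 2 + Ty (t, p) ^ 2)) -
        ∫ p in box R 0 H, W p.1 * (Tx (s, p) ^ 2 + Ty (s, p) ^ 2) ≤
      ∫ z in s..t, ∫ p in box R 0 H,
        -2 * (W p.1 * (Txx (z, p) + Tyy (z, p)) + W' p.1 * Tx (z, p)) * Tt (z, p) := by
  have := h.cT; have := h.cTx; have := h.cTy; have := h.cTt
  have := h.cTxx; have := h.cTyy
  have cW : Continuous W := continuous_iff_continuousAt.2 fun y => (hW y).continuousAt
  refine sub_le_integral_diagonal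
    (g := fun t => ∫ p in box R 0 H, W p.1 * (Tx (t, p) ^ 2 + Ty (t, p) ^ 2))
    (m := fun c => ∫ p in box R 0 H,
      -2 * (W p.1 * (Txx (c.1, p) + Tyy (c.1, p)) + W' p.1 * Tx (c.1, p)) * Tt (c.2, p)) hst
    (continuous_integral_box (by fun_prop)).continuousOn
    (continuous_integral_box (by fun_prop)) ?_
  intro b hb c _ hbc
  simp only
  rw [← integral_box_sub_eq_integral_deriv hbc
    (F := fun q => -2 * (W q.2.1 * (Txx (c, q.2) + Tyy (c, q.2)) + W' q.2.1 * Tx (c, q.2)) * T q)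
    (Ft := fun q => -2 * (W q.2.1 * (Txx (c, q.2) + Tyy (c, q.2)) + W' q.2.1 * Tx (c, q.2)) *
      Tt q) (by fun_prop) (by fun_prop)
    (fun z hz p => (h.ht z ((has.trans hb.1).trans_lt hz.1) p).const_mul
      (-2 * (W p.1 * (Txx (c, p) + Tyy (c, p)) + W' p.1 * Tx (c, p))))]
  have hdiv := integral_box_divergence_eq_zero (R := R) (a := 0) (b := H) hR hH
    (X := fun p => W p.1 * (T (c, p) - T (b, p)) * Tx (c, p))
    (Xx := fun p => (W' p.1 * (T (c, p) - T (b, p)) + W p.1 * (Tx (c, p) - Tx (b, p))) * Tx (c, p)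
      + W p.1 * (T (c, p) - T (b, p)) * Txx (c, p))
    (Y := fun p => W p.1 * (T (c, p) - T (b, p)) * Ty (c, p))
    (Yy := fun p => W p.1 * (Ty (c, p) - Ty (b, p)) * Ty (c, p)
      + W p.1 * (T (c, p) - T (b, p)) * Tyy (c, p))
    (by fun_prop) (by fun_prop) (by fun_prop)
    (fun x y => ((hW x).mul ((h.hx c x y).sub (h.hx b x y))).mul (h.hxx c x y))
    (by intro y; simp [hl, hr])
    (fun x y hy => (((h.hy c x y hy).sub (h.hy b x y hy)).const_mul (W x)).mul
      (h.hyy c x y hy))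
    (by
      intro x
      rcases h.bc with hb | hb
      · simp [(hb c x).1, (hb c x).2]
      · simp only [(hb c x).1, (hb c x).2, (hb b x).1])
  rw [← integral_sub (integrableOn_box (by fun_prop)) (integrableOn_box (by fun_prop)),
    ← integral_sub (integrableOn_box (by fun_prop)) (integrableOn_box (by fun_prop))]
  have key : ∀ A B D : ℝ, D = 0 → A ≤ B + 2 * D → A ≤ B := by
    intro A B D hD hle
    linarith
  refine key _ _ _ hdiv ?_
  rw [← integral_const_mul,
    ← integral_add (integrableOn_box (by fun_prop)) (integrableOn_box (by fun_prop))]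
  refine setIntegral_mono_on (integrableOn_box (by fun_prop)) (integrableOn_box (by fun_prop))
    (measurableSet_box _ _ _) fun p hp => ?_
  have h0 := hW0 p.1 hp.1
  have h1 := mul_nonneg h0 (sq_nonneg (Tx (c, p) - Tx (b, p)))
  have h2 := mul_nonneg h0 (sq_nonneg (Ty (c, p) - Ty (b, p)))
  nlinarith

end IsExtendedSolution

theorem integral_exp_neg_abs_le {η R : ℝ} (hη : 0 < η) (hR : 0 ≤ R) :
    ∫ x in (-R)..R, Real.exp (-η * |x|) ≤ 2 / η := by
  have c : Continuous fun x : ℝ => Real.exp (-η * |x|) := by fun_prop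
  have hd : ∀ x : ℝ, HasDerivAt (fun x => -Real.exp (-η * x) / η) (Real.exp (-η * x)) x := by
    intro x
    refine ((((hasDerivAt_id x).const_mul (-η)).exp.neg).div_const η).congr_deriv ?_
    simp only [id]; field_simp
  have h2 : ∫ x in (0 : ℝ)..R, Real.exp (-η * |x|) ≤ 1 / η := by
    have : ∫ x in (0 : ℝ)..R, Real.exp (-η * |x|) = ∫ x in (0 : ℝ)..R, Real.exp (-η * x) := by
      refine intervalIntegral.integral_congr fun x hx => ?_
      rw [uIcc_of_le hR] at hx
      simp only [abs_of_nonneg hx.1]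
    rw [this, intervalIntegral.integral_eq_sub_of_hasDerivAt (fun x _ => hd x)
      (Continuous.intervalIntegrable (by fun_prop) _ _)]
    have : 0 ≤ Real.exp (-η * R) / η := by positivity
    simp only [mul_zero, Real.exp_zero]
    rw [neg_div, neg_div]; linarith
  have h1 : ∫ x in (-R)..0, Real.exp (-η * |x|) = ∫ x in (0 : ℝ)..R, Real.exp (-η * |x|) := by
    have := intervalIntegral.integral_comp_neg (a := 0) (b := R)
      (fun x : ℝ => Real.exp (-η * |x|))
    simp only [abs_neg, neg_zero] at this
    exact this.symm
  rw [← intervalIntegral.integral_add_adjacent_intervals (c.intervalIntegrable _ _)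
    (c.intervalIntegrable _ _), h1]
  calc _ ≤ 1 / η + 1 / η := add_le_add h2 h2
    _ = 2 / η := by ring

theorem integral_box_exp_neg_abs_le {η R H : ℝ} (hη : 0 < η) (hR : 0 ≤ R) (hH : 0 ≤ H) :
    ∫ p in box R 0 H, Real.exp (-η * |p.1|) ≤ 2 * H / η := by
  rw [integral_box_eq_iterated hR hH (by fun_prop)]
  simp only [intervalIntegral.integral_const, sub_zero, smul_eq_mul,
    intervalIntegral.integral_const_mul]
  calc _ ≤ H * (2 / η) := mul_le_mul_of_nonneg_left (integral_exp_neg_abs_le hη hR) hH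
    _ = _ := by ring

theorem integral_box_mono {R a b : ℝ} {f g : ℝ × ℝ → ℝ} (hf : Continuous f) (hg : Continuous g)
    (h : ∀ p ∈ box R a b, f p ≤ g p) : ∫ p in box R a b, f p ≤ ∫ p in box R a b, g p :=
  setIntegral_mono_on (integrableOn_box hf) (integrableOn_box hg) (measurableSet_box _ _ _) h

theorem integral_box_nonneg {R a b : ℝ} {f : ℝ × ℝ → ℝ} (h : ∀ p ∈ box R a b, 0 ≤ f p) :
    0 ≤ ∫ p in box R a b, f p :=
  setIntegral_nonneg (measurableSet_box _ _ _) h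

/-- Time integrals of box integrals are monotone in the integrand. -/
theorem integral_time_box_mono {R a b s t : ℝ} (hst : s ≤ t) {f g : ℝ × ℝ × ℝ → ℝ}
    (hf : Continuous f) (hg : Continuous g)
    (h : ∀ z ∈ Icc s t, ∀ p ∈ box R a b, f (z, p) ≤ g (z, p)) :
    ∫ z in s..t, ∫ p in box R a b, f (z, p) ≤ ∫ z in s..t, ∫ p in box R a b, g (z, p) :=
  intervalIntegral.integral_mono_on hst
    ((continuous_integral_box (by fun_prop)).intervalIntegrable _ _)
    ((continuous_integral_box (by fun_prop)).intervalIntegrable _ _)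
    fun z hz => integral_box_mono (by fun_prop) (by fun_prop) (h z hz)

theorem integral_time_box_add {R a b s t : ℝ} {f g : ℝ × ℝ × ℝ → ℝ}
    (hf : Continuous f) (hg : Continuous g) :
    ∫ z in s..t, ∫ p in box R a b, (f (z, p) + g (z, p)) =
      (∫ z in s..t, ∫ p in box R a b, f (z, p)) + ∫ z in s..t, ∫ p in box R a b, g (z, p) := by
  rw [← intervalIntegral.integral_add
    ((continuous_integral_box (by fun_prop)).intervalIntegrable _ _)
    ((continuous_integral_box (by fun_prop)).intervalIntegrable _ _)]
  refine intervalIntegral.integral_congr fun z _ => ?_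
  exact integral_add (integrableOn_box (by fun_prop)) (integrableOn_box (by fun_prop))

theorem integral_time_box_const_mul {R a b s t : ℝ} (c : ℝ) (f : ℝ × ℝ × ℝ → ℝ) :
    ∫ z in s..t, ∫ p in box R a b, c * f (z, p) =
      c * ∫ z in s..t, ∫ p in box R a b, f (z, p) := by
  simp only [integral_const_mul, intervalIntegral.integral_const_mul]

theorem integral_time_box_nonneg {R a b s t : ℝ} (hst : s ≤ t) {f : ℝ × ℝ × ℝ → ℝ}
    (h : ∀ z ∈ Icc s t, ∀ p ∈ box R a b, 0 ≤ f (z, p)) :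
    0 ≤ ∫ z in s..t, ∫ p in box R a b, f (z, p) :=
  intervalIntegral.integral_nonneg hst fun z hz => integral_box_nonneg (h z hz)

theorem integral_time_box_mono_interval {R a b s s' t t' : ℝ} (hs : s ≤ s') (hst : s' ≤ t')
    (ht : t' ≤ t) {f : ℝ × ℝ × ℝ → ℝ} (hf : Continuous f)
    (h : ∀ z ∈ Icc s t, ∀ p ∈ box R a b, 0 ≤ f (z, p)) :
    ∫ z in s'..t', ∫ p in box R a b, f (z, p) ≤ ∫ z in s..t, ∫ p in box R a b, f (z, p) := by
  have c : Continuous fun z => ∫ p in box R a b, f (z, p) := continuous_integral_box (by fun_prop)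
  refine intervalIntegral.integral_mono_interval hs hst ht ?_ (c.intervalIntegrable _ _)
  refine (ae_restrict_iff' measurableSet_Ioc).2 (Eventually.of_forall fun z hz => ?_)
  exact integral_box_nonneg (h z (Ioc_subset_Icc_self hz))

/-- The product of `(1 - x²/R²)²` and `cosh (η x)` as a cutoff. -/
theorem isCutoff_cosh {R : ℝ} (hR : 0 < R) (η : ℝ) :
    IsCutoff R (fun x => (1 - x ^ 2 / R ^ 2) ^ 2 * Real.cosh (η * x))
      (fun x => 2 * (1 - x ^ 2 / R ^ 2) * (-(2 * x / R ^ 2)) * Real.cosh (η * x)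
        + (1 - x ^ 2 / R ^ 2) ^ 2 * (η * Real.sinh (η * x)))
      (fun x => (2 * (2 * x / R ^ 2) ^ 2 - 2 * (1 - x ^ 2 / R ^ 2) * (2 / R ^ 2)) *
          Real.cosh (η * x)
        + 4 * (1 - x ^ 2 / R ^ 2) * (-(2 * x / R ^ 2)) * (η * Real.sinh (η * x))
        + (1 - x ^ 2 / R ^ 2) ^ 2 * (η ^ 2 * Real.cosh (η * x))) := by
  have hz : ∀ x : ℝ, HasDerivAt (fun x : ℝ => 1 - x ^ 2 / R ^ 2) (-(2 * x / R ^ 2)) x := by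
    intro x
    refine ((((hasDerivAt_id x).pow 2).div_const (R ^ 2)).const_sub 1).congr_deriv ?_
    simp
  have hz' : ∀ x : ℝ, HasDerivAt (fun x : ℝ => -(2 * x / R ^ 2)) (-(2 / R ^ 2)) x := by
    intro x
    refine ((((hasDerivAt_id x).const_mul 2).div_const (R ^ 2)).neg).congr_deriv ?_
    simp
  have hc : ∀ x : ℝ, HasDerivAt (fun x => Real.cosh (η * x)) (η * Real.sinh (η * x)) x := by
    intro x
    refine (((hasDerivAt_id x).const_mul η).cosh).congr_deriv ?_
    simp only [id]; ring
  have hs : ∀ x : ℝ, HasDerivAt (fun x => Real.sinh (η * x)) (η * Real.cosh (η * x)) x := by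
    intro x
    refine (((hasDerivAt_id x).const_mul η).sinh).congr_deriv ?_
    simp only [id]; ring
  have hRR : R ^ 2 / R ^ 2 = 1 := div_self (by positivity)
  refine ⟨fun x => ?_, fun x => ?_, by fun_prop, ?_, ?_, ?_, ?_⟩
  · refine (((hz x).pow 2).mul (hc x)).congr_deriv ?_
    simp
  · refine (((((hz x).const_mul 2).mul (hz' x)).mul (hc x)).add
      (((hz x).pow 2).mul ((hs x).const_mul η))).congr_deriv ?_
    simp only [Pi.mul_apply, Pi.pow_apply]
    ring
  all_goals simp [hRR]

theorem zeta_bounds_of_pos {R x : ℝ} (hR0 : 0 < R) (hx : x ∈ Icc (-R) R) :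
    0 ≤ 1 - x ^ 2 / R ^ 2 ∧ 1 - x ^ 2 / R ^ 2 ≤ 1 ∧ |2 * x / R ^ 2| ≤ 2 / R := by
  have hxR : |x| ≤ R := abs_le.2 hx
  have hx2 : x ^ 2 ≤ R ^ 2 := sq_le_sq' hx.1 hx.2
  refine ⟨?_, ?_, ?_⟩
  · rw [sub_nonneg, div_le_one (by positivity)]; exact hx2
  · have : 0 ≤ x ^ 2 / R ^ 2 := by positivity
    linarith
  · rw [abs_div, abs_mul, abs_of_pos (by positivity : 0 < R ^ 2), abs_of_pos two_pos,
      div_le_div_iff₀ (by positivity) hR0]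
    nlinarith

theorem zeta_bounds {R x : ℝ} (hR : 1 ≤ R) (hx : x ∈ Icc (-R) R) :
    0 ≤ 1 - x ^ 2 / R ^ 2 ∧ 1 - x ^ 2 / R ^ 2 ≤ 1 ∧ |2 * x / R ^ 2| ≤ 2 / R ∧
      |2 / R ^ 2| ≤ 2 / R := by
  have hR0 : 0 < R := by linarith
  obtain ⟨h1, h2, h3⟩ := zeta_bounds_of_pos hR0 hx
  refine ⟨h1, h2, h3, ?_⟩
  rw [abs_of_pos (by positivity), div_le_div_iff₀ (by positivity) hR0]
  nlinarith

theorem mul_one_sub_mem {s : ℝ} (hs : s ∈ Icc (0 : ℝ) 1) : s * (1 - s) ∈ Icc (0 : ℝ) 1 := by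
  have h0 := hs.1
  have h1 := hs.2
  constructor <;> nlinarith

theorem mul_one_sub_le_exp {s A lam x : ℝ} (hs : s ∈ Icc (0 : ℝ) 1)
    (h1 : s ≤ A * Real.exp (-lam * x)) (h2 : 1 - s ≤ A * Real.exp (lam * x)) :
    s * (1 - s) ≤ A * Real.exp (-lam * |x|) := by
  have e0 := hs.1
  have e1 := hs.2
  rcases le_total 0 x with h | h
  · rw [abs_of_nonneg h]; nlinarith
  · rw [abs_of_nonpos h, neg_mul_neg]; nlinarith

theorem cosh_le_exp_abs {η x : ℝ} (hη : 0 ≤ η) : Real.cosh (η * x) ≤ Real.exp (η * |x|) := by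
  rw [← Real.cosh_abs, abs_mul, abs_of_nonneg hη, Real.cosh_eq]
  have : Real.exp (-(η * |x|)) ≤ Real.exp (η * |x|) :=
    Real.exp_le_exp.2 (by have := mul_nonneg hη (abs_nonneg x); linarith)
  linarith

theorem half_exp_abs_le_cosh {η x : ℝ} (hη : 0 ≤ η) :
    Real.exp (η * |x|) / 2 ≤ Real.cosh (η * x) := by
  rw [← Real.cosh_abs, abs_mul, abs_of_nonneg hη, Real.cosh_eq]
  have : 0 < Real.exp (-(η * |x|)) := Real.exp_pos _
  linarith

theorem abs_sinh_le_cosh (x : ℝ) : |Real.sinh x| ≤ Real.cosh x := by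
  rw [abs_le]
  constructor
  · have := Real.cosh_add_sinh x
    have := Real.exp_pos x
    linarith
  · exact (Real.sinh_lt_cosh x).le

namespace IsExtendedSolution

variable {κ H a : ℝ} {u : ℝ → ℝ} {r T Tt Tx Ty Txx Tyy : ℝ × ℝ × ℝ → ℝ}

theorem energy_le (h : IsExtendedSolution κ H a u r T Tt Tx Ty Txx Tyy) (hκ : 0 ≤ κ) (hH : 0 ≤ H)
    {U : ℝ} (hU : ∀ y, |u y| ≤ U) (hr : ∀ q, 0 ≤ r q) {R : ℝ}
    (hR : 0 ≤ R) {ω ω' ω'' : ℝ → ℝ} (hω : IsCutoff R ω ω' ω'')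
    (hω0 : ∀ x ∈ Icc (-R) R, 0 ≤ ω x) {s t : ℝ} (has : a ≤ s) (hst : s ≤ t) :
    2 * κ * ∫ z in s..t, ∫ p in box R 0 H, ω p.1 * (Tx (z, p) ^ 2 + Ty (z, p) ^ 2) ≤
      (∫ p in box R 0 H, ω p.1 * (T (t, p) * (1 - T (t, p)))) +
      (∫ z in s..t, ∫ p in box R 0 H, ω p.1 * r (z, p)) +
      ∫ z in s..t, ∫ p in box R 0 H,
        (U * |ω' p.1| + κ * |ω'' p.1|) * (T (z, p) * (1 - T (z, p))) := by
  have := h.cu; have := h.cr; have := h.cT; have := h.cTx; have := h.cTy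
  have := hω.cont; have := hω.cont'; have := hω.cont''
  have hid := h.energy_identity hH hR hω has hst
  have hs : 0 ≤ ∫ p in box R 0 H, ω p.1 * (T (s, p) * (1 - T (s, p))) :=
    integral_box_nonneg fun p hp => mul_nonneg (hω0 _ hp.1) (mul_one_sub_mem (h.mem _)).1
  rw [← integral_time_box_const_mul (f := fun q => ω q.2.1 * (Tx q ^ 2 + Ty q ^ 2))]
  have hmono := integral_time_box_mono (R := R) (a := 0) (b := H) hst
    (f := fun q => 2 * κ * (ω q.2.1 * (Tx q ^ 2 + Ty q ^ 2)))
    (g := fun q => ((u q.2.2 * ω' q.2.1 + κ * ω'' q.2.1) * (T q * (1 - T q))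
          + 2 * κ * (ω q.2.1 * (Tx q ^ 2 + Ty q ^ 2)) + ω q.2.1 * (1 - 2 * T q) * r q) +
        (ω q.2.1 * r q + (U * |ω' q.2.1| + κ * |ω'' q.2.1|) * (T q * (1 - T q))))
    (by fun_prop) (by fun_prop)
    (by
      intro z _ p hp
      have hT := h.mem (z, p)
      have h1 : 0 ≤ ω p.1 * r (z, p) * (2 - 2 * T (z, p)) :=
        mul_nonneg (mul_nonneg (hω0 _ hp.1) (hr _)) (by linarith [hT.2])
      have h2 : -(U * |ω' p.1|) ≤ u p.2 * ω' p.1 := by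
        have : |u p.2 * ω' p.1| ≤ U * |ω' p.1| := by
          rw [abs_mul]; exact mul_le_mul_of_nonneg_right (hU _) (abs_nonneg _)
        exact (abs_le.1 this).1
      have h3 : -(κ * |ω'' p.1|) ≤ κ * ω'' p.1 := by
        have := mul_le_mul_of_nonneg_left (neg_abs_le (ω'' p.1)) hκ
        linarith
      have h4 : 0 ≤ (u p.2 * ω' p.1 + κ * ω'' p.1 + (U * |ω' p.1| + κ * |ω'' p.1|)) *
          (T (z, p) * (1 - T (z, p))) :=
        mul_nonneg (by linarith) (mul_one_sub_mem hT).1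
      simp only
      nlinarith)
  rw [integral_time_box_add
      (f := fun q => (u q.2.2 * ω' q.2.1 + κ * ω'' q.2.1) * (T q * (1 - T q))
          + 2 * κ * (ω q.2.1 * (Tx q ^ 2 + Ty q ^ 2)) + ω q.2.1 * (1 - 2 * T q) * r q)
      (g := fun q => ω q.2.1 * r q + (U * |ω' q.2.1| + κ * |ω'' q.2.1|) * (T q * (1 - T q)))
      (by fun_prop) (by fun_prop),
    integral_time_box_add (f := fun q => ω q.2.1 * r q)
      (g := fun q => (U * |ω' q.2.1| + κ * |ω'' q.2.1|) * (T q * (1 - T q)))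
      (by fun_prop) (by fun_prop)] at hmono
  linarith

theorem integral_cosh_le (h : IsExtendedSolution κ H a u r T Tt Tx Ty Txx Tyy) (hH : 0 ≤ H)
    {A η τ : ℝ} (hη : 0 < η) (hA : 0 ≤ A)
    (hdec : ∀ t ≤ τ, ∀ x y, T (t, x, y) ≤ A * Real.exp (-(2 * η) * x) ∧
      1 - T (t, x, y) ≤ A * Real.exp (2 * η * x)) {R : ℝ} (hR : 0 ≤ R) {t : ℝ} (ht : t ≤ τ) :
    ∫ p in box R 0 H, Real.cosh (η * p.1) * (T (t, p) * (1 - T (t, p))) ≤ A * (2 * H / η) := by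
  have := h.cT
  calc _ ≤ ∫ p in box R 0 H, A * Real.exp (-η * |p.1|) := by
        refine integral_box_mono (by fun_prop) (by fun_prop) fun p _ => ?_
        have h1 := mul_one_sub_le_exp (h.mem (t, p)) (hdec t ht p.1 p.2).1 (hdec t ht p.1 p.2).2
        calc _ ≤ Real.exp (η * |p.1|) * (A * Real.exp (-(2 * η) * |p.1|)) :=
              mul_le_mul (cosh_le_exp_abs hη.le) h1 (mul_one_sub_mem (h.mem (t, p))).1
                (Real.exp_pos _).le
          _ = A * Real.exp (-η * |p.1|) := by
              rw [mul_left_comm, ← Real.exp_add]; ring_nf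
    _ ≤ _ := by
        rw [integral_const_mul]
        exact mul_le_mul_of_nonneg_left (integral_box_exp_neg_abs_le hη hR hH) hA

theorem integral_time_cosh_le (h : IsExtendedSolution κ H a u r T Tt Tx Ty Txx Tyy) (hH : 0 ≤ H)
    {A η τ : ℝ} (hη : 0 < η) (hA : 0 ≤ A)
    (hdec : ∀ t ≤ τ, ∀ x y, T (t, x, y) ≤ A * Real.exp (-(2 * η) * x) ∧
      1 - T (t, x, y) ≤ A * Real.exp (2 * η * x)) {R : ℝ} (hR : 0 ≤ R) {s t : ℝ} (hst : s ≤ t)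
    (ht : t ≤ τ) :
    ∫ z in s..t, ∫ p in box R 0 H, Real.cosh (η * p.1) * (T (z, p) * (1 - T (z, p))) ≤
      (t - s) * (A * (2 * H / η)) := by
  have := h.cT
  have := intervalIntegral.integral_mono_on (μ := volume) (a := s) (b := t) hst
    ((continuous_integral_box (R := R) (a := 0) (b := H)
      (F := fun z p => Real.cosh (η * p.1) * (T (z, p) * (1 - T (z, p))))
      (by fun_prop)).intervalIntegrable _ _)
    (intervalIntegrable_const (c := A * (2 * H / η)))
    (fun z hz => h.integral_cosh_le hH hη hA hdec hR (hz.2.trans ht))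
  rwa [intervalIntegral.integral_const, smul_eq_mul] at this

/-- Exponentially weighted gradient bound, uniform in the cutoff radius. -/
theorem exists_gradient_bound (h : IsExtendedSolution κ H a u r T Tt Tx Ty Txx Tyy) (hκ : 0 < κ)
    (hH : 0 ≤ H) {U K : ℝ} (hU : ∀ y, |u y| ≤ U) (hr : ∀ q, 0 ≤ r q) (hK : 0 ≤ K)
    (hrK : ∀ q, r q ≤ K * (T q * (1 - T q))) {A η τ : ℝ} (hη : 0 < η) (hA : 0 ≤ A)
    (hdec : ∀ t ≤ τ, ∀ x y, T (t, x, y) ≤ A * Real.exp (-(2 * η) * x) ∧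
      1 - T (t, x, y) ≤ A * Real.exp (2 * η * x)) {t : ℝ} (hat : a ≤ t) (ht : t ≤ τ) :
    ∃ B, ∀ R, 1 ≤ R → ∫ z in a..t, ∫ p in box R 0 H,
      ((1 - p.1 ^ 2 / R ^ 2) ^ 2 * Real.cosh (η * p.1)) * (Tx (z, p) ^ 2 + Ty (z, p) ^ 2) ≤ B := by
  have hU0 : 0 ≤ U := (abs_nonneg _).trans (hU 0)
  set M := U * (4 + η) + κ * (12 + 8 * η + η ^ 2) with hM
  have hM0 : 0 ≤ M := by positivity
  set C := A * (2 * H / η) with hC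
  refine ⟨(C + K * ((t - a) * C) + M * ((t - a) * C)) / (2 * κ), fun R hR => ?_⟩
  have hR0 : 0 ≤ R := by linarith
  have := h.cr; have := h.cT
  have hω := isCutoff_cosh (R := R) (by linarith) η
  have hωc : ∀ x ∈ Icc (-R) R, (1 - x ^ 2 / R ^ 2) ^ 2 * Real.cosh (η * x) ≤ Real.cosh (η * x) := by
    intro x hx
    obtain ⟨z0, z1, -, -⟩ := zeta_bounds hR hx
    exact mul_le_of_le_one_left (Real.cosh_pos _).le (pow_le_one₀ z0 z1)
  rw [le_div_iff₀ (by positivity), mul_comm]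
  refine (h.energy_le hκ.le hH hU hr hR0 hω (fun x _ => by positivity) le_rfl hat).trans ?_
  have i1 := h.integral_cosh_le hH hη hA hdec hR0 ht
  have i2 := h.integral_time_cosh_le hH hη hA hdec hR0 hat ht
  refine add_le_add (add_le_add ?_ ?_) ?_
  · refine le_trans ?_ i1
    refine integral_box_mono (by have := hω.cont; fun_prop) (by fun_prop) fun p hp => ?_
    exact mul_le_mul_of_nonneg_right (hωc _ hp.1) (mul_one_sub_mem (h.mem _)).1
  · refine le_trans ?_ (mul_le_mul_of_nonneg_left i2 hK)
    rw [← integral_time_box_const_mul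
      (f := fun q => Real.cosh (η * q.2.1) * (T q * (1 - T q)))]
    refine integral_time_box_mono hat
      (f := fun q => (1 - q.2.1 ^ 2 / R ^ 2) ^ 2 * Real.cosh (η * q.2.1) * r q)
      (g := fun q => K * (Real.cosh (η * q.2.1) * (T q * (1 - T q))))
      (by fun_prop) (by fun_prop) fun z _ p hp => ?_
    calc _ ≤ Real.cosh (η * p.1) * (K * (T (z, p) * (1 - T (z, p)))) :=
          mul_le_mul (hωc _ hp.1) (hrK _) (hr _) (Real.cosh_pos _).le
      _ = _ := by ring
  · refine le_trans ?_ (mul_le_mul_of_nonneg_left i2 hM0)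
    rw [← integral_time_box_const_mul
      (f := fun q => Real.cosh (η * q.2.1) * (T q * (1 - T q)))]
    refine integral_time_box_mono hat
      (f := fun q => (U * |2 * (1 - q.2.1 ^ 2 / R ^ 2) * (-(2 * q.2.1 / R ^ 2)) *
          Real.cosh (η * q.2.1) + (1 - q.2.1 ^ 2 / R ^ 2) ^ 2 * (η * Real.sinh (η * q.2.1))| +
        κ * |(2 * (2 * q.2.1 / R ^ 2) ^ 2 - 2 * (1 - q.2.1 ^ 2 / R ^ 2) * (2 / R ^ 2)) *
          Real.cosh (η * q.2.1)
        + 4 * (1 - q.2.1 ^ 2 / R ^ 2) * (-(2 * q.2.1 / R ^ 2)) * (η * Real.sinh (η * q.2.1))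
        + (1 - q.2.1 ^ 2 / R ^ 2) ^ 2 * (η ^ 2 * Real.cosh (η * q.2.1))|) * (T q * (1 - T q)))
      (g := fun q => M * (Real.cosh (η * q.2.1) * (T q * (1 - T q))))
      (by fun_prop) (by fun_prop) fun z _ p hp => ?_
    simp only
    rw [← mul_assoc M]
    refine mul_le_mul_of_nonneg_right ?_ (mul_one_sub_mem (h.mem _)).1
    obtain ⟨z0, z1, z2, z3⟩ := zeta_bounds hR hp.1
    have h2R : 2 / R ≤ 2 := div_le_self (by norm_num) hR
    have z2' := z2.trans h2R
    have z3' := z3.trans h2R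
    generalize 1 - p.1 ^ 2 / R ^ 2 = ζ at *
    generalize 2 * p.1 / R ^ 2 = ζ₁ at *
    generalize 2 / R ^ 2 = ζ₂ at *
    have hs := abs_sinh_le_cosh (η * p.1)
    have hc := Real.cosh_pos (η * p.1)
    generalize Real.cosh (η * p.1) = c at *
    generalize Real.sinh (η * p.1) = σ at *
    have hζ2 : ζ ^ 2 ≤ 1 := pow_le_one₀ z0 z1
    have aζ : |ζ| ≤ 1 := by rwa [abs_of_nonneg z0]
    have b1 : |2 * ζ * (-ζ₁) * c + ζ ^ 2 * (η * σ)| ≤ (4 + η) * c := by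
      refine (abs_add_le _ _).trans ?_
      rw [abs_mul, abs_mul, abs_mul, abs_mul, abs_mul, abs_neg, abs_of_pos hc, abs_of_pos hη,
        abs_two, abs_of_nonneg (sq_nonneg ζ)]
      have e1 : 2 * |ζ| * |ζ₁| * c ≤ 2 * 1 * 2 * c := by gcongr
      have e2 : ζ ^ 2 * (η * |σ|) ≤ 1 * (η * c) := by gcongr
      linarith
    have b2 : |(2 * ζ₁ ^ 2 - 2 * ζ * ζ₂) * c + 4 * ζ * (-ζ₁) * (η * σ) + ζ ^ 2 * (η ^ 2 * c)| ≤
        (12 + 8 * η + η ^ 2) * c := by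
      refine (abs_add_three _ _ _).trans ?_
      have e1 : |(2 * ζ₁ ^ 2 - 2 * ζ * ζ₂) * c| ≤ 12 * c := by
        rw [abs_mul, abs_of_pos hc]
        refine mul_le_mul_of_nonneg_right ?_ hc.le
        refine (abs_sub _ _).trans ?_
        rw [abs_mul, abs_mul, abs_mul, abs_two, abs_pow]
        have e1 : 2 * |ζ₁| ^ 2 ≤ 2 * 2 ^ 2 := by gcongr
        have e2 : 2 * |ζ| * |ζ₂| ≤ 2 * 1 * 2 := by gcongr
        linarith
      have e2 : |4 * ζ * (-ζ₁) * (η * σ)| ≤ 8 * η * c := by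
        rw [abs_mul, abs_mul, abs_mul, abs_mul, abs_neg, abs_of_pos hη,
          abs_of_pos (by norm_num : (0 : ℝ) < 4)]
        have e2 : 4 * |ζ| * |ζ₁| * (η * |σ|) ≤ 4 * 1 * 2 * (η * c) := by gcongr
        linarith
      have e3 : |ζ ^ 2 * (η ^ 2 * c)| ≤ η ^ 2 * c := by
        rw [abs_of_nonneg (by positivity)]
        exact mul_le_of_le_one_left (by positivity) hζ2
      linarith
    have c1 := mul_le_mul_of_nonneg_left b1 hU0
    have c2 := mul_le_mul_of_nonneg_left b2 hκ.le
    rw [hM]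
    linarith

end IsExtendedSolution

theorem hasDerivAt_quartic_cosh {R : ℝ} (η x : ℝ) :
    HasDerivAt (fun x => (1 - x ^ 2 / R ^ 2) ^ 4 * Real.cosh (η * x))
      ((1 - x ^ 2 / R ^ 2) ^ 3 * (-(4 * (2 * x / R ^ 2)) * Real.cosh (η * x)
        + (1 - x ^ 2 / R ^ 2) * (η * Real.sinh (η * x)))) x := by
  have hz : HasDerivAt (fun x : ℝ => 1 - x ^ 2 / R ^ 2) (-(2 * x / R ^ 2)) x := by
    refine ((((hasDerivAt_id x).pow 2).div_const (R ^ 2)).const_sub 1).congr_deriv ?_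
    simp
  refine ((hz.pow 4).mul (((hasDerivAt_id x).const_mul η).cosh)).congr_deriv ?_
  simp only [id, Pi.pow_apply]
  push_cast
  ring

theorem quartic_weight_young {κ η ζ ζ₁ c σ : ℝ} (hκ : 0 ≤ κ) (hη : 0 ≤ η) (z0 : 0 ≤ ζ) (z1 : ζ ≤ 1)
    (z2 : |ζ₁| ≤ 2) (hc : 0 ≤ c) (hs : |σ| ≤ c) (X Y : ℝ) :
    -(1 / 4 * (ζ ^ 4 * c * Y ^ 2) + κ ^ 2 * (8 + η) ^ 2 * (ζ ^ 2 * c * X ^ 2)) ≤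
      κ * (ζ ^ 3 * (-(4 * ζ₁) * c + ζ * (η * σ)) * X * Y) := by
  have hd : |-(4 * ζ₁) * c + ζ * (η * σ)| ≤ (8 + η) * c := by
    refine (abs_add_le _ _).trans ?_
    rw [abs_mul, abs_mul, abs_mul, abs_neg, abs_mul, abs_of_nonneg hc, abs_of_nonneg hη,
      abs_of_nonneg z0, abs_of_pos (by norm_num : (0 : ℝ) < 4)]
    have e1 : 4 * |ζ₁| * c ≤ 4 * 2 * c := by gcongr
    have e2 : ζ * (η * |σ|) ≤ 1 * (η * c) := by gcongr
    linarith
  have hd2 : |κ * (ζ ^ 3 * (-(4 * ζ₁) * c + ζ * (η * σ)) * X * Y)| ≤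
      κ * (ζ ^ 3 * ((8 + η) * c) * |X| * |Y|) := by
    rw [abs_mul, abs_mul, abs_mul, abs_mul, abs_of_nonneg hκ, abs_of_nonneg (pow_nonneg z0 3)]
    gcongr
  have hd3 : κ * (ζ ^ 3 * ((8 + η) * c) * |X| * |Y|) ≤
      1 / 4 * (ζ ^ 4 * c * Y ^ 2) + κ ^ 2 * (8 + η) ^ 2 * (ζ ^ 2 * c * X ^ 2) := by
    have h1 := mul_nonneg hc (sq_nonneg (ζ ^ 2 * |Y| / 2 - κ * (8 + η) * ζ * |X|))
    rw [← sq_abs X, ← sq_abs Y]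
    linarith
  exact (abs_le.1 (hd2.trans hd3)).1

namespace IsExtendedSolution

variable {κ H a : ℝ} {u : ℝ → ℝ} {r T Tt Tx Ty Txx Tyy : ℝ × ℝ × ℝ → ℝ}

/-- Exponentially weighted `L²` bound on the time derivative, uniform in the cutoff radius. -/
theorem exists_time_deriv_bound (h : IsExtendedSolution κ H a u r T Tt Tx Ty Txx Tyy) (hκ : 0 < κ)
    (hH : 0 ≤ H) {U K : ℝ} (hU : ∀ y, |u y| ≤ U) (hr : ∀ q, 0 ≤ r q) (hK : 0 ≤ K)
    (hrK : ∀ q, r q ≤ K * (T q * (1 - T q))) {A η τ : ℝ} (hη : 0 < η) (hA : 0 ≤ A)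
    (hdec : ∀ t ≤ τ, ∀ x y, T (t, x, y) ≤ A * Real.exp (-(2 * η) * x) ∧
      1 - T (t, x, y) ≤ A * Real.exp (2 * η * x)) {s t : ℝ} (has : a < s) (hst : s ≤ t)
    (ht : t ≤ τ) :
    ∃ B, ∀ R, 1 ≤ R → ∫ z in s..t, ∫ p in box R 0 H,
      ((1 - p.1 ^ 2 / R ^ 2) ^ 4 * Real.cosh (η * p.1)) * Tt (z, p) ^ 2 ≤ B := by
  have hU0 : 0 ≤ U := (abs_nonneg _).trans (hU 0)
  have hat : a ≤ t := has.le.trans hst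
  obtain ⟨B, hB⟩ := h.exists_gradient_bound hκ hH hU hr hK hrK hη hA hdec hat ht
  set C := (t - a) * (A * (2 * H / η)) with hC
  set M := κ ^ 2 * (8 + η) ^ 2 + U ^ 2 with hM
  have hM0 : 0 ≤ M := by positivity
  refine ⟨4 * (κ / 2 * (B / (s - a)) + M * B + K ^ 2 * C), fun R hR => ?_⟩
  have hR0 : 0 ≤ R := by linarith
  have hRpos : 0 < R := by linarith
  have := h.cu; have := h.cr; have := h.cT; have := h.cTx; have := h.cTy; have := h.cTt
  have := h.cTxx; have := h.cTyy
  have hRR : R ^ 2 / R ^ 2 = 1 := div_self (by positivity)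
  have hcosh := fun x : ℝ => Real.cosh_pos (η * x)
  let ω : ℝ → ℝ := fun x => (1 - x ^ 2 / R ^ 2) ^ 2 * Real.cosh (η * x)
  let W : ℝ → ℝ := fun x => (1 - x ^ 2 / R ^ 2) ^ 4 * Real.cosh (η * x)
  let W' : ℝ → ℝ := fun x => (1 - x ^ 2 / R ^ 2) ^ 3 * (-(4 * (2 * x / R ^ 2)) * Real.cosh (η * x)
        + (1 - x ^ 2 / R ^ 2) * (η * Real.sinh (η * x)))
  have cω : Continuous ω := by fun_prop
  have cW : Continuous W := by fun_prop
  have cW' : Continuous W' := by fun_prop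
  have hω0 : ∀ x, 0 ≤ ω x := fun x => by positivity
  have hW0 : ∀ x, 0 ≤ W x := fun x => by positivity
  have hWω : ∀ x ∈ Icc (-R) R, W x ≤ ω x := by
    intro x hx
    obtain ⟨z0, z1, -, -⟩ := zeta_bounds hR hx
    exact mul_le_mul_of_nonneg_right (pow_le_pow_of_le_one z0 z1 (by norm_num)) (hcosh x).le
  have hWc : ∀ x ∈ Icc (-R) R, W x ≤ Real.cosh (η * x) := by
    intro x hx
    obtain ⟨z0, z1, -, -⟩ := zeta_bounds hR hx
    exact mul_le_of_le_one_left (hcosh x).le (pow_le_one₀ z0 z1)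
  have hgrad : ∀ b c, a ≤ b → b ≤ c → c ≤ t → ∫ z in b..c, ∫ p in box R 0 H,
      ω p.1 * (Tx (z, p) ^ 2 + Ty (z, p) ^ 2) ≤ B := by
    intro b c hab hbc hct
    refine le_trans ?_ (hB R hR)
    exact integral_time_box_mono_interval (f := fun q => ω q.2.1 * (Tx q ^ 2 + Ty q ^ 2))
      hab hbc hct (by fun_prop) fun z _ p _ => mul_nonneg (hω0 _) (by positivity)
  -- a time at which the weighted gradient is controlled
  obtain ⟨b, hb, hgb⟩ := exists_mul_le_integral
    (g := fun z => ∫ p in box R 0 H, W p.1 * (Tx (z, p) ^ 2 + Ty (z, p) ^ 2))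
    (continuous_integral_box (by fun_prop)) has
  have hgb' : ∫ p in box R 0 H, W p.1 * (Tx (b, p) ^ 2 + Ty (b, p) ^ 2) ≤ B / (s - a) := by
    rw [le_div_iff₀ (sub_pos.2 has), mul_comm]
    refine hgb.trans (le_trans ?_ (hgrad a s le_rfl has.le hst))
    refine integral_time_box_mono has.le (f := fun q => W q.2.1 * (Tx q ^ 2 + Ty q ^ 2))
      (g := fun q => ω q.2.1 * (Tx q ^ 2 + Ty q ^ 2)) (by fun_prop) (by fun_prop)
      fun z _ p hp => mul_le_mul_of_nonneg_right (hWω _ hp.1) (by positivity)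
  have hbt : b ≤ t := hb.2.trans hst
  have hinc := h.gradient_increment_le hH hR0 (W := W) (W' := W')
    (fun x => hasDerivAt_quartic_cosh η x) cW' (fun x _ => hW0 x) (by simp [W, hRR])
    (by simp [W, hRR]) hb.1 hbt
  have hgt : 0 ≤ ∫ p in box R 0 H, W p.1 * (Tx (t, p) ^ 2 + Ty (t, p) ^ 2) :=
    integral_box_nonneg fun p _ => mul_nonneg (hW0 _) (by positivity)
  have hcP : ∫ z in b..t, ∫ p in box R 0 H, Real.cosh (η * p.1) * (T (z, p) * (1 - T (z, p)))
      ≤ C := by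
    refine (h.integral_time_cosh_le hH hη hA hdec hR0 hbt ht).trans ?_
    have : 0 ≤ A * (2 * H / η) := by positivity
    exact mul_le_mul_of_nonneg_right (by linarith [hb.1]) this
  have hG := hgrad b t hb.1 hbt le_rfl
  -- pointwise Young inequality
  have hpt := integral_time_box_mono (R := R) (a := 0) (b := H) hbt
    (f := fun q => 1 / 4 * (W q.2.1 * Tt q ^ 2) +
      κ / 2 * (-2 * (W q.2.1 * (Txx q + Tyy q) + W' q.2.1 * Tx q) * Tt q))
    (g := fun q => M * (ω q.2.1 * (Tx q ^ 2 + Ty q ^ 2)) +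
      K ^ 2 * (Real.cosh (η * q.2.1) * (T q * (1 - T q)))) (by fun_prop) (by fun_prop)
    (by
      rintro z _ ⟨x, y⟩ hp
      obtain ⟨z0, z1, z2, -⟩ := zeta_bounds hR hp.1
      have h2R : 2 / R ≤ 2 := div_le_self (by norm_num) hR
      have hP := mul_one_sub_mem (h.mem (z, x, y))
      have hWr : W x * r (z, x, y) ^ 2 ≤
          K ^ 2 * (Real.cosh (η * x) * (T (z, x, y) * (1 - T (z, x, y)))) := by
        have e1 : r (z, x, y) ^ 2 ≤ K ^ 2 * (T (z, x, y) * (1 - T (z, x, y))) := by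
          calc r (z, x, y) ^ 2 ≤ (K * (T (z, x, y) * (1 - T (z, x, y)))) ^ 2 :=
                pow_le_pow_left₀ (hr _) (hrK _) 2
            _ = K ^ 2 * ((T (z, x, y) * (1 - T (z, x, y))) * (T (z, x, y) * (1 - T (z, x, y)))) :=
                by ring
            _ ≤ K ^ 2 * ((T (z, x, y) * (1 - T (z, x, y))) * 1) := by
                have := mul_le_mul_of_nonneg_left hP.2 hP.1
                gcongr
            _ = _ := by ring
        calc _ ≤ Real.cosh (η * x) * (K ^ 2 * (T (z, x, y) * (1 - T (z, x, y)))) :=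
              mul_le_mul (hWc x hp.1) e1 (sq_nonneg _) (hcosh x).le
          _ = _ := by ring
      have hWu : W x * (u y * Tx (z, x, y)) ^ 2 ≤ U ^ 2 * (ω x * Tx (z, x, y) ^ 2) := by
        have e1 : u y ^ 2 ≤ U ^ 2 := sq_le_sq' (abs_le.1 (hU y)).1 (abs_le.1 (hU y)).2
        calc W x * (u y * Tx (z, x, y)) ^ 2 = W x * (u y ^ 2 * Tx (z, x, y) ^ 2) := by ring
          _ ≤ ω x * (U ^ 2 * Tx (z, x, y) ^ 2) := by
              have := hWω x hp.1
              have := hω0 x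
              gcongr
          _ = _ := by ring
      have hW'y : -(1 / 4 * (W x * Tt (z, x, y) ^ 2) +
          κ ^ 2 * (8 + η) ^ 2 * (ω x * Tx (z, x, y) ^ 2)) ≤
          κ * (W' x * Tx (z, x, y) * Tt (z, x, y)) :=
        quartic_weight_young hκ.le hη.le z0 z1 (z2.trans h2R) (hcosh x).le
          (abs_sinh_le_cosh (η * x)) _ _
      have heq := h.eq z x y
      have k1 := mul_nonneg (hW0 x) (sq_nonneg (Tt (z, x, y) / 2 - r (z, x, y)))
      have k2 := mul_nonneg (hW0 x) (sq_nonneg (Tt (z, x, y) / 2 + u y * Tx (z, x, y)))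
      have k3 : 0 ≤ M * (ω x * Ty (z, x, y) ^ 2) := by
        have := hω0 x
        positivity
      have heqW : W x * Tt (z, x, y) ^ 2 = W x * Tt (z, x, y) *
          (κ * (Txx (z, x, y) + Tyy (z, x, y)) + r (z, x, y) - u y * Tx (z, x, y)) := by
        rw [← heq]; ring
      simp only
      rw [hM] at k3 ⊢
      linarith)
  rw [integral_time_box_add (f := fun q => 1 / 4 * (W q.2.1 * Tt q ^ 2))
      (g := fun q => κ / 2 * (-2 * (W q.2.1 * (Txx q + Tyy q) + W' q.2.1 * Tx q) * Tt q))
      (by fun_prop) (by fun_prop),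
    integral_time_box_add (f := fun q => M * (ω q.2.1 * (Tx q ^ 2 + Ty q ^ 2)))
      (g := fun q => K ^ 2 * (Real.cosh (η * q.2.1) * (T q * (1 - T q))))
      (by fun_prop) (by fun_prop),
    integral_time_box_const_mul (f := fun q => W q.2.1 * Tt q ^ 2),
    integral_time_box_const_mul
      (f := fun q => -2 * (W q.2.1 * (Txx q + Tyy q) + W' q.2.1 * Tx q) * Tt q),
    integral_time_box_const_mul (f := fun q => ω q.2.1 * (Tx q ^ 2 + Ty q ^ 2)),
    integral_time_box_const_mul (f := fun q => Real.cosh (η * q.2.1) * (T q * (1 - T q)))] at hpt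
  have hfin : ∫ z in s..t, ∫ p in box R 0 H, W p.1 * Tt (z, p) ^ 2 ≤
      ∫ z in b..t, ∫ p in box R 0 H, W p.1 * Tt (z, p) ^ 2 :=
    integral_time_box_mono_interval (f := fun q => W q.2.1 * Tt q ^ 2) hb.2 hst le_rfl
      (by fun_prop) fun z _ p _ => mul_nonneg (hW0 _) (by positivity)
  have m1 := mul_le_mul_of_nonneg_left hG hM0
  have m2 := mul_le_mul_of_nonneg_left hcP (sq_nonneg K)
  have m3 := mul_le_mul_of_nonneg_left (show -(B / (s - a)) ≤
    ∫ z in b..t, ∫ p in box R 0 H,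
        -2 * (W p.1 * (Txx (z, p) + Tyy (z, p)) + W' p.1 * Tx (z, p)) * Tt (z, p) by linarith)
    (by positivity : 0 ≤ κ / 2)
  change ∫ z in s..t, ∫ p in box R 0 H, W p.1 * Tt (z, p) ^ 2 ≤ _
  linarith

end IsExtendedSolution

/-- The cutoff `(1 - x²/R²)²`. -/
def cut (R x : ℝ) : ℝ := (1 - x ^ 2 / R ^ 2) ^ 2

/-- First derivative of `cut R`. -/
def cut' (R x : ℝ) : ℝ := 2 * (1 - x ^ 2 / R ^ 2) * (-(2 * x / R ^ 2))

/-- Second derivative of `cut R`. -/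
def cut'' (R x : ℝ) : ℝ := 2 * (2 * x / R ^ 2) ^ 2 - 2 * (1 - x ^ 2 / R ^ 2) * (2 / R ^ 2)

theorem isCutoff_cut {R : ℝ} (hR : 0 < R) : IsCutoff R (cut R) (cut' R) (cut'' R) := by
  have := isCutoff_cosh hR 0
  simp only [zero_mul, Real.cosh_zero, mul_one, mul_zero, add_zero, zero_pow, ne_eq,
    OfNat.ofNat_ne_zero, not_false_eq_true] at this
  exact this

theorem cut_nonneg (R x : ℝ) : 0 ≤ cut R x := sq_nonneg _

theorem cut_le_one {R x : ℝ} (hR : 0 < R) (hx : x ∈ Icc (-R) R) : cut R x ≤ 1 := by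
  obtain ⟨z0, z1, -⟩ := zeta_bounds_of_pos hR hx
  exact pow_le_one₀ z0 z1

theorem abs_cut'_le {R x : ℝ} (hR : 0 < R) (hx : x ∈ Icc (-R) R) : |cut' R x| ≤ 4 / R := by
  obtain ⟨z0, z1, z2⟩ := zeta_bounds_of_pos hR hx
  rw [cut', abs_mul, abs_mul, abs_neg, abs_two, abs_of_nonneg z0]
  calc _ ≤ 2 * 1 * (2 / R) := by gcongr
    _ = _ := by ring

theorem abs_cut''_le {R x : ℝ} (hR : 0 < R) (hx : x ∈ Icc (-R) R) : |cut'' R x| ≤ 12 / R ^ 2 := by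
  obtain ⟨z0, z1, z2⟩ := zeta_bounds_of_pos hR hx
  rw [cut'']
  refine (abs_sub _ _).trans ?_
  rw [abs_mul, abs_mul, abs_mul, abs_two, abs_of_nonneg z0, abs_pow,
    abs_of_pos (by positivity : 0 < 2 / R ^ 2)]
  calc _ ≤ 2 * (2 / R) ^ 2 + 2 * 1 * (2 / R ^ 2) := by gcongr
    _ = _ := by field_simp; norm_num

theorem box_subset_strip (R H : ℝ) : box R 0 H ⊆ strip H := fun _ hp => ⟨trivial, hp.2⟩

theorem measurableSet_strip (H : ℝ) : MeasurableSet (strip H) :=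
  MeasurableSet.univ.prod measurableSet_Icc

theorem eventually_mem_box {H : ℝ} {p : ℝ × ℝ} (hp : p ∈ strip H) :
    ∀ᶠ n : ℕ in atTop, p ∈ box n 0 H := by
  filter_upwards [eventually_ge_atTop ⌈|p.1|⌉₊] with n hn
  have h1 : |p.1| ≤ n := (Nat.le_ceil _).trans (by exact_mod_cast hn)
  exact ⟨abs_le.1 h1, hp.2⟩

theorem aecover_box (H : ℝ) :
    AECover (volume.restrict (strip H)) atTop fun n : ℕ => box n 0 H where
  ae_eventually_mem := (ae_restrict_iff' (measurableSet_strip H)).2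
    (Eventually.of_forall fun _ hp => eventually_mem_box hp)
  measurableSet _ := measurableSet_box _ _ _

theorem restrict_strip_box (R H : ℝ) :
    (volume.restrict (strip H)).restrict (box R 0 H) = volume.restrict (box R 0 H) :=
  Measure.restrict_restrict_of_subset (box_subset_strip R H)

theorem integrableOn_strip_of_bound {H B : ℝ} {g : ℝ × ℝ → ℝ} (hg : Continuous g)
    (hB : ∀ n : ℕ, ∫ p in box n 0 H, |g p| ≤ B) : IntegrableOn g (strip H) := by
  refine (aecover_box H).integrable_of_integral_norm_bounded B (fun n => ?_)
    (Eventually.of_forall fun n => ?_)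
  · rw [IntegrableOn, restrict_strip_box]
    exact integrableOn_box hg
  · rw [restrict_strip_box]
    exact hB n

theorem integrableOn_strip_exp {η H : ℝ} (hη : 0 < η) (hH : 0 ≤ H) :
    IntegrableOn (fun p : ℝ × ℝ => Real.exp (-η * |p.1|)) (strip H) := by
  refine integrableOn_strip_of_bound (B := 2 * H / η) (by fun_prop) fun n => ?_
  simp only [Real.abs_exp]
  exact integral_box_exp_neg_abs_le hη n.cast_nonneg hH

theorem tendsto_cut (x : ℝ) : Tendsto (fun n : ℕ => cut n x) atTop (𝓝 1) := by
  have h1 : Tendsto (fun n : ℕ => x ^ 2 / (n : ℝ) ^ 2) atTop (𝓝 0) :=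
    tendsto_const_nhds.div_atTop
      ((tendsto_pow_atTop two_ne_zero).comp tendsto_natCast_atTop_atTop)
  simpa [cut] using ((h1.const_sub 1).pow 2)

theorem tendsto_integral_box_cut {H : ℝ} {g : ℝ × ℝ → ℝ} (hg : Continuous g)
    (hi : IntegrableOn g (strip H)) :
    Tendsto (fun n : ℕ => ∫ p in box n 0 H, cut n p.1 * g p) atTop (𝓝 (∫ p in strip H, g p)) := by
  have e : ∀ n : ℕ, ∫ p in box n 0 H, cut n p.1 * g p =
      ∫ p in strip H, (box n 0 H).indicator (fun p => cut n p.1 * g p) p := by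
    intro n
    rw [integral_indicator (measurableSet_box _ _ _), restrict_strip_box]
  simp only [e]
  refine tendsto_integral_filter_of_dominated_convergence (fun p => |g p|) ?_ ?_ hi.abs ?_
  · refine Eventually.of_forall fun n => ?_
    refine AEStronglyMeasurable.indicator ?_ (measurableSet_box _ _ _)
    have : Continuous fun p : ℝ × ℝ => cut n p.1 * g p := by unfold cut; fun_prop
    exact this.aestronglyMeasurable
  · filter_upwards [eventually_ge_atTop 1] with n hn
    have hn' : (1 : ℝ) ≤ n := by exact_mod_cast hn
    refine Eventually.of_forall fun p => ?_
    by_cases hp : p ∈ box n 0 H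
    · rw [indicator_of_mem hp, Real.norm_eq_abs, abs_mul, abs_of_nonneg (cut_nonneg _ _)]
      exact mul_le_of_le_one_left (abs_nonneg _) (cut_le_one (by linarith) hp.1)
    · rw [indicator_of_notMem hp, norm_zero]
      exact abs_nonneg _
  · refine (ae_restrict_iff' (measurableSet_strip H)).2 (Eventually.of_forall fun p hp => ?_)
    have h1 := (tendsto_cut p.1).mul_const (g p)
    rw [one_mul] at h1
    refine h1.congr' ?_
    filter_upwards [eventually_mem_box hp] with n hn
    rw [indicator_of_mem hn]

namespace IsExtendedSolution

variable {κ H a : ℝ} {u : ℝ → ℝ} {r T Tt Tx Ty Txx Tyy : ℝ × ℝ × ℝ → ℝ}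

theorem ae_integrableOn_time_deriv (h : IsExtendedSolution κ H a u r T Tt Tx Ty Txx Tyy)
    (hκ : 0 < κ)
    (hH : 0 ≤ H) {U K : ℝ} (hU : ∀ y, |u y| ≤ U) (hr : ∀ q, 0 ≤ r q) (hK : 0 ≤ K)
    (hrK : ∀ q, r q ≤ K * (T q * (1 - T q))) {A η τ : ℝ} (hη : 0 < η) (hA : 0 ≤ A)
    (hdec : ∀ t ≤ τ, ∀ x y, T (t, x, y) ≤ A * Real.exp (-(2 * η) * x) ∧
      1 - T (t, x, y) ≤ A * Real.exp (2 * η * x)) {s t : ℝ} (has : a < s) (hst : s ≤ t)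
    (ht : t ≤ τ) :
    ∀ᵐ z ∂volume.restrict (Icc s t), IntegrableOn (fun p => Tt (z, p)) (strip H) := by
  obtain ⟨B, hB⟩ := h.exists_time_deriv_bound hκ hH hU hr hK hrK hη hA hdec has hst ht
  have := h.cTt
  have key : Integrable Tt ((volume.restrict (Icc s t)).prod (volume.restrict (strip H))) := by
    have hcov : AECover ((volume.restrict (Icc s t)).prod (volume.restrict (strip H))) atTop
        fun n : ℕ => Icc s t ×ˢ box n 0 H := by
      refine ⟨?_, fun n => measurableSet_Icc.prod (measurableSet_box _ _ _)⟩
      rw [Measure.prod_restrict]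
      refine (ae_restrict_iff' (measurableSet_Icc.prod (measurableSet_strip H))).2
        (Eventually.of_forall fun q hq => ?_)
      filter_upwards [eventually_mem_box hq.2] with n hn using ⟨hq.1, hn⟩
    have hres : ∀ n : ℕ, ((volume.restrict (Icc s t)).prod (volume.restrict (strip H))).restrict
        (Icc s t ×ˢ box n 0 H) = (volume : Measure (ℝ × ℝ × ℝ)).restrict
          (Icc s t ×ˢ box n 0 H) := by
      intro n
      rw [Measure.prod_restrict]
      exact Measure.restrict_restrict_of_subset (prod_mono le_rfl (box_subset_strip _ _))
    refine hcov.integrable_of_integral_norm_bounded (4 * B + (t - s) * (2 * (2 * H / η)))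
      (fun n => ?_) ?_
    · rw [IntegrableOn, hres]
      exact this.continuousOn.integrableOn_compact (isCompact_Icc.prod (isCompact_box _ _ _))
    · filter_upwards [eventually_ge_atTop 1] with n hn
      have hn1 : (1 : ℝ) ≤ n := by exact_mod_cast hn
      have hn2 : (1 : ℝ) ≤ 2 * n := by linarith
      rw [hres]
      have hsplit : ∫ q in Icc s t ×ˢ box n 0 H, ‖Tt q‖ =
          ∫ z in s..t, ∫ p in box n 0 H, |Tt (z, p)| := by
        rw [intervalIntegral.integral_of_le hst, ← integral_Icc_eq_integral_Ioc]
        refine setIntegral_prod _ ?_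
        exact this.norm.continuousOn.integrableOn_compact
          (isCompact_Icc.prod (isCompact_box _ _ _))
      rw [hsplit]
      let W : ℝ → ℝ := fun x => (1 - x ^ 2 / (2 * n : ℝ) ^ 2) ^ 4 * Real.cosh (η * x)
      have cW : Continuous W := by fun_prop
      have hW0 : ∀ x, 0 ≤ W x := fun x => by have := Real.cosh_pos (η * x); positivity
      have hsub : box n 0 H ⊆ box (2 * n) 0 H := by
        refine prod_mono (Icc_subset_Icc ?_ ?_) le_rfl <;> linarith
      have h1 : ∫ z in s..t, ∫ p in box n 0 H, |Tt (z, p)| ≤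
          ∫ z in s..t, ∫ p in box n 0 H, (4 * (W p.1 * Tt (z, p) ^ 2) +
            2 * Real.exp (-η * |p.1|)) := by
        refine integral_time_box_mono hst (f := fun q => |Tt q|)
          (g := fun q => 4 * (W q.2.1 * Tt q ^ 2) + 2 * Real.exp (-η * |q.2.1|))
          (by fun_prop) (by fun_prop) fun z _ p hp => ?_
        have hx2 : p.1 ^ 2 ≤ (n : ℝ) ^ 2 := sq_le_sq' hp.1.1 hp.1.2
        have hζ : 3 / 4 ≤ 1 - p.1 ^ 2 / (2 * n : ℝ) ^ 2 := by
          have : p.1 ^ 2 / (2 * n : ℝ) ^ 2 ≤ 1 / 4 := by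
            rw [div_le_iff₀ (by positivity)]; nlinarith
          linarith
        have hζ4 : (1 : ℝ) / 4 ≤ (1 - p.1 ^ 2 / (2 * n : ℝ) ^ 2) ^ 4 :=
          le_trans (by norm_num) (pow_le_pow_left₀ (by norm_num) hζ 4)
        have hc := half_exp_abs_le_cosh (x := p.1) hη.le
        have hWE : Real.exp (η * |p.1|) / 8 ≤ W p.1 := by
          have := mul_le_mul hζ4 hc (by positivity) (by positivity)
          calc _ = 1 / 4 * (Real.exp (η * |p.1|) / 2) := by ring
            _ ≤ _ := this
        have hE : Real.exp (-η * |p.1|) = (Real.exp (η * |p.1|))⁻¹ := by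
          rw [← Real.exp_neg, neg_mul]
        have hEp := Real.exp_pos (η * |p.1|)
        generalize Real.exp (η * |p.1|) = E at *
        simp only
        rw [hE]
        have h2 : E / 2 * Tt (z, p) ^ 2 ≤ 4 * (W p.1 * Tt (z, p) ^ 2) := by
          have := mul_le_mul_of_nonneg_right hWE (sq_nonneg (Tt (z, p)))
          linarith
        refine le_trans ?_ (add_le_add_left h2 _)
        have hsq : 0 ≤ E / 2 * (|Tt (z, p)| - E⁻¹) ^ 2 := by positivity
        have hEE : E * E⁻¹ = 1 := mul_inv_cancel₀ hEp.ne'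
        have hinv : 0 < E⁻¹ := inv_pos.2 hEp
        have : E / 2 * (|Tt (z, p)| - E⁻¹) ^ 2 =
            E / 2 * Tt (z, p) ^ 2 - |Tt (z, p)| * (E * E⁻¹) + E * E⁻¹ * E⁻¹ / 2 := by
          rw [← sq_abs (Tt (z, p))]; ring
        rw [hEE] at this
        linarith
      rw [integral_time_box_add (f := fun q => 4 * (W q.2.1 * Tt q ^ 2))
        (g := fun q => 2 * Real.exp (-η * |q.2.1|)) (by fun_prop) (by fun_prop),
        integral_time_box_const_mul (f := fun q => W q.2.1 * Tt q ^ 2)] at h1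
      have h3 : ∫ z in s..t, ∫ p in box n 0 H, W p.1 * Tt (z, p) ^ 2 ≤ B := by
        refine le_trans ?_ (hB (2 * n) hn2)
        refine intervalIntegral.integral_mono_on hst
          ((continuous_integral_box (by fun_prop)).intervalIntegrable _ _)
          ((continuous_integral_box (by fun_prop)).intervalIntegrable _ _) fun z _ => ?_
        refine setIntegral_mono_set (integrableOn_box (by fun_prop)) ?_
          (LE.le.eventuallyLE hsub)
        exact Eventually.of_forall fun p => mul_nonneg (hW0 _) (sq_nonneg _)
      have h4 : ∫ z in s..t, ∫ p in box n 0 H, 2 * Real.exp (-η * |p.1|) ≤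
          (t - s) * (2 * (2 * H / η)) := by
        rw [intervalIntegral.integral_const, smul_eq_mul, integral_const_mul]
        refine mul_le_mul_of_nonneg_left ?_ (by linarith)
        exact mul_le_mul_of_nonneg_left
          (integral_box_exp_neg_abs_le hη n.cast_nonneg hH) (by norm_num)
      linarith
  exact key.prod_right_ae

end IsExtendedSolution

namespace IsExtendedSolution

variable {κ H a : ℝ} {u : ℝ → ℝ} {r T Tt Tx Ty Txx Tyy : ℝ × ℝ × ℝ → ℝ}

theorem abs_integral_cut'_sub_le (h : IsExtendedSolution κ H a u r T Tt Tx Ty Txx Tyy)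
    {A η τ : ℝ} (hη : 0 < η) (hA : 0 ≤ A)
    (hdec : ∀ t ≤ τ, ∀ x y, T (t, x, y) ≤ A * Real.exp (-(2 * η) * x) ∧
      1 - T (t, x, y) ≤ A * Real.exp (2 * η * x)) {φ : ℝ → ℝ} (cφ : Continuous φ)
    (h0 : ∀ s ∈ Icc (0 : ℝ) 1, |φ s| ≤ s) (h1 : ∀ s ∈ Icc (0 : ℝ) 1, |φ s - φ 1| ≤ 1 - s)
    {R : ℝ} (hR : 1 ≤ R) {t : ℝ} (ht : t ≤ τ) (y : ℝ) :
    |(∫ x in (-R)..R, cut' R x * φ (T (t, x, y))) - φ 1| ≤ 4 * A / (η * R) := by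
  have hRpos : 0 < R := by linarith
  have := h.cT
  have hc := isCutoff_cut hRpos
  have c' := hc.cont'
  have hsplit : (∫ x in (-R)..R, cut' R x * φ (T (t, x, y))) - φ 1 =
      (∫ x in (-R)..0, cut' R x * (φ (T (t, x, y)) - φ 1)) +
        ∫ x in (0 : ℝ)..R, cut' R x * φ (T (t, x, y)) := by
    have e1 : ∫ x in (-R)..0, cut' R x = 1 := by
      rw [intervalIntegral.integral_eq_sub_of_hasDerivAt (fun x _ => hc.hd x)
        (c'.intervalIntegrable _ _), hc.left]
      simp [cut]
    have e2 : ∫ x in (-R)..0, cut' R x * (φ (T (t, x, y)) - φ 1) =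
        (∫ x in (-R)..0, cut' R x * φ (T (t, x, y))) - φ 1 := by
      simp only [mul_sub]
      rw [intervalIntegral.integral_sub (Continuous.intervalIntegrable (by fun_prop) _ _)
        (Continuous.intervalIntegrable (by fun_prop) _ _), intervalIntegral.integral_mul_const,
        e1, one_mul]
    rw [e2, ← intervalIntegral.integral_add_adjacent_intervals (a := -R) (b := 0) (c := R)
      (Continuous.intervalIntegrable (by fun_prop) _ _)
      (Continuous.intervalIntegrable (by fun_prop) _ _)]
    ring
  rw [hsplit]
  have cE : Continuous fun x : ℝ => 4 / R * (A * Real.exp (-(2 * η) * |x|)) := by fun_prop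
  have b1 : |∫ x in (-R)..0, cut' R x * (φ (T (t, x, y)) - φ 1)| ≤
      ∫ x in (-R)..0, 4 / R * (A * Real.exp (-(2 * η) * |x|)) := by
    rw [← Real.norm_eq_abs]
    refine intervalIntegral.norm_integral_le_of_norm_le (by linarith)
      (Eventually.of_forall fun x hx => ?_) (cE.intervalIntegrable _ _)
    rw [Real.norm_eq_abs, abs_mul]
    refine mul_le_mul (abs_cut'_le hRpos ⟨hx.1.le, by linarith [hx.2]⟩) ?_ (abs_nonneg _)
      (by positivity)
    rw [abs_of_nonpos hx.2, neg_mul_neg]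
    exact (h1 _ (h.mem _)).trans (hdec t ht x y).2
  have b2 : |∫ x in (0 : ℝ)..R, cut' R x * φ (T (t, x, y))| ≤
      ∫ x in (0 : ℝ)..R, 4 / R * (A * Real.exp (-(2 * η) * |x|)) := by
    rw [← Real.norm_eq_abs]
    refine intervalIntegral.norm_integral_le_of_norm_le hRpos.le
      (Eventually.of_forall fun x hx => ?_) (cE.intervalIntegrable _ _)
    rw [Real.norm_eq_abs, abs_mul]
    refine mul_le_mul (abs_cut'_le hRpos ⟨by linarith [hx.1], hx.2⟩) ?_ (abs_nonneg _)
      (by positivity)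
    rw [abs_of_pos hx.1]
    exact (h0 _ (h.mem _)).trans (hdec t ht x y).1
  have b3 : (∫ x in (-R)..0, 4 / R * (A * Real.exp (-(2 * η) * |x|))) +
      ∫ x in (0 : ℝ)..R, 4 / R * (A * Real.exp (-(2 * η) * |x|)) ≤ 4 * A / (η * R) := by
    rw [intervalIntegral.integral_add_adjacent_intervals (cE.intervalIntegrable _ _)
      (cE.intervalIntegrable _ _), intervalIntegral.integral_const_mul,
      intervalIntegral.integral_const_mul]
    have := integral_exp_neg_abs_le (η := 2 * η) (R := R) (by positivity) hRpos.le
    calc _ ≤ 4 / R * (A * (2 / (2 * η))) := by gcongr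
      _ = _ := by field_simp
  calc _ ≤ _ := abs_add_le _ _
    _ ≤ _ := add_le_add b1 b2
    _ ≤ _ := b3

theorem abs_transport_sub_le (h : IsExtendedSolution κ H a u r T Tt Tx Ty Txx Tyy)
    {A η τ : ℝ} (hη : 0 < η) (hA : 0 ≤ A)
    (hdec : ∀ t ≤ τ, ∀ x y, T (t, x, y) ≤ A * Real.exp (-(2 * η) * x) ∧
      1 - T (t, x, y) ≤ A * Real.exp (2 * η * x)) {φ : ℝ → ℝ} (cφ : Continuous φ)
    (h0 : ∀ s ∈ Icc (0 : ℝ) 1, |φ s| ≤ s) (h1 : ∀ s ∈ Icc (0 : ℝ) 1, |φ s - φ 1| ≤ 1 - s)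
    {R : ℝ} (hR : 1 ≤ R) {t : ℝ} (ht : t ≤ τ) {α β M : ℝ} (hαβ : α ≤ β) {g : ℝ → ℝ}
    (cg : Continuous g) (hg : ∀ y ∈ Icc α β, |g y| ≤ M) :
    |(∫ p in box R α β, g p.2 * cut' R p.1 * φ (T (t, p))) - φ 1 * ∫ y in α..β, g y| ≤
      M * (4 * A / (η * R)) * (β - α) := by
  have hRpos : 0 < R := by linarith
  have := h.cT
  have c' := (isCutoff_cut hRpos).cont'
  have cI : Continuous fun y => ∫ x in (-R)..R, cut' R x * φ (T (t, x, y)) := by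
    apply intervalIntegral.continuous_parametric_intervalIntegral_of_continuous'
    fun_prop
  rw [integral_box_eq_iterated_symm hRpos.le hαβ (by fun_prop)]
  simp only [mul_assoc, intervalIntegral.integral_const_mul]
  rw [← intervalIntegral.integral_const_mul, ← intervalIntegral.integral_sub
    (Continuous.intervalIntegrable (by fun_prop) _ _)
    (Continuous.intervalIntegrable (by fun_prop) _ _)]
  have := intervalIntegral.norm_integral_le_of_norm_le_const (a := α) (b := β)
    (f := fun y => g y * (∫ x in (-R)..R, cut' R x * φ (T (t, x, y))) - φ 1 * g y)
    (C := M * (4 * A / (η * R))) (fun y hy => by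
      rw [uIoc_of_le hαβ] at hy
      rw [mul_comm (φ 1), ← mul_sub, Real.norm_eq_abs, abs_mul]
      exact mul_le_mul (hg y (Ioc_subset_Icc_self hy))
        (h.abs_integral_cut'_sub_le hη hA hdec cφ h0 h1 hR ht y) (abs_nonneg _)
        ((abs_nonneg _).trans (hg y (Ioc_subset_Icc_self hy))))
  rw [Real.norm_eq_abs, abs_of_nonneg (sub_nonneg.2 hαβ)] at this
  exact this.trans_eq (by ring)

theorem abs_integral_cut''_le (h : IsExtendedSolution κ H a u r T Tt Tx Ty Txx Tyy) {φ : ℝ → ℝ}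
    (h0 : ∀ s ∈ Icc (0 : ℝ) 1, |φ s| ≤ s) {R : ℝ} (hR : 1 ≤ R) (t : ℝ)
    {α β M : ℝ} (hαβ : α ≤ β) {g : ℝ → ℝ}
    (hg : ∀ y ∈ Icc α β, |g y| ≤ M) :
    |∫ p in box R α β, cut'' R p.1 * g p.2 * φ (T (t, p))| ≤ M * (24 / R) * (β - α) := by
  have hRpos : 0 < R := by linarith
  have hM : 0 ≤ M := (abs_nonneg _).trans (hg α (left_mem_Icc.2 hαβ))
  have hfin : volume (box R α β) < ⊤ := (isCompact_box R α β).measure_lt_top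
  have key := norm_setIntegral_le_of_norm_le_const (μ := volume) hfin
    (f := fun p : ℝ × ℝ => cut'' R p.1 * g p.2 * φ (T (t, p))) (C := 12 / R ^ 2 * M * 1)
    (fun p hp => by
      rw [Real.norm_eq_abs, abs_mul, abs_mul]
      have hT := h.mem (t, p)
      exact mul_le_mul (mul_le_mul (abs_cut''_le hRpos hp.1) (hg _ hp.2) (abs_nonneg _)
        (by positivity)) ((h0 _ hT).trans hT.2) (abs_nonneg _) (by positivity))
  refine key.trans_eq ?_
  have hv : volume.real (box R α β) = (2 * R) * (β - α) := by
    rw [box, Measure.real, Measure.volume_eq_prod, Measure.prod_prod, Real.volume_Icc,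
      Real.volume_Icc, ENNReal.toReal_mul, ENNReal.toReal_ofReal (by linarith),
      ENNReal.toReal_ofReal (by linarith)]
    ring
  rw [hv]
  field_simp
  ring

theorem integrableOn_strip_reaction (h : IsExtendedSolution κ H a u r T Tt Tx Ty Txx Tyy)
    (hH : 0 ≤ H) {K : ℝ} (hr : ∀ q, 0 ≤ r q) (hK : 0 ≤ K)
    (hrK : ∀ q, r q ≤ K * (T q * (1 - T q))) {A η τ : ℝ} (hη : 0 < η)
    (hdec : ∀ t ≤ τ, ∀ x y, T (t, x, y) ≤ A * Real.exp (-(2 * η) * x) ∧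
      1 - T (t, x, y) ≤ A * Real.exp (2 * η * x)) {t : ℝ} (ht : t ≤ τ) :
    IntegrableOn (fun p => r (t, p)) (strip H) ∧
      ∫ p in strip H, r (t, p) ≤
        ∫ p in strip H, K * (A * Real.exp (-(2 * η) * |p.1|)) := by
  have cr := h.cr
  have hle : ∀ p : ℝ × ℝ, r (t, p) ≤ K * (A * Real.exp (-(2 * η) * |p.1|)) := fun p =>
    (hrK _).trans (mul_le_mul_of_nonneg_left
      (mul_one_sub_le_exp (h.mem _) (hdec t ht p.1 p.2).1 (hdec t ht p.1 p.2).2) hK)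
  have hi : IntegrableOn (fun p : ℝ × ℝ => K * (A * Real.exp (-(2 * η) * |p.1|))) (strip H) :=
    ((integrableOn_strip_exp (by positivity) hH).const_mul A).const_mul K
  have hri : IntegrableOn (fun p => r (t, p)) (strip H) := by
    refine Integrable.mono' hi (Continuous.aestronglyMeasurable (by fun_prop))
      (Eventually.of_forall fun p => ?_)
    rw [Real.norm_eq_abs, abs_of_nonneg (hr _)]
    exact hle p
  exact ⟨hri, integral_mono hri hi hle⟩

theorem isC2_id : IsC2 (fun s => s) (fun _ => 1) (fun _ => 0) where
  hd s := hasDerivAt_id s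
  hd' s := hasDerivAt_const s 1
  cont'' := continuous_const

/-- The bulk burning rate equals the total reaction. -/
theorem integral_time_deriv_eq (h : IsExtendedSolution κ H a u r T Tt Tx Ty Txx Tyy)
    (hH : 0 ≤ H) {U K : ℝ} (hU : ∀ y, |u y| ≤ U) (hmean : ∫ y in (0 : ℝ)..H, u y = 0)
    (hr : ∀ q, 0 ≤ r q) (hK : 0 ≤ K)
    (hrK : ∀ q, r q ≤ K * (T q * (1 - T q))) {A η τ : ℝ} (hη : 0 < η) (hA : 0 ≤ A)
    (hdec : ∀ t ≤ τ, ∀ x y, T (t, x, y) ≤ A * Real.exp (-(2 * η) * x) ∧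
      1 - T (t, x, y) ≤ A * Real.exp (2 * η * x)) {t : ℝ} (ht : t ≤ τ)
    (hi : IntegrableOn (fun p => Tt (t, p)) (strip H)) :
    ∫ p in strip H, Tt (t, p) = ∫ p in strip H, r (t, p) := by
  have := h.cu; have := h.cr; have := h.cT; have := h.cTt
  have hri := (h.integrableOn_strip_reaction hH hr hK hrK hη hdec ht).1
  have l1 := tendsto_integral_box_cut (g := fun p => Tt (t, p)) (by fun_prop) hi
  have l2 := tendsto_integral_box_cut (g := fun p => r (t, p)) (by fun_prop) hri
  have hid0 : ∀ s ∈ Icc (0 : ℝ) 1, |s| ≤ s := fun s hs => (abs_of_nonneg hs.1).le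
  have hid1 : ∀ s ∈ Icc (0 : ℝ) 1, |s - 1| ≤ 1 - s := fun s hs => by
    rw [abs_sub_comm, abs_of_nonneg (sub_nonneg.2 hs.2)]
  have hdiff : Tendsto (fun n : ℕ => (∫ p in box n 0 H, cut n p.1 * Tt (t, p)) -
      ∫ p in box n 0 H, cut n p.1 * r (t, p)) atTop (𝓝 0) := by
    have hlim : Tendsto (fun n : ℕ => (U * (4 * A / η) * H + |κ| * (24 * H)) / (n : ℝ)) atTop
        (𝓝 0) := tendsto_const_div_atTop_nhds_zero_nat _
    refine squeeze_zero_norm' ?_ hlim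
    filter_upwards [eventually_ge_atTop 1] with n hn
    have hn1 : (1 : ℝ) ≤ n := by exact_mod_cast hn
    have hnpos : (0 : ℝ) < n := by linarith
    have hω := isCutoff_cut hnpos
    have := hω.cont; have := hω.cont'; have := hω.cont''
    have e := h.integral_test (R := n) hnpos.le le_rfl hH le_rfl hω (G := fun _ => 1)
      (G' := fun _ => 0) (fun y => hasDerivAt_const y 1) continuous_const isC2_id t
      (fun x => by simpa using h.flux_eq (fun _ => 1) t x)
    simp only [testIntegrand, mul_one, mul_zero, zero_mul, sub_zero] at e
    rw [e, integral_add (integrableOn_box (by fun_prop)) (integrableOn_box (by fun_prop)),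
      integral_add (integrableOn_box (by fun_prop)) (integrableOn_box (by fun_prop)),
      add_sub_cancel_right]
    have t1 := h.abs_transport_sub_le hη hA hdec continuous_id hid0 hid1 hn1 ht hH h.cu
      (fun y _ => hU y)
    have t2 := h.abs_integral_cut''_le hid0 hn1 t hH (g := fun _ => 1) (M := 1)
      (fun y _ => by simp)
    simp only [hmean, id, mul_zero, sub_zero, mul_one, one_mul] at t1 t2
    have e3 : ∫ p in box n 0 H, κ * cut'' n p.1 * T (t, p) =
        κ * ∫ p in box n 0 H, cut'' n p.1 * T (t, p) := by
      simp only [mul_assoc, integral_const_mul]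
    rw [e3, Real.norm_eq_abs]
    refine (abs_add_le _ _).trans ?_
    rw [abs_mul κ]
    have t3 := mul_le_mul_of_nonneg_left t2 (abs_nonneg κ)
    refine (add_le_add t1 t3).trans_eq ?_
    field_simp
  have hsub := l1.sub l2
  have := tendsto_nhds_unique hsub hdiff
  linarith

end IsExtendedSolution

theorem cut_le_one_sub {h c y : ℝ} (hh : 0 < h) (hy : y ∈ Icc (c - h) (c + h)) :
    cut h (y - c) ≤ 1 :=
  cut_le_one hh ⟨by linarith [hy.1], by linarith [hy.2]⟩

theorem integral_cut {h : ℝ} (hh : 0 < h) (c : ℝ) :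
    ∫ y in (c - h)..(c + h), cut h (y - c) = 16 / 15 * h := by
  have hd : ∀ y : ℝ, HasDerivAt
      (fun y => (y - c) - 2 / 3 * (y - c) ^ 3 / h ^ 2 + (y - c) ^ 5 / (5 * h ^ 4))
      (cut h (y - c)) y := by
    intro y
    have h1 : HasDerivAt (fun y => y - c) 1 y := (hasDerivAt_id y).sub_const c
    refine ((h1.sub (((h1.pow 3).const_mul (2 / 3)).div_const (h ^ 2))).add
      ((h1.pow 5).div_const (5 * h ^ 4))).congr_deriv ?_
    simp only [cut]
    push_cast
    field_simp
    ring
  rw [intervalIntegral.integral_eq_sub_of_hasDerivAt (fun y _ => hd y)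
    (Continuous.intervalIntegrable (by unfold cut; fun_prop) _ _)]
  field_simp
  ring

/-- The cubic `s²/2 - s³/3`, a primitive of `s (1 - s)`. -/
def cubic (s : ℝ) : ℝ := s ^ 2 / 2 - s ^ 3 / 3

theorem isC2_cubic : IsC2 cubic (fun s => s * (1 - s)) (fun s => 1 - 2 * s) where
  hd s := (((hasDerivAt_pow 2 s).div_const 2).sub ((hasDerivAt_pow 3 s).div_const 3)).congr_deriv
    (by push_cast; ring)
  hd' := IsExtendedSolution.isC2_mul_one_sub.hd
  cont'' := by fun_prop

theorem cubic_one : cubic 1 = 1 / 6 := by norm_num [cubic]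

theorem abs_cubic_le {s : ℝ} (hs : s ∈ Icc (0 : ℝ) 1) : |cubic s| ≤ s := by
  have h0 := hs.1
  have h1 := hs.2
  have h2 : 0 ≤ s ^ 2 := by positivity
  have h3 : 0 ≤ s ^ 3 := by positivity
  have h4 : s ^ 3 ≤ s ^ 2 := by nlinarith
  have h5 : s ^ 2 ≤ s := by nlinarith
  rw [cubic, abs_le]
  constructor <;> linarith

theorem abs_cubic_sub_le {s : ℝ} (hs : s ∈ Icc (0 : ℝ) 1) : |cubic s - cubic 1| ≤ 1 - s := by
  have h0 := hs.1
  have h1 := sub_nonneg.2 hs.2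
  have e : cubic s - cubic 1 = -((1 - s) ^ 2 * (1 + 2 * s) / 6) := by simp only [cubic]; ring
  rw [e, abs_neg, abs_of_nonneg (by positivity)]
  have h2 : (1 - s) * ((1 - s) * (1 + 2 * s)) ≤ (1 - s) * 6 := by
    refine mul_le_mul_of_nonneg_left ?_ h1
    nlinarith
  nlinarith

/-- Energy density `κ |∇T|² + r`. -/
def energyDensity (κ : ℝ) (r Tx Ty : ℝ × ℝ × ℝ → ℝ) (q : ℝ × ℝ × ℝ) : ℝ :=
  κ * (Tx q ^ 2 + Ty q ^ 2) + r q

namespace IsExtendedSolution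

variable {κ H a : ℝ} {u : ℝ → ℝ} {r T Tt Tx Ty Txx Tyy : ℝ × ℝ × ℝ → ℝ}

theorem continuous_energyDensity (h : IsExtendedSolution κ H a u r T Tt Tx Ty Txx Tyy) :
    Continuous (energyDensity κ r Tx Ty) := by
  have := h.cr; have := h.cTx; have := h.cTy
  unfold energyDensity
  fun_prop

theorem energyDensity_nonneg (hκ : 0 ≤ κ) (hr : ∀ q, 0 ≤ r q) (q : ℝ × ℝ × ℝ) :
    0 ≤ energyDensity κ r Tx Ty q := by
  have := hr q
  unfold energyDensity
  positivity

/-- Interface energy bound: `v₀ T(1-T)|T_y|` is controlled by the energy density. -/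
theorem flux_le_energyDensity (h : IsExtendedSolution κ H a u r T Tt Tx Ty Txx Tyy) (hκ : 0 < κ)
    {c v₀ : ℝ} (hc : 0 < c)
    (hrc : ∀ q, c * (v₀ ^ 2 / (4 * κ) * (T q * (1 - T q))) ≤ r q) (q : ℝ × ℝ × ℝ) :
    v₀ * (T q * (1 - T q) * |Ty q|) ≤ (1 + 1 / c) * energyDensity κ r Tx Ty q := by
  have hP := mul_one_sub_mem (h.mem q)
  have hrc' := hrc q
  generalize T q * (1 - T q) = P at *
  have h1 : v₀ ^ 2 / (4 * κ) * P ≤ r q / c := by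
    rw [le_div_iff₀ hc]; linarith
  have h2 : v₀ ^ 2 / (4 * κ) * P ^ 2 ≤ v₀ ^ 2 / (4 * κ) * P := by
    have : P ^ 2 ≤ P := by nlinarith [hP.1, hP.2]
    gcongr
  have h3 : v₀ * (P * |Ty q|) ≤ κ * Ty q ^ 2 + v₀ ^ 2 / (4 * κ) * P ^ 2 := by
    rw [← sq_abs (Ty q)]
    have e : κ * |Ty q| ^ 2 + v₀ ^ 2 / (4 * κ) * P ^ 2 - v₀ * (P * |Ty q|) =
        (2 * κ * |Ty q| - v₀ * P) ^ 2 / (4 * κ) := by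
      field_simp
      ring
    have : 0 ≤ (2 * κ * |Ty q| - v₀ * P) ^ 2 / (4 * κ) := by positivity
    linarith
  have hr0 : 0 ≤ r q := le_trans (mul_nonneg hc.le (mul_nonneg (by positivity) hP.1)) hrc'
  unfold energyDensity
  have e1 : 0 ≤ κ * Tx q ^ 2 := by positivity
  have e2 : 0 ≤ 1 / c * (κ * (Tx q ^ 2 + Ty q ^ 2)) := by positivity
  have e3 : r q / c = 1 / c * r q := by ring
  nlinarith

theorem oscillation_le (h : IsExtendedSolution κ H a u r T Tt Tx Ty Txx Tyy) (hκ : 0 < κ)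
    {c v₀ : ℝ} (hc : 0 < c) (hv : 0 < v₀)
    (hrc : ∀ q, c * (v₀ ^ 2 / (4 * κ) * (T q * (1 - T q))) ≤ r q) {R : ℝ} (hR : 0 < R) (t : ℝ)
    {y : ℝ} (hy : y ∈ Icc 0 H) :
    |(∫ x in (-R)..R, cut R x * cubic (T (t, x, y))) -
        ∫ x in (-R)..R, cut R x * cubic (T (t, x, 0))| ≤
      (1 + 1 / c) / v₀ * ∫ p in box R 0 H, cut R p.1 * energyDensity κ r Tx Ty (t, p) := by
  have := h.cT; have := h.cTy; have := (isCutoff_cut hR).cont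
  have := isC2_cubic.cont; have := h.continuous_energyDensity
  have hH : 0 ≤ H := hy.1.trans hy.2
  rw [← intervalIntegral.integral_sub (Continuous.intervalIntegrable (by fun_prop) _ _)
    (Continuous.intervalIntegrable (by fun_prop) _ _), ← integral_const_mul,
    integral_box_eq_iterated hR.le hH (by fun_prop), ← Real.norm_eq_abs]
  refine intervalIntegral.norm_integral_le_of_norm_le (by linarith)
    (Eventually.of_forall fun x hx => ?_) (Continuous.intervalIntegrable ?_ _ _)
  · have hftc : ∫ z in (0 : ℝ)..y, T (t, x, z) * (1 - T (t, x, z)) * Ty (t, x, z) =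
        cubic (T (t, x, y)) - cubic (T (t, x, 0)) := by
      refine intervalIntegral.integral_eq_sub_of_hasDerivAt_of_le hy.1
        (f := fun z => cubic (T (t, x, z)))
        (Continuous.continuousOn (by fun_prop)) (fun z hz => ?_)
        (Continuous.intervalIntegrable (by fun_prop) _ _)
      exact (isC2_cubic.hd (T (t, x, z))).comp z (h.hy t x z ⟨hz.1, hz.2.trans_le hy.2⟩)
    rw [← mul_sub, ← hftc, Real.norm_eq_abs, abs_mul, abs_of_nonneg (cut_nonneg _ _)]
    have e : ∫ z in (0 : ℝ)..H, (1 + 1 / c) / v₀ *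
        (cut R x * energyDensity κ r Tx Ty (t, x, z)) =
        cut R x * ∫ z in (0 : ℝ)..H, (1 + 1 / c) / v₀ * energyDensity κ r Tx Ty (t, x, z) := by
      rw [← intervalIntegral.integral_const_mul]
      refine intervalIntegral.integral_congr fun z _ => ?_
      ring
    simp only
    rw [e]
    refine mul_le_mul_of_nonneg_left ?_ (cut_nonneg _ _)
    calc |∫ z in (0 : ℝ)..y, T (t, x, z) * (1 - T (t, x, z)) * Ty (t, x, z)|
        ≤ ∫ z in (0 : ℝ)..y, T (t, x, z) * (1 - T (t, x, z)) * |Ty (t, x, z)| := by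
          refine (intervalIntegral.abs_integral_le_integral_abs hy.1).trans_eq ?_
          refine intervalIntegral.integral_congr fun z _ => ?_
          rw [abs_mul, abs_of_nonneg (mul_one_sub_mem (h.mem _)).1]
      _ ≤ ∫ z in (0 : ℝ)..H, T (t, x, z) * (1 - T (t, x, z)) * |Ty (t, x, z)| := by
          refine intervalIntegral.integral_mono_interval le_rfl hy.1 hy.2
            (Eventually.of_forall fun z => ?_) (Continuous.intervalIntegrable (by fun_prop) _ _)
          exact mul_nonneg (mul_one_sub_mem (h.mem _)).1 (abs_nonneg _)
      _ ≤ _ := by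
          refine intervalIntegral.integral_mono_on hH
            (Continuous.intervalIntegrable (by fun_prop) _ _)
            (Continuous.intervalIntegrable (by fun_prop) _ _) fun z _ => ?_
          rw [div_mul_eq_mul_div, le_div_iff₀ hv, mul_comm]
          exact h.flux_le_energyDensity hκ hc hrc _
  · apply intervalIntegral.continuous_parametric_intervalIntegral_of_continuous'
    fun_prop

/-- Testing with a bump over one interval of the cross-section. -/
theorem interval_test (h : IsExtendedSolution κ H a u r T Tt Tx Ty Txx Tyy) (hκ : 0 < κ)
    {c v₀ : ℝ} (hc : 0 < c) (hv : 0 < v₀)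
    (hrc : ∀ q, c * (v₀ ^ 2 / (4 * κ) * (T q * (1 - T q))) ≤ r q) (hr : ∀ q, 0 ≤ r q)
    {U : ℝ} (hU : ∀ y, |u y| ≤ U) {A η τ : ℝ} (hη : 0 < η) (hA : 0 ≤ A)
    (hdec : ∀ t ≤ τ, ∀ x y, T (t, x, y) ≤ A * Real.exp (-(2 * η) * x) ∧
      1 - T (t, x, y) ≤ A * Real.exp (2 * η * x)) {R : ℝ} (hR : 1 ≤ R) {t₁ t₂ : ℝ}
    (ha : 0 ≤ a) (h₁ : a ≤ t₁) (h₁₂ : t₁ ≤ t₂) (h₂ : t₂ ≤ τ) {y₀ w : ℝ} (hw : 0 < w)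
    (hsub : Icc (y₀ - w) (y₀ + w) ⊆ Icc 0 H) :
    |((∫ p in box R (y₀ - w) (y₀ + w), cut R p.1 * cut w (p.2 - y₀) * cubic (T (t₂, p))) -
        ∫ p in box R (y₀ - w) (y₀ + w), cut R p.1 * cut w (p.2 - y₀) * cubic (T (t₁, p))) -
        (t₂ - t₁) / 6 * ∫ y in (y₀ - w)..(y₀ + w), u y * cut w (y - y₀)| ≤
      (1 + 4 * (1 + 1 / c) * (κ / v₀ / w)) * (∫ z in t₁..t₂, ∫ p in box R (y₀ - w) (y₀ + w),
        cut R p.1 * energyDensity κ r Tx Ty (z, p)) +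
      τ * (4 * U * A / η + 24 * κ) * H / R := by
  have hRpos : 0 < R := by linarith
  have hαβ : y₀ - w ≤ y₀ + w := by linarith
  have hU0 : 0 ≤ U := (abs_nonneg _).trans (hU 0)
  have hα : 0 ≤ y₀ - w := (hsub (left_mem_Icc.2 hαβ)).1
  have hβ : y₀ + w ≤ H := (hsub (right_mem_Icc.2 hαβ)).2
  have hω := isCutoff_cut hRpos
  have hG := isCutoff_cut hw
  have := h.cu; have := h.cr; have := h.cT; have := h.cTx; have := h.cTy
  have := hω.cont; have := hω.cont'; have := hω.cont''
  have := hG.cont; have := hG.cont'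
  have := isC2_cubic.cont; have cE := h.continuous_energyDensity
  have hGd : ∀ y, HasDerivAt (fun y => cut w (y - y₀)) (cut' w (y - y₀)) y := fun y => by
    have := (hG.hd (y - y₀)).comp y ((hasDerivAt_id y).sub_const y₀)
    rwa [mul_one] at this
  have hzero : cut w (y₀ - w - y₀) = 0 ∧ cut w (y₀ + w - y₀) = 0 := by
    constructor
    · rw [show y₀ - w - y₀ = -w by ring]; exact hG.left
    · rw [show y₀ + w - y₀ = w by ring]; exact hG.right
  have hid := h.integral_test_time hRpos.le hα hαβ hβ hω hGd (by fun_prop) isC2_cubic h₁ h₁₂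
    (fun t x => by rw [hzero.1, hzero.2, zero_mul, zero_mul, zero_mul, zero_mul])
  rw [hid]
  set m : ℝ := ∫ y in (y₀ - w)..(y₀ + w), u y * cut w (y - y₀) with hm
  set Q := 1 + 4 * (1 + 1 / c) * (κ / v₀ / w) with hQ
  have hQ0 : 0 ≤ Q := by positivity
  set D := (4 * U * A / η + 24 * κ) * H / R with hD
  have hH : 0 ≤ H := hα.trans (hαβ.trans hβ)
  have hD0 : 0 ≤ D := by positivity
  have hG01 : ∀ y ∈ Icc (y₀ - w) (y₀ + w), |cut w (y - y₀)| ≤ 1 := fun y hy => by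
    rw [abs_of_nonneg (cut_nonneg _ _)]; exact cut_le_one_sub hw hy
  have hwidth : y₀ + w - (y₀ - w) ≤ H := by linarith
  have hslice : ∀ z ∈ Icc t₁ t₂,
      ‖(∫ p in box R (y₀ - w) (y₀ + w), testIntegrand κ u r T Tx Ty (cut R) (cut' R) (cut'' R)
        (fun y => cut w (y - y₀)) (fun y => cut' w (y - y₀)) cubic (fun s => s * (1 - s))
        (fun s => 1 - 2 * s) (z, p)) - 1 / 6 * m‖ ≤
      Q * (∫ p in box R (y₀ - w) (y₀ + w), cut R p.1 * energyDensity κ r Tx Ty (z, p)) + D := by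
    intro z hz
    have hzτ : z ≤ τ := hz.2.trans h₂
    have t1 := h.abs_transport_sub_le hη hA hdec isC2_cubic.cont (fun s => abs_cubic_le)
      (fun s => abs_cubic_sub_le) hR hzτ hαβ (g := fun y => u y * cut w (y - y₀)) (M := U)
      (by fun_prop) (fun y hy => by
        rw [abs_mul]
        calc _ ≤ U * 1 := mul_le_mul (hU y) (hG01 y hy) (abs_nonneg _) hU0
          _ = U := mul_one U)
    rw [cubic_one, ← hm] at t1
    have t2 := h.abs_integral_cut''_le (fun s => abs_cubic_le) hR z hαβ
      (g := fun y => cut w (y - y₀)) hG01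
    have t3 : |∫ p in box R (y₀ - w) (y₀ + w),
        (- (κ * cut R p.1 * cut w (p.2 - y₀) * (1 - 2 * T (z, p)) *
            (Tx (z, p) ^ 2 + Ty (z, p) ^ 2))
          - κ * cut R p.1 * cut' w (p.2 - y₀) * (T (z, p) * (1 - T (z, p))) * Ty (z, p)
          + cut R p.1 * cut w (p.2 - y₀) * (T (z, p) * (1 - T (z, p))) * r (z, p))| ≤
        Q * ∫ p in box R (y₀ - w) (y₀ + w), cut R p.1 * energyDensity κ r Tx Ty (z, p) := by
      rw [← integral_const_mul, ← Real.norm_eq_abs]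
      refine norm_integral_le_of_norm_le
        (g := fun p => Q * (cut R p.1 * energyDensity κ r Tx Ty (z, p)))
        (integrableOn_box (by fun_prop))
        ((ae_restrict_iff' (measurableSet_box _ _ _)).2 (Eventually.of_forall fun p hp => ?_))
      have hT := h.mem (z, p)
      have hP := mul_one_sub_mem hT
      have hω0 := cut_nonneg R p.1
      have hg0 := cut_nonneg w (p.2 - y₀)
      have hg1 := cut_le_one_sub hw hp.2
      have hg' : |cut' w (p.2 - y₀)| ≤ 4 / w :=
        abs_cut'_le hw ⟨by linarith [hp.2.1], by linarith [hp.2.2]⟩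
      have hfl := h.flux_le_energyDensity hκ hc hrc (z, p)
      have hr0 := hr (z, p)
      have hE0 := energyDensity_nonneg (Tx := Tx) (Ty := Ty) hκ.le hr (z, p)
      set E := energyDensity κ r Tx Ty (z, p) with hE
      have hEdef : E = κ * (Tx (z, p) ^ 2 + Ty (z, p) ^ 2) + r (z, p) := rfl
      rw [Real.norm_eq_abs]
      have b1 : |κ * cut R p.1 * cut w (p.2 - y₀) * (1 - 2 * T (z, p)) *
          (Tx (z, p) ^ 2 + Ty (z, p) ^ 2)| ≤
          cut R p.1 * (κ * (Tx (z, p) ^ 2 + Ty (z, p) ^ 2)) := by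
        rw [abs_mul, abs_mul, abs_mul, abs_mul, abs_of_pos hκ, abs_of_nonneg hω0,
          abs_of_nonneg hg0,
          abs_of_nonneg (by positivity : 0 ≤ Tx (z, p) ^ 2 + Ty (z, p) ^ 2)]
        have e1 : |1 - 2 * T (z, p)| ≤ 1 := abs_le.2 ⟨by linarith [hT.2], by linarith [hT.1]⟩
        calc _ ≤ κ * cut R p.1 * 1 * 1 * (Tx (z, p) ^ 2 + Ty (z, p) ^ 2) := by gcongr
          _ = _ := by ring
      have b2 : |κ * cut R p.1 * cut' w (p.2 - y₀) * (T (z, p) * (1 - T (z, p))) * Ty (z, p)| ≤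
          cut R p.1 * (4 * (1 + 1 / c) * (κ / v₀ / w) * E) := by
        rw [abs_mul, abs_mul, abs_mul, abs_mul κ, abs_of_pos hκ, abs_of_nonneg hω0,
          abs_of_nonneg hP.1]
        have e1 : T (z, p) * (1 - T (z, p)) * |Ty (z, p)| ≤ (1 + 1 / c) * E / v₀ := by
          rw [le_div_iff₀ hv]; linarith
        calc _ = κ * cut R p.1 * |cut' w (p.2 - y₀)| *
              (T (z, p) * (1 - T (z, p)) * |Ty (z, p)|) := by ring
          _ ≤ κ * cut R p.1 * (4 / w) * ((1 + 1 / c) * E / v₀) := by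
              have := hP.1
              gcongr
          _ = _ := by field_simp
      have b3 : |cut R p.1 * cut w (p.2 - y₀) * (T (z, p) * (1 - T (z, p))) * r (z, p)| ≤
          cut R p.1 * r (z, p) := by
        have hP0 := hP.1
        rw [abs_of_nonneg (by positivity)]
        calc _ ≤ cut R p.1 * 1 * 1 * r (z, p) := by gcongr; exact hP.2
          _ = _ := by ring
      have hsum : Q * (cut R p.1 * E) = cut R p.1 * (κ * (Tx (z, p) ^ 2 + Ty (z, p) ^ 2)) +
          cut R p.1 * (4 * (1 + 1 / c) * (κ / v₀ / w) * E) + cut R p.1 * r (z, p) := by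
        rw [hQ, add_mul, one_mul]
        nth_rewrite 1 [hEdef]
        ring
      have b1' := abs_le.1 b1
      have b2' := abs_le.1 b2
      have b3' := abs_le.1 b3
      rw [hsum, abs_le]
      constructor <;> linarith [b1'.1, b1'.2, b2'.1, b2'.2, b3'.1, b3'.2]
    have hsplit : ∫ p in box R (y₀ - w) (y₀ + w), testIntegrand κ u r T Tx Ty (cut R) (cut' R)
        (cut'' R) (fun y => cut w (y - y₀)) (fun y => cut' w (y - y₀)) cubic
        (fun s => s * (1 - s)) (fun s => 1 - 2 * s) (z, p) =
        (∫ p in box R (y₀ - w) (y₀ + w), u p.2 * cut w (p.2 - y₀) * cut' R p.1 *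
          cubic (T (z, p))) +
        κ * (∫ p in box R (y₀ - w) (y₀ + w), cut'' R p.1 * cut w (p.2 - y₀) *
          cubic (T (z, p))) +
        ∫ p in box R (y₀ - w) (y₀ + w),
        (- (κ * cut R p.1 * cut w (p.2 - y₀) * (1 - 2 * T (z, p)) *
            (Tx (z, p) ^ 2 + Ty (z, p) ^ 2))
          - κ * cut R p.1 * cut' w (p.2 - y₀) * (T (z, p) * (1 - T (z, p))) * Ty (z, p)
          + cut R p.1 * cut w (p.2 - y₀) * (T (z, p) * (1 - T (z, p))) * r (z, p)) := by
      rw [← integral_const_mul,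
        ← integral_add (integrableOn_box (by fun_prop)) (integrableOn_box (by fun_prop)),
        ← integral_add (integrableOn_box (by fun_prop)) (integrableOn_box (by fun_prop))]
      refine integral_congr_ae (Eventually.of_forall fun p => ?_)
      simp only [testIntegrand]
      ring
    rw [hsplit, Real.norm_eq_abs]
    have t1' := abs_le.1 t1
    have t2' := abs_le.1 t2
    have t3' := abs_le.1 t3
    have hDbound : U * (4 * A / (η * R)) * (y₀ + w - (y₀ - w)) +
        κ * (1 * (24 / R) * (y₀ + w - (y₀ - w))) ≤ D := by
      calc _ ≤ U * (4 * A / (η * R)) * H + κ * (1 * (24 / R) * H) := by gcongr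
        _ = D := by rw [hD]; field_simp
    have k1 := mul_le_mul_of_nonneg_left t2'.1 hκ.le
    have k2 := mul_le_mul_of_nonneg_left t2'.2 hκ.le
    rw [abs_le]
    constructor <;> linarith [t1'.1, t1'.2, t3'.1, t3'.2]
  have cI := h.continuous_testIntegrand hω (G := fun y => cut w (y - y₀))
    (G' := fun y => cut' w (y - y₀)) (by fun_prop) (by fun_prop) isC2_cubic
  have c1 : Continuous fun z => ∫ p in box R (y₀ - w) (y₀ + w), testIntegrand κ u r T Tx Ty
      (cut R) (cut' R) (cut'' R) (fun y => cut w (y - y₀)) (fun y => cut' w (y - y₀)) cubic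
      (fun s => s * (1 - s)) (fun s => 1 - 2 * s) (z, p) :=
    continuous_integral_box (by fun_prop)
  have c2 : Continuous fun z => ∫ p in box R (y₀ - w) (y₀ + w),
      cut R p.1 * energyDensity κ r Tx Ty (z, p) := continuous_integral_box (by fun_prop)
  have e1 : (t₂ - t₁) / 6 * m = ∫ _ in t₁..t₂, 1 / 6 * m := by
    rw [intervalIntegral.integral_const, smul_eq_mul]; ring
  rw [e1, ← intervalIntegral.integral_sub (c1.intervalIntegrable _ _) (by simp),
    ← Real.norm_eq_abs]
  refine (intervalIntegral.norm_integral_le_of_norm_le h₁₂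
    (Eventually.of_forall fun z hz => hslice z (Ioc_subset_Icc_self hz))
    (Continuous.intervalIntegrable (by fun_prop) _ _)).trans ?_
  rw [intervalIntegral.integral_add (Continuous.intervalIntegrable (by fun_prop) _ _) (by simp),
    intervalIntegral.integral_const_mul, intervalIntegral.integral_const, smul_eq_mul]
  refine add_le_add le_rfl ?_
  calc (t₂ - t₁) * D ≤ τ * D := mul_le_mul_of_nonneg_right (by linarith) hD0
    _ = _ := by rw [hD]; ring

end IsExtendedSolution

namespace IsExtendedSolution

variable {κ H a : ℝ} {u : ℝ → ℝ} {r T Tt Tx Ty Txx Tyy : ℝ × ℝ × ℝ → ℝ}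

/-- Two well-separated times at which the cut-off energy is controlled by its average. -/
theorem exists_good_times {τ : ℝ}
    (h : IsExtendedSolution κ H (τ / 8) u r T Tt Tx Ty Txx Tyy) (hκ : 0 < κ) (hH : 0 ≤ H)
    {c v₀ J : ℝ} (hc : 0 < c) (hv : 0 < v₀)
    (hrc : ∀ q, c * (v₀ ^ 2 / (4 * κ) * (T q * (1 - T q))) ≤ r q) (hr : ∀ q, 0 ≤ r q)
    {U : ℝ} (hU : ∀ y, |u y| ≤ U) {A η : ℝ} (hη : 0 < η) (hA : 0 ≤ A) (hτ : 0 < τ)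
    (hdec : ∀ t ≤ τ, ∀ x y, T (t, x, y) ≤ A * Real.exp (-(2 * η) * x) ∧
      1 - T (t, x, y) ≤ A * Real.exp (2 * η * x)) (hτκ : κ / v₀ ^ 2 ≤ τ)
    (hJ : ∀ R, 1 ≤ R → ∫ z in (τ / 8)..τ, ∫ p in box R 0 H, cut R p.1 * r (z, p) ≤ J) :
    ∃ B, ∀ R, 1 ≤ R → ∃ t₁ t₂, τ / 8 ≤ t₁ ∧ t₁ ≤ τ / 4 ∧ τ / 2 ≤ t₂ ∧ t₂ ≤ 3 * τ / 4 ∧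
      (∫ p in box R 0 H, cut R p.1 * energyDensity κ r Tx Ty (t₁, p)) ≤
        8 / τ * ((8 / c + 2) * J + B / R) ∧
      (∫ p in box R 0 H, cut R p.1 * energyDensity κ r Tx Ty (t₂, p)) ≤
        8 / τ * ((8 / c + 2) * J + B / R) ∧
      ∫ z in t₁..t₂, (∫ p in box R 0 H, cut R p.1 * energyDensity κ r Tx Ty (z, p)) ≤
        (8 / c + 2) * J + B / R := by
  have hU0 : 0 ≤ U := (abs_nonneg _).trans (hU 0)
  refine ⟨(4 * U + 12 * κ) * (τ * (A * (2 * H / η))), fun R hR => ?_⟩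
  have hRpos : 0 < R := by linarith
  have hω := isCutoff_cut hRpos
  have := h.cr; have := h.cT; have := h.cTx; have := h.cTy
  have := hω.cont; have := hω.cont'; have := hω.cont''
  have cE := h.continuous_energyDensity
  set B := (4 * U + 12 * κ) * (τ * (A * (2 * H / η))) with hB
  have hB0 : 0 ≤ B / R := by positivity
  have hcr : Continuous fun z => ∫ p in box R 0 H, cut R p.1 * r (z, p) :=
    continuous_integral_box (by fun_prop)
  have hce : Continuous fun z => ∫ p in box R 0 H, cut R p.1 * energyDensity κ r Tx Ty (z, p) :=
    continuous_integral_box (by fun_prop)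
  have hr_sub : ∀ s t, τ / 8 ≤ s → s ≤ t → t ≤ τ →
      ∫ z in s..t, ∫ p in box R 0 H, cut R p.1 * r (z, p) ≤ J := fun s t hs hst ht =>
    (integral_time_box_mono_interval (f := fun q => cut R q.2.1 * r q) hs hst ht (by fun_prop)
      fun z _ p _ => mul_nonneg (cut_nonneg _ _) (hr _)).trans (hJ R hR)
  have hJ0 : 0 ≤ J := le_trans (integral_time_box_nonneg (f := fun q => cut R q.2.1 * r q)
    (by linarith : τ / 8 ≤ τ) fun z _ p _ => mul_nonneg (cut_nonneg _ _) (hr _)) (hJ R hR)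
  obtain ⟨t₃, ht₃, hrt₃⟩ := exists_mul_le_integral hcr (by linarith : 3 * τ / 4 < τ)
  have hrt₃' := hrt₃.trans (hr_sub _ _ (by linarith) (by linarith) le_rfl)
  have hP₃ : ∫ p in box R 0 H, cut R p.1 * (T (t₃, p) * (1 - T (t₃, p))) ≤ 16 / c * J := by
    have hk : 0 < c * (v₀ ^ 2 / (4 * κ)) := by positivity
    have e1 : c * (v₀ ^ 2 / (4 * κ)) *
        ∫ p in box R 0 H, cut R p.1 * (T (t₃, p) * (1 - T (t₃, p))) ≤
        ∫ p in box R 0 H, cut R p.1 * r (t₃, p) := by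
      rw [← integral_const_mul]
      refine integral_box_mono (by fun_prop) (by fun_prop) fun p _ => ?_
      have := mul_le_mul_of_nonneg_left (hrc (t₃, p)) (cut_nonneg R p.1)
      linarith
    have e2 : ∫ p in box R 0 H, cut R p.1 * r (t₃, p) ≤ 4 / τ * J := by
      rw [div_mul_eq_mul_div, le_div_iff₀ hτ]
      linarith
    have e3 : 4 / τ * J ≤ c * (v₀ ^ 2 / (4 * κ)) * (16 / c * J) := by
      have : c * (v₀ ^ 2 / (4 * κ)) * (16 / c * J) = 4 * (v₀ ^ 2 / κ) * J := by
        field_simp; ring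
      rw [this]
      refine mul_le_mul_of_nonneg_right ?_ hJ0
      rw [div_le_iff₀ (pow_pos hv 2)] at hτκ
      rw [mul_div_assoc', div_le_div_iff₀ hτ hκ]
      linarith
    exact le_of_mul_le_mul_left ((e1.trans e2).trans e3) hk
  have hen := h.energy_le hκ.le hH hU hr hRpos.le hω (fun x _ => cut_nonneg R x) le_rfl
    (by linarith [ht₃.1] : τ / 8 ≤ t₃)
  have herr : ∫ z in (τ / 8)..t₃, ∫ p in box R 0 H,
      (U * |cut' R p.1| + κ * |cut'' R p.1|) * (T (z, p) * (1 - T (z, p))) ≤ B / R := by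
    have hcosh := h.integral_time_cosh_le hH hη hA hdec hRpos.le
      (by linarith [ht₃.1] : τ / 8 ≤ t₃) ht₃.2
    calc _ ≤ ∫ z in (τ / 8)..t₃, ∫ p in box R 0 H, (4 * U + 12 * κ) / R *
          (Real.cosh (η * p.1) * (T (z, p) * (1 - T (z, p)))) := by
          refine integral_time_box_mono (by linarith [ht₃.1])
            (f := fun q => (U * |cut' R q.2.1| + κ * |cut'' R q.2.1|) * (T q * (1 - T q)))
            (g := fun q => (4 * U + 12 * κ) / R * (Real.cosh (η * q.2.1) * (T q * (1 - T q))))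
            (by fun_prop) (by fun_prop) fun z _ p hp => ?_
          have e1 : |cut'' R p.1| ≤ 12 / R := (abs_cut''_le hRpos hp.1).trans (by
            rw [div_le_div_iff₀ (by positivity) hRpos]; nlinarith)
          have e2 := abs_cut'_le hRpos hp.1
          have hP := (mul_one_sub_mem (h.mem (z, p))).1
          have e3 : U * |cut' R p.1| + κ * |cut'' R p.1| ≤ (4 * U + 12 * κ) / R := by
            calc _ ≤ U * (4 / R) + κ * (12 / R) := by gcongr
              _ = _ := by ring
          have e4 := le_mul_of_one_le_left hP (Real.one_le_cosh (η * p.1))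
          exact mul_le_mul e3 e4 hP (by positivity)
      _ ≤ (4 * U + 12 * κ) / R * (τ * (A * (2 * H / η))) := by
          rw [integral_time_box_const_mul
            (f := fun q => Real.cosh (η * q.2.1) * (T q * (1 - T q)))]
          refine mul_le_mul_of_nonneg_left (hcosh.trans ?_) (by positivity)
          exact mul_le_mul_of_nonneg_right (by linarith [ht₃.2]) (by positivity)
      _ = B / R := by rw [hB]; ring
  have hr₃ := hr_sub (τ / 8) t₃ le_rfl (by linarith [ht₃.1]) ht₃.2
  have hetot : ∫ z in (τ / 8)..t₃, (∫ p in box R 0 H,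
      cut R p.1 * energyDensity κ r Tx Ty (z, p)) ≤ (8 / c + 2) * J + B / R := by
    have e1 : ∫ z in (τ / 8)..t₃, (∫ p in box R 0 H,
        cut R p.1 * energyDensity κ r Tx Ty (z, p)) =
        κ * (∫ z in (τ / 8)..t₃, ∫ p in box R 0 H,
          cut R p.1 * (Tx (z, p) ^ 2 + Ty (z, p) ^ 2)) +
        ∫ z in (τ / 8)..t₃, ∫ p in box R 0 H, cut R p.1 * r (z, p) := by
      rw [← integral_time_box_const_mul (f := fun q => cut R q.2.1 * (Tx q ^ 2 + Ty q ^ 2)),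
        ← integral_time_box_add (f := fun q => κ * (cut R q.2.1 * (Tx q ^ 2 + Ty q ^ 2)))
          (g := fun q => cut R q.2.1 * r q) (by fun_prop) (by fun_prop)]
      refine intervalIntegral.integral_congr fun z _ => ?_
      refine integral_congr_ae (Eventually.of_forall fun p => ?_)
      simp only [energyDensity]
      ring
    rw [e1]
    have e2 : (8 / c + 2) * J = (16 / c * J) / 2 + 2 * J := by ring
    linarith
  have he_sub : ∀ s t, τ / 8 ≤ s → s ≤ t → t ≤ 3 * τ / 4 →
      ∫ z in s..t, (∫ p in box R 0 H, cut R p.1 * energyDensity κ r Tx Ty (z, p)) ≤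
        (8 / c + 2) * J + B / R := fun s t hs hst ht =>
    (integral_time_box_mono_interval (f := fun q => cut R q.2.1 * energyDensity κ r Tx Ty q)
      hs hst (ht.trans ht₃.1) (by fun_prop)
      fun z _ p _ => mul_nonneg (cut_nonneg _ _) (energyDensity_nonneg hκ.le hr _)).trans hetot
  obtain ⟨t₁, ht₁, he₁⟩ := exists_mul_le_integral hce (by linarith : τ / 8 < τ / 4)
  obtain ⟨t₂, ht₂, he₂⟩ := exists_mul_le_integral hce (by linarith : τ / 2 < 3 * τ / 4)
  have he₁' := he₁.trans (he_sub _ _ le_rfl (by linarith) (by linarith))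
  have he₂' := he₂.trans (he_sub _ _ (by linarith) (by linarith) le_rfl)
  have hJ2 : 0 ≤ (8 / c + 2) * J + B / R := by positivity
  refine ⟨t₁, t₂, ht₁.1, ht₁.2, ht₂.1, ht₂.2, ?_, ?_,
    he_sub _ _ ht₁.1 (by linarith [ht₁.2, ht₂.1]) ht₂.2⟩
  · rw [div_mul_eq_mul_div, le_div_iff₀ hτ]
    linarith
  · rw [div_mul_eq_mul_div, le_div_iff₀ hτ]
    linarith

/-- Each interval ties the front displacement at the wall to the flow through the interval. -/
theorem interval_estimate (h : IsExtendedSolution κ H a u r T Tt Tx Ty Txx Tyy) (hκ : 0 < κ)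
    {c v₀ : ℝ} (hc : 0 < c) (hv : 0 < v₀)
    (hrc : ∀ q, c * (v₀ ^ 2 / (4 * κ) * (T q * (1 - T q))) ≤ r q) (hr : ∀ q, 0 ≤ r q)
    {U : ℝ} (hU : ∀ y, |u y| ≤ U) {A η τ : ℝ} (hη : 0 < η) (hA : 0 ≤ A)
    (hdec : ∀ t ≤ τ, ∀ x y, T (t, x, y) ≤ A * Real.exp (-(2 * η) * x) ∧
      1 - T (t, x, y) ≤ A * Real.exp (2 * η * x)) {R : ℝ} (hR : 1 ≤ R) {t₁ t₂ : ℝ}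
    (ha : 0 ≤ a) (h₁ : a ≤ t₁) (h₁₂ : t₁ ≤ t₂) (h₂ : t₂ ≤ τ) {y₀ w : ℝ} (hw : 0 < w)
    (hsub : Icc (y₀ - w) (y₀ + w) ⊆ Icc 0 H) :
    |16 / 15 * w * ((∫ x in (-R)..R, cut R x * cubic (T (t₂, x, 0))) -
          ∫ x in (-R)..R, cut R x * cubic (T (t₁, x, 0))) -
        (t₂ - t₁) / 6 * ∫ y in (y₀ - w)..(y₀ + w), u y * cut w (y - y₀)| ≤
      16 / 15 * w * ((1 + 1 / c) / v₀ *
        ((∫ p in box R 0 H, cut R p.1 * energyDensity κ r Tx Ty (t₁, p)) +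
          ∫ p in box R 0 H, cut R p.1 * energyDensity κ r Tx Ty (t₂, p))) +
      (1 + 4 * (1 + 1 / c) * (κ / v₀ / w)) * (∫ z in t₁..t₂, ∫ p in box R (y₀ - w) (y₀ + w),
        cut R p.1 * energyDensity κ r Tx Ty (z, p)) +
      τ * (4 * U * A / η + 24 * κ) * H / R := by
  have hRpos : 0 < R := by linarith
  have hαβ : y₀ - w ≤ y₀ + w := by linarith
  have := h.cT
  have := (isCutoff_cut hRpos).cont; have := (isCutoff_cut hw).cont
  have := isC2_cubic.cont
  have htest := h.interval_test hκ hc hv hrc hr hU hη hA hdec hR ha h₁ h₁₂ h₂ hw hsub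
  have hosc : ∀ t, |(∫ p in box R (y₀ - w) (y₀ + w),
      cut R p.1 * cut w (p.2 - y₀) * cubic (T (t, p))) -
      16 / 15 * w * ∫ x in (-R)..R, cut R x * cubic (T (t, x, 0))| ≤
      16 / 15 * w * ((1 + 1 / c) / v₀ *
        ∫ p in box R 0 H, cut R p.1 * energyDensity κ r Tx Ty (t, p)) := by
    intro t
    have cI : Continuous fun y => ∫ x in (-R)..R, cut R x * cubic (T (t, x, y)) := by
      apply intervalIntegral.continuous_parametric_intervalIntegral_of_continuous'
      fun_prop
    have e1 : ∫ p in box R (y₀ - w) (y₀ + w), cut R p.1 * cut w (p.2 - y₀) * cubic (T (t, p)) =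
        ∫ y in (y₀ - w)..(y₀ + w), cut w (y - y₀) *
          ∫ x in (-R)..R, cut R x * cubic (T (t, x, y)) := by
      rw [integral_box_eq_iterated_symm hRpos.le hαβ (by fun_prop)]
      refine intervalIntegral.integral_congr fun y _ => ?_
      simp only
      rw [← intervalIntegral.integral_const_mul]
      refine intervalIntegral.integral_congr fun x _ => ?_
      ring
    rw [e1, ← integral_cut hw y₀, ← intervalIntegral.integral_mul_const,
      ← intervalIntegral.integral_mul_const,
      ← intervalIntegral.integral_sub (Continuous.intervalIntegrable (by fun_prop) _ _)
        (Continuous.intervalIntegrable (by fun_prop) _ _), ← Real.norm_eq_abs]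
    refine intervalIntegral.norm_integral_le_of_norm_le hαβ
      (Eventually.of_forall fun y hy => ?_) (Continuous.intervalIntegrable (by fun_prop) _ _)
    rw [← mul_sub, Real.norm_eq_abs, abs_mul, abs_of_nonneg (cut_nonneg _ _)]
    exact mul_le_mul_of_nonneg_left
      (h.oscillation_le hκ hc hv hrc hRpos t (hsub (Ioc_subset_Icc_self hy))) (cut_nonneg _ _)
  have o1 := abs_le.1 (hosc t₁)
  have o2 := abs_le.1 (hosc t₂)
  have o3 := abs_le.1 htest
  rw [abs_le]
  constructor <;> linarith [o1.1, o1.2, o2.1, o2.2, o3.1, o3.2]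

end IsExtendedSolution

namespace SignedIntervals

variable {H : ℝ} {u₀ : ℝ → ℝ} {ι : Type}

theorem sum_integral_le (I : SignedIntervals H u₀ ι) (hH : 0 ≤ H) (s : Finset ι) {q : ℝ → ℝ}
    (cq : Continuous q) (hq : ∀ y ∈ Icc 0 H, 0 ≤ q y) :
    ∑ j ∈ s, ∫ y in (I.c j - I.h j)..(I.c j + I.h j), q y ≤ ∫ y in (0 : ℝ)..H, q y := by
  have hsub : ∀ j, Ioo (I.c j - I.h j) (I.c j + I.h j) ⊆ Icc 0 H := fun j =>
    Ioo_subset_Icc_self.trans (I.subset j)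
  have e : ∀ j, ∫ y in (I.c j - I.h j)..(I.c j + I.h j), q y =
      ∫ y in Ioo (I.c j - I.h j) (I.c j + I.h j), q y := by
    intro j
    rw [intervalIntegral.integral_of_le (by linarith [I.h_pos j]), integral_Ioc_eq_integral_Ioo]
  have hItg : IntegrableOn q (Icc 0 H) := cq.continuousOn.integrableOn_compact isCompact_Icc
  simp only [e]
  rw [← integral_biUnion_finset s (fun j _ => measurableSet_Ioo)
    (fun i _ j _ hij => I.nonoverlapping hij) (fun j _ => hItg.mono_set (hsub j)),
    intervalIntegral.integral_of_le hH, ← integral_Icc_eq_integral_Ioc]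
  refine setIntegral_mono_set hItg ((ae_restrict_iff' measurableSet_Icc).2
    (Eventually.of_forall hq)) (LE.le.eventuallyLE (iUnion₂_subset fun j _ => hsub j))

theorem sum_integral_box_le (I : SignedIntervals H u₀ ι) (hH : 0 ≤ H) (s : Finset ι) {R : ℝ}
    (hR : 0 ≤ R) {g : ℝ × ℝ → ℝ} (cg : Continuous g) (hg : ∀ p, 0 ≤ g p) :
    ∑ j ∈ s, ∫ p in box R (I.c j - I.h j) (I.c j + I.h j), g p ≤ ∫ p in box R 0 H, g p := by
  rw [integral_box_eq_iterated_symm hR hH cg]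
  have e : ∀ j, ∫ p in box R (I.c j - I.h j) (I.c j + I.h j), g p =
      ∫ y in (I.c j - I.h j)..(I.c j + I.h j), ∫ x in (-R)..R, g (x, y) := fun j =>
    integral_box_eq_iterated_symm hR (by linarith [I.h_pos j]) cg
  simp only [e]
  refine I.sum_integral_le hH s (q := fun y => ∫ x in (-R)..R, g (x, y)) ?_ fun y _ => ?_
  · apply intervalIntegral.continuous_parametric_intervalIntegral_of_continuous'
    fun_prop
  · exact intervalIntegral.integral_nonneg (by linarith) fun x _ => hg _

theorem sum_h_le (I : SignedIntervals H u₀ ι) (hH : 0 ≤ H) (s : Finset ι) :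
    2 * ∑ j ∈ s, I.h j ≤ H := by
  have := I.sum_integral_le hH s (q := fun _ => 1) continuous_const fun _ _ => zero_le_one
  simp only [intervalIntegral.integral_const, smul_eq_mul, mul_one, sub_zero] at this
  rw [Finset.mul_sum]
  refine le_trans (Finset.sum_le_sum fun j _ => ?_) this
  linarith

theorem weight_nonneg (I : SignedIntervals H u₀ ι) (l : ℝ) (j : ι) : 0 ≤ I.weight l j := by
  have := I.h_pos j
  unfold weight
  positivity

theorem weight_eq (I : SignedIntervals H u₀ ι) (l : ℝ) (j : ι) :
    I.weight l j = (1 + l ^ 2 / I.h j ^ 2)⁻¹ * I.h j := by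
  have := I.h_pos j
  unfold weight
  field_simp

theorem inv_le_one (I : SignedIntervals H u₀ ι) (l : ℝ) (j : ι) :
    (1 + l ^ 2 / I.h j ^ 2)⁻¹ ≤ 1 :=
  inv_le_one_of_one_le₀ (by have := I.h_pos j; have : 0 ≤ l ^ 2 / I.h j ^ 2 := by positivity
                            linarith)

theorem weight_le (I : SignedIntervals H u₀ ι) (l : ℝ) (j : ι) : I.weight l j ≤ I.h j := by
  rw [weight_eq]
  exact mul_le_of_le_one_left (I.h_pos j).le (I.inv_le_one l j)

theorem term_nonneg (I : SignedIntervals H u₀ ι) (hH : 0 ≤ H) (l : ℝ) (j : ι) :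
    0 ≤ I.term l j := by
  have := I.h_pos j
  unfold term
  refine mul_nonneg (by positivity) (intervalIntegral.integral_nonneg (by linarith) fun y _ => ?_)
  positivity

/-- The bump-weighted flow through an interval dominates `term`. -/
theorem term_le (I : SignedIntervals H u₀ ι) (hH : 0 < H) {u : ℝ → ℝ} (cu : Continuous u)
    (hu : ∀ y ∈ Icc 0 H, u₀ y = u y) (l : ℝ) (j : ι) :
    9 / 16 * H * I.term l j ≤ (1 + l ^ 2 / I.h j ^ 2)⁻¹ *
      ∫ y in (I.c j - I.h j)..(I.c j + I.h j), |u y| * cut (I.h j) (y - I.c j) := by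
  have hh := I.h_pos j
  have := (isCutoff_cut hh).cont
  have hw : 0 ≤ (1 + l ^ 2 / I.h j ^ 2)⁻¹ := by positivity
  have e1 : ∫ y in (I.c j - I.h j / 2)..(I.c j + I.h j / 2), |u₀ y| / H =
      (∫ y in (I.c j - I.h j / 2)..(I.c j + I.h j / 2), |u y|) / H := by
    rw [← intervalIntegral.integral_div]
    refine intervalIntegral.integral_congr fun y hy => ?_
    rw [uIcc_of_le (by linarith)] at hy
    rw [hu y (I.subset j ⟨by linarith [hy.1], by linarith [hy.2]⟩)]
  have e2 : 9 / 16 * ∫ y in (I.c j - I.h j / 2)..(I.c j + I.h j / 2), |u y| ≤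
      ∫ y in (I.c j - I.h j)..(I.c j + I.h j), |u y| * cut (I.h j) (y - I.c j) := by
    calc _ = ∫ y in (I.c j - I.h j / 2)..(I.c j + I.h j / 2), 9 / 16 * |u y| :=
          (intervalIntegral.integral_const_mul _ _).symm
      _ ≤ ∫ y in (I.c j - I.h j / 2)..(I.c j + I.h j / 2),
            |u y| * cut (I.h j) (y - I.c j) := by
          refine intervalIntegral.integral_mono_on (by linarith)
            (Continuous.intervalIntegrable (by fun_prop) _ _)
            (Continuous.intervalIntegrable (by fun_prop) _ _) fun y hy => ?_
          rw [mul_comm]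
          refine mul_le_mul_of_nonneg_left ?_ (abs_nonneg _)
          have hx2 : (y - I.c j) ^ 2 ≤ (I.h j / 2) ^ 2 :=
            sq_le_sq' (by linarith [hy.1]) (by linarith [hy.2])
          have hz : 3 / 4 ≤ 1 - (y - I.c j) ^ 2 / I.h j ^ 2 := by
            have : (y - I.c j) ^ 2 / I.h j ^ 2 ≤ 1 / 4 := by
              rw [div_le_iff₀ (by positivity)]; nlinarith
            linarith
          calc (9 : ℝ) / 16 = (3 / 4) ^ 2 := by norm_num
            _ ≤ _ := pow_le_pow_left₀ (by norm_num) hz 2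
      _ ≤ _ := by
          refine intervalIntegral.integral_mono_interval (by linarith) (by linarith) (by linarith)
            (Eventually.of_forall fun y => mul_nonneg (abs_nonneg _) (cut_nonneg _ _))
            (Continuous.intervalIntegrable (by fun_prop) _ _)
  rw [term, e1]
  calc _ = (1 + l ^ 2 / I.h j ^ 2)⁻¹ *
        (9 / 16 * ∫ y in (I.c j - I.h j / 2)..(I.c j + I.h j / 2), |u y|) := by field_simp
    _ ≤ _ := mul_le_mul_of_nonneg_left e2 hw

end SignedIntervals

theorem le_of_le_add_div_nat {X Y N : ℝ} (h : ∀ n : ℕ, 1 ≤ n → X ≤ Y + N / n) : X ≤ Y := by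
  have h1 : Tendsto (fun n : ℕ => Y + N / (n : ℝ)) atTop (𝓝 (Y + 0)) :=
    tendsto_const_nhds.add (tendsto_const_div_atTop_nhds_zero_nat N)
  rw [add_zero] at h1
  exact ge_of_tendsto h1 (eventually_atTop.2 ⟨1, fun n hn => h n hn⟩)

theorem combine_families {ι : Type*} (P M : Finset ι) {w x E G : ι → ℝ} {A₀ O C J k b d D : ℝ}
    (hw : ∀ j, 0 ≤ w j) (hx : ∀ j, 0 ≤ x j) (hb : 0 ≤ b) (hC : 0 ≤ C) (hD : 0 ≤ D) (hdD : d ≤ D)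
    (hj : ∀ j, |16 / 15 * w j * A₀ - D * G j| ≤ 16 / 15 * w j * O + C * E j + k)
    (hP : ∀ j ∈ P, b * x j ≤ G j) (hM : ∀ j ∈ M, b * x j ≤ -G j)
    (hE : ∀ s : Finset ι, ∑ j ∈ s, E j ≤ J) :
    d * b * ((∑ j ∈ M, w j) * (∑ j ∈ P, x j) + (∑ j ∈ P, w j) * ∑ j ∈ M, x j) ≤
      32 / 15 * ((∑ j ∈ P, w j) * (∑ j ∈ M, w j) * O) +
      ((∑ j ∈ P, w j) + ∑ j ∈ M, w j) * (C * J) +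
      ((∑ j ∈ M, w j) * (P.card * k) + (∑ j ∈ P, w j) * (M.card * k)) := by
  have sP : ∑ j ∈ P, (d * (b * x j) - (16 / 15 * w j * O + C * E j + k)) ≤
      ∑ j ∈ P, 16 / 15 * w j * A₀ := by
    refine Finset.sum_le_sum fun j hjP => ?_
    have a1 := (abs_le.1 (hj j)).1
    have a2 := mul_le_mul hdD (hP j hjP) (mul_nonneg hb (hx j)) hD
    linarith
  have sM : ∑ j ∈ M, 16 / 15 * w j * A₀ ≤
      ∑ j ∈ M, ((16 / 15 * w j * O + C * E j + k) - d * (b * x j)) := by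
    refine Finset.sum_le_sum fun j hjM => ?_
    have a1 := (abs_le.1 (hj j)).2
    have a2 := mul_le_mul hdD (hM j hjM) (mul_nonneg hb (hx j)) hD
    linarith
  simp only [Finset.sum_sub_distrib, Finset.sum_add_distrib, ← Finset.mul_sum,
    ← Finset.sum_mul, Finset.sum_const, nsmul_eq_mul] at sP sM
  have hWP : 0 ≤ ∑ j ∈ P, w j := Finset.sum_nonneg fun j _ => hw j
  have hWM : 0 ≤ ∑ j ∈ M, w j := Finset.sum_nonneg fun j _ => hw j
  have eP := mul_le_mul_of_nonneg_left (hE P) hC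
  have eM := mul_le_mul_of_nonneg_left (hE M) hC
  generalize ∑ j ∈ P, w j = WP at *
  generalize ∑ j ∈ M, w j = WM at *
  generalize ∑ j ∈ P, x j = XP at *
  generalize ∑ j ∈ M, x j = XM at *
  have f1 := mul_le_mul_of_nonneg_left (show d * (b * XP) - 16 / 15 * WP * O - C * J -
    P.card * k ≤ 16 / 15 * WP * A₀ by linarith) hWM
  have f2 := mul_le_mul_of_nonneg_left (show 16 / 15 * WM * A₀ ≤ 16 / 15 * WM * O + C * J +
    M.card * k - d * (b * XM) by linarith) hWP
  linarith

namespace IsExtendedSolution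

variable {κ H : ℝ} {u : ℝ → ℝ} {r T Tt Tx Ty Txx Tyy : ℝ × ℝ × ℝ → ℝ}

set_option maxHeartbeats 1000000 in
/-- The burning estimate for finite subfamilies of intervals. -/
theorem burning_estimate {τ : ℝ}
    (h : IsExtendedSolution κ H (τ / 8) u r T Tt Tx Ty Txx Tyy) (hκ : 0 < κ) (hH : 0 < H)
    {c v₀ J : ℝ} (hc : 0 < c) (hv : 0 < v₀)
    (hrc : ∀ q, c * (v₀ ^ 2 / (4 * κ) * (T q * (1 - T q))) ≤ r q) (hr : ∀ q, 0 ≤ r q)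
    {U : ℝ} (hU : ∀ y, |u y| ≤ U) {A η : ℝ} (hη : 0 < η) (hA : 0 ≤ A) (hτ : 0 < τ)
    (hdec : ∀ t ≤ τ, ∀ x y, T (t, x, y) ≤ A * Real.exp (-(2 * η) * x) ∧
      1 - T (t, x, y) ≤ A * Real.exp (2 * η * x)) (hτκ : κ / v₀ ^ 2 ≤ τ) (hτH : H / v₀ ≤ τ)
    (hJ : ∀ R, 1 ≤ R → ∫ z in (τ / 8)..τ, ∫ p in box R 0 H, cut R p.1 * r (z, p) ≤ J)
    {u₀ : ℝ → ℝ} (hu : ∀ y ∈ Icc 0 H, u₀ y = u y) {ι : Type} (I : SignedIntervals H u₀ ι)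
    (P M : Finset ι) (hP : ∀ j ∈ P, j ∈ I.Dplus) (hM : ∀ j ∈ M, j ∈ I.Dminus) :
    τ * H * ((∑ j ∈ M, I.weight (κ / v₀) j) * (∑ j ∈ P, I.term (κ / v₀) j) +
        (∑ j ∈ P, I.weight (κ / v₀) j) * ∑ j ∈ M, I.term (κ / v₀) j) ≤
      43 * (35 + 34 / c) * (8 / c + 2) *
        ((∑ j ∈ P, I.weight (κ / v₀) j) + ∑ j ∈ M, I.weight (κ / v₀) j) * J := by
  obtain ⟨B, hB⟩ := h.exists_good_times hκ hH.le hc hv hrc hr hU hη hA hτ hdec hτκ hJ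
  have hU0 : 0 ≤ U := (abs_nonneg _).trans (hU 0)
  set l := κ / v₀ with hl
  have hl0 : 0 < l := by positivity
  set WP := ∑ j ∈ P, I.weight l j with hWP
  set WM := ∑ j ∈ M, I.weight l j with hWM
  set XP := ∑ j ∈ P, I.term l j with hXP
  set XM := ∑ j ∈ M, I.term l j with hXM
  have hWP0 : 0 ≤ WP := Finset.sum_nonneg fun j _ => I.weight_nonneg l j
  have hWM0 : 0 ≤ WM := Finset.sum_nonneg fun j _ => I.weight_nonneg l j
  have hXP0 : 0 ≤ XP := Finset.sum_nonneg fun j _ => I.term_nonneg hH.le l j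
  have hXM0 : 0 ≤ XM := Finset.sum_nonneg fun j _ => I.term_nonneg hH.le l j
  have hWPH : WP ≤ H / 2 := by
    have h1 := I.sum_h_le hH.le P
    have h2 : WP ≤ ∑ j ∈ P, I.h j := Finset.sum_le_sum fun j _ => I.weight_le l j
    linarith
  set K := τ * (4 * U * A / η + 24 * κ) * H with hK
  set C₁ := 1 + 2 * (1 + 1 / c) with hC₁
  refine le_of_le_add_div_nat
    (N := 43 * (35 + 34 / c) * (WP + WM) * B + 43 * (WM * (P.card * K) + WP * (M.card * K)))
    fun n hn => ?_
  have hR : (1 : ℝ) ≤ n := by exact_mod_cast hn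
  generalize (n : ℝ) = R at hR
  have hRpos : 0 < R := by linarith
  obtain ⟨t₁, t₂, ht1, ht1', ht2, ht2', he1, he2, hE⟩ := hB R hR
  have h12 : t₁ ≤ t₂ := by linarith
  have cE := h.continuous_energyDensity; have := (isCutoff_cut hRpos).cont
  set J₂ := (8 / c + 2) * J + B / R with hJ₂
  set e₁ := ∫ p in box R 0 H, cut R p.1 * energyDensity κ r Tx Ty (t₁, p) with he₁
  set e₂ := ∫ p in box R 0 H, cut R p.1 * energyDensity κ r Tx Ty (t₂, p) with he₂
  set A₀ := (∫ x in (-R)..R, cut R x * cubic (T (t₂, x, 0))) -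
          ∫ x in (-R)..R, cut R x * cubic (T (t₁, x, 0)) with hA₀
  set O := (1 + 1 / c) / v₀ * (e₁ + e₂) with hO
  set E : ι → ℝ := fun j => ∫ z in t₁..t₂, ∫ p in box R (I.c j - I.h j) (I.c j + I.h j),
        cut R p.1 * energyDensity κ r Tx Ty (z, p) with hEj
  set F : ι → ℝ := fun j => ∫ y in (I.c j - I.h j)..(I.c j + I.h j),
    u y * cut (I.h j) (y - I.c j) with hF
  have hK0 : 0 ≤ K := by positivity
  have hEnn : ∀ p : ℝ × ℝ × ℝ, 0 ≤ cut R p.2.1 * energyDensity κ r Tx Ty p := fun p =>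
    mul_nonneg (cut_nonneg _ _) (energyDensity_nonneg hκ.le hr _)
  have hE0 : ∀ j, 0 ≤ E j := fun j =>
    integral_time_box_nonneg (f := fun q => cut R q.2.1 * energyDensity κ r Tx Ty q) h12
      fun z _ p _ => hEnn (z, p)
  -- the estimate on a single interval, multiplied by its weight
  have hj : ∀ j, |16 / 15 * I.weight l j * A₀ -
      (t₂ - t₁) / 6 * ((1 + l ^ 2 / I.h j ^ 2)⁻¹ * F j)| ≤
      16 / 15 * I.weight l j * O + C₁ * E j + K / R := by
    intro j
    have hh := I.h_pos j
    have hest := h.interval_estimate hκ hc hv hrc hr hU hη hA hdec hR (by linarith) ht1 h12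
      (by linarith : t₂ ≤ τ) hh (I.subset j)
    set ω := (1 + l ^ 2 / I.h j ^ 2)⁻¹ with hω
    have hω0 : 0 < ω := by positivity
    have hω1 : ω ≤ 1 := I.inv_le_one l j
    have hωl : ω * (l / I.h j) ≤ 1 / 2 := by
      rw [hω, inv_mul_le_iff₀ (by positivity), ← div_pow]
      nlinarith [sq_nonneg (l / I.h j - 1)]
    have e1 : 16 / 15 * I.weight l j * A₀ - (t₂ - t₁) / 6 * (ω * F j) =
        ω * (16 / 15 * I.h j * A₀ - (t₂ - t₁) / 6 * F j) := by
      rw [I.weight_eq]; ring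
    rw [e1, abs_mul, abs_of_pos hω0]
    have hest' := mul_le_mul_of_nonneg_left hest hω0.le
    refine hest'.trans ?_
    have e2 : ω * (1 + 4 * (1 + 1 / c) * (l / I.h j)) ≤ C₁ := by
      have : 4 * (1 + 1 / c) * (ω * (l / I.h j)) ≤ 4 * (1 + 1 / c) * (1 / 2) :=
        mul_le_mul_of_nonneg_left hωl (by positivity)
      rw [hC₁]; linarith
    have e3 := mul_le_mul_of_nonneg_right e2 (hE0 j)
    have e4 : ω * (K / R) ≤ K / R := mul_le_of_le_one_left (by positivity) hω1
    rw [I.weight_eq]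
    calc _ = 16 / 15 * (ω * I.h j) * O + ω * (1 + 4 * (1 + 1 / c) * (l / I.h j)) * E j +
          ω * (K / R) := by ring
      _ ≤ _ := by linarith
  have hEsum : ∀ s : Finset ι, ∑ j ∈ s, E j ≤ J₂ := by
    intro s
    refine le_trans ?_ hE
    rw [← intervalIntegral.integral_finsetSum fun j _ =>
      (continuous_integral_box (by fun_prop)).intervalIntegrable _ _]
    refine intervalIntegral.integral_mono_on h12
      (Continuous.intervalIntegrable (continuous_finsetSum _ fun j _ =>
        continuous_integral_box (by fun_prop)) _ _)
      ((continuous_integral_box (by fun_prop)).intervalIntegrable _ _) fun z _ => ?_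
    exact I.sum_integral_box_le hH.le s hRpos.le (by fun_prop) fun p => hEnn (z, p)
  have hC₁0 : 0 ≤ C₁ := by positivity
  -- sign of the flow on the two families
  have hFP : ∀ j ∈ P, 9 / 16 * H * I.term l j ≤ (1 + l ^ 2 / I.h j ^ 2)⁻¹ * F j := by
    intro j hjP
    refine (I.term_le hH h.cu hu l j).trans_eq ?_
    congr 1
    refine intervalIntegral.integral_congr fun y hy => ?_
    rw [uIcc_of_le (by linarith [I.h_pos j])] at hy
    have h0 := I.nonneg_on_Dplus j (hP j hjP) y hy
    rw [hu y (I.subset j hy)] at h0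
    simp only [abs_of_nonneg h0]
  have hFM : ∀ j ∈ M, 9 / 16 * H * I.term l j ≤ -((1 + l ^ 2 / I.h j ^ 2)⁻¹ * F j) := by
    intro j hjM
    refine (I.term_le hH h.cu hu l j).trans_eq ?_
    rw [← mul_neg, hF, ← intervalIntegral.integral_neg]
    congr 1
    refine intervalIntegral.integral_congr fun y hy => ?_
    rw [uIcc_of_le (by linarith [I.h_pos j])] at hy
    have h0 := I.nonpos_on_Dminus j (hM j hjM) y hy
    rw [hu y (I.subset j hy)] at h0
    simp only [abs_of_nonpos h0, neg_mul]
  have hΔ : τ / 24 ≤ (t₂ - t₁) / 6 := by linarith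
  have hJ₂0 : 0 ≤ J₂ := by
    refine le_trans (integral_time_box_nonneg
      (f := fun q => cut R q.2.1 * energyDensity κ r Tx Ty q) h12 fun z _ p _ => hEnn (z, p)) hE
  have hOle : H * O ≤ 16 * (1 + 1 / c) * J₂ := by
    have h1 : e₁ + e₂ ≤ 16 / τ * J₂ := by
      have : 16 / τ * J₂ = 8 / τ * J₂ + 8 / τ * J₂ := by ring
      linarith
    have h2 : H ≤ τ * v₀ := (div_le_iff₀ hv).1 hτH
    have h3 : H * ((1 + 1 / c) / v₀ * (16 / τ * J₂)) = 16 * (1 + 1 / c) * J₂ * (H / (τ * v₀)) := by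
      field_simp
    calc H * O ≤ H * ((1 + 1 / c) / v₀ * (16 / τ * J₂)) := by rw [hO]; gcongr
      _ = 16 * (1 + 1 / c) * J₂ * (H / (τ * v₀)) := h3
      _ ≤ 16 * (1 + 1 / c) * J₂ * 1 := by
          refine mul_le_mul_of_nonneg_left ?_ (by positivity)
          rw [div_le_one (by positivity)]; exact h2
      _ = _ := mul_one _
  have hO0 : 0 ≤ O := by
    have : 0 ≤ e₁ := integral_box_nonneg fun p _ => hEnn (t₁, p)
    have : 0 ≤ e₂ := integral_box_nonneg fun p _ => hEnn (t₂, p)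
    positivity
  have f3 : WP * WM * O ≤ WM * (8 * (1 + 1 / c) * J₂) := by
    have g1 : WP * O ≤ 8 * (1 + 1 / c) * J₂ := by
      have := mul_le_mul_of_nonneg_right hWPH hO0
      linarith
    have := mul_le_mul_of_nonneg_left g1 hWM0
    linarith
  have f4 := combine_families P M (fun j => I.weight_nonneg l j)
    (fun j => I.term_nonneg hH.le l j) (by positivity : 0 ≤ 9 / 16 * H) hC₁0
    (by linarith : 0 ≤ (t₂ - t₁) / 6) hΔ hj hFP hFM hEsum
  rw [← hWP, ← hWM, ← hXP, ← hXM] at f4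
  clear_value WP WM XP XM J₂ O K E F e₁ e₂ A₀
  have f5 : 0 ≤ WP * J₂ := by positivity
  have f6 : 0 ≤ WM * J₂ := by positivity
  have f7 : 0 ≤ WP * J₂ * (1 / c) := by positivity
  have f8 : 0 ≤ WM * J₂ * (1 / c) := by positivity
  have f9 : 0 ≤ WM * (P.card * (K / R)) + WP * (M.card * (K / R)) := by positivity
  have e1 : 43 * (35 + 34 / c) * (8 / c + 2) * (WP + WM) * J +
      (43 * (35 + 34 / c) * (WP + WM) * B + 43 * (WM * (P.card * K) + WP * (M.card * K))) / R =
      43 * (35 + 34 * (1 / c)) * (WP + WM) * J₂ +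
        43 * (WM * (P.card * (K / R)) + WP * (M.card * (K / R))) := by
    rw [hJ₂]; ring
  rw [e1]
  have e2 : τ / 24 * (9 / 16 * H) * (WM * XP + WP * XM) =
      3 / 128 * (τ * H * (WM * XP + WP * XM)) := by ring
  rw [e2] at f4
  have e3 : (WP + WM) * (C₁ * J₂) = 3 * (WP * J₂) + 3 * (WM * J₂) + 2 * (WP * J₂ * (1 / c)) +
      2 * (WM * J₂ * (1 / c)) := by rw [hC₁]; ring
  have e4 : WM * (8 * (1 + 1 / c) * J₂) = 8 * (WM * J₂) + 8 * (WM * J₂ * (1 / c)) := by ring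
  have e5 : 43 * (35 + 34 * (1 / c)) * (WP + WM) * J₂ = 1505 * (WP * J₂) + 1505 * (WM * J₂) +
      1462 * (WP * J₂ * (1 / c)) + 1462 * (WM * J₂ * (1 / c)) := by ring
  linarith

end IsExtendedSolution

/-- Nearest-point retraction onto `[0, H]`. -/
def clamp (H y : ℝ) : ℝ := max 0 (min y H)

theorem continuous_clamp (H : ℝ) : Continuous (clamp H) := by unfold clamp; fun_prop

theorem clamp_mem {H : ℝ} (hH : 0 ≤ H) (y : ℝ) : clamp H y ∈ Icc 0 H :=
  ⟨le_max_left _ _, max_le hH (min_le_right _ _)⟩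

theorem clamp_of_mem {H y : ℝ} (hy : y ∈ Icc 0 H) : clamp H y = y := by
  rw [clamp, min_eq_left hy.2, max_eq_right hy.1]

/-- Continuous extension of `g(t, x, y)` from `[a, ∞) × ℝ × [0, H]` to `ℝ³`. -/
def extend (a H : ℝ) (g : ℝ → ℝ → ℝ → ℝ) (q : ℝ × ℝ × ℝ) : ℝ :=
  g (max q.1 a) q.2.1 (clamp H q.2.2)

theorem extend_of_mem {a H t x y : ℝ} {g : ℝ → ℝ → ℝ → ℝ} (ht : a ≤ t) (hy : y ∈ Icc 0 H) :
    extend a H g (t, x, y) = g t x y := by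
  simp only [extend, max_eq_left ht, clamp_of_mem hy]

theorem continuous_extend {a H : ℝ} (hH : 0 ≤ H) {g : ℝ → ℝ → ℝ → ℝ} {s : Set ℝ}
    (hs : ∀ t, max t a ∈ s)
    (hg : ContinuousOn (fun p : ℝ × ℝ × ℝ => g p.1 p.2.1 p.2.2) (s ×ˢ univ ×ˢ Icc 0 H)) :
    Continuous (extend a H g) := by
  have := continuous_clamp H
  exact hg.comp_continuous
    (f := fun q : ℝ × ℝ × ℝ => (max q.1 a, q.2.1, clamp H q.2.2)) (by fun_prop)
    fun q => ⟨hs _, trivial, clamp_mem hH _⟩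

theorem IsClassicalSolution.isExtendedSolution {f u : ℝ → ℝ} {κ v₀ H a : ℝ}
    {T : ℝ → ℝ → ℝ → ℝ} (hT : IsClassicalSolution f κ v₀ H u T) (hf : ContinuousOn f (Icc 0 1))
    (hH : 0 < H) (hu : ContinuousOn u (Icc 0 H)) (hbc : NeumannBC H T ∨ PeriodicBC H T)
    (ha : 0 < a) :
    IsExtendedSolution κ H a (fun y => u (clamp H y))
      (fun q => v₀ ^ 2 / (4 * κ) * f (extend a H T q)) (extend a H T) (extend a H (dt T))
      (extend a H (dx T)) (extend a H (dy H T)) (extend a H (dx (dx T)))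
      (extend a H (dy H (dy H T))) := by
  have hs0 : ∀ t, max t a ∈ Ici (0 : ℝ) := fun t => ha.le.trans (le_max_right _ _)
  have hs : ∀ t, max t a ∈ Ioi (0 : ℝ) := fun t => ha.trans_le (le_max_right _ _)
  have hmem : ∀ q, extend a H T q ∈ Icc (0 : ℝ) 1 := fun q =>
    hT.mem_Icc _ (hs0 _) _ _ (clamp_mem hH.le _)
  have cT := continuous_extend hH.le hs0 hT.continuousOn
  have hev : ∀ y ∈ Ioo 0 H, ∀ᶠ z in 𝓝 y, clamp H z = z := fun y hy => by
    filter_upwards [Icc_mem_nhds hy.1 hy.2] with z hz using clamp_of_mem hz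
  refine ⟨hu.comp_continuous (continuous_clamp H) fun y => clamp_mem hH.le y,
    continuous_const.mul (hf.comp_continuous cT hmem), cT,
    continuous_extend hH.le hs hT.continuousOn_dt, continuous_extend hH.le hs hT.continuousOn_dx,
    continuous_extend hH.le hs hT.continuousOn_dy, continuous_extend hH.le hs hT.continuousOn_dxx,
    continuous_extend hH.le hs hT.continuousOn_dyy, hmem, ?_, ?_, ?_, ?_, ?_, ?_, ?_⟩
  · intro t hat p
    have h1 := (hT.differentiable_t t (ha.trans hat) p.1 _ (clamp_mem hH.le p.2)).hasDerivAt
    refine (h1.congr_of_eventuallyEq ?_).congr_deriv ?_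
    · filter_upwards [lt_mem_nhds hat] with s hs
      simp only [extend, max_eq_left hs.le]
    · simp only [extend, max_eq_left hat.le, dt]
  · intro t x y
    exact (hT.differentiable_x _ (hs t) x _ (clamp_mem hH.le y)).hasDerivAt
  · intro t x y
    exact (hT.differentiable_xx _ (hs t) x _ (clamp_mem hH.le y)).hasDerivAt
  · intro t x y hy
    have h1 :=
      (hT.differentiable_y _ (hs t) x y (Ioo_subset_Icc_self hy)).hasDerivWithinAt.hasDerivAt
      (Icc_mem_nhds hy.1 hy.2)
    refine (h1.congr_of_eventuallyEq ?_).congr_deriv ?_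
    · filter_upwards [hev y hy] with z hz
      simp only [extend, hz]
    · simp only [extend, clamp_of_mem (Ioo_subset_Icc_self hy), dy]
  · intro t x y hy
    have h1 := (hT.differentiable_yy _ (hs t) x y
      (Ioo_subset_Icc_self hy)).hasDerivWithinAt.hasDerivAt (Icc_mem_nhds hy.1 hy.2)
    refine (h1.congr_of_eventuallyEq ?_).congr_deriv ?_
    · filter_upwards [hev y hy] with z hz
      simp only [extend, hz]
    · simp only [extend, clamp_of_mem (Ioo_subset_Icc_self hy), dy]
  · intro t x y
    exact hT.equation _ (hs t) x _ (clamp_mem hH.le y)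
  · have h0 : clamp H 0 = 0 := clamp_of_mem (left_mem_Icc.2 hH.le)
    have h1 : clamp H H = H := clamp_of_mem (right_mem_Icc.2 hH.le)
    rcases hbc with hb | hb
    · refine Or.inl fun t x => ?_
      simpa only [extend, h0, h1] using hb _ (hs t) x
    · refine Or.inr fun t x => ?_
      simpa only [extend, h0, h1] using hb _ (hs t) x

namespace SignedIntervals

variable {H : ℝ} {u₀ : ℝ → ℝ} {ι : Type}

theorem summable_weight (I : SignedIntervals H u₀ ι) (hH : 0 ≤ H) (l : ℝ) :
    Summable (I.weight l) :=
  summable_of_sum_le (fun j => I.weight_nonneg l j) (c := H / 2) fun s => by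
    have h1 := I.sum_h_le hH s
    have h2 : ∑ j ∈ s, I.weight l j ≤ ∑ j ∈ s, I.h j :=
      Finset.sum_le_sum fun j _ => I.weight_le l j
    linarith

theorem summable_term (I : SignedIntervals H u₀ ι) (hH : 0 < H) {u : ℝ → ℝ} (cu : Continuous u)
    (hu : ∀ y ∈ Icc 0 H, u₀ y = u y) (l : ℝ) : Summable (I.term l) := by
  have hle : ∀ j, 9 / 16 * H * I.term l j ≤
      ∫ y in (I.c j - I.h j)..(I.c j + I.h j), |u y| := by
    intro j
    have hh := I.h_pos j
    have := (isCutoff_cut hh).cont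
    have hmono : ∫ y in (I.c j - I.h j)..(I.c j + I.h j), |u y| * cut (I.h j) (y - I.c j) ≤
        ∫ y in (I.c j - I.h j)..(I.c j + I.h j), |u y| := by
      refine intervalIntegral.integral_mono_on (by linarith)
        (Continuous.intervalIntegrable (by fun_prop) _ _)
        (Continuous.intervalIntegrable (by fun_prop) _ _) fun y hy => ?_
      exact mul_le_of_le_one_right (abs_nonneg _) (cut_le_one_sub hh hy)
    have h0 : 0 ≤ ∫ y in (I.c j - I.h j)..(I.c j + I.h j), |u y| * cut (I.h j) (y - I.c j) :=
      intervalIntegral.integral_nonneg (by linarith) fun y _ =>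
        mul_nonneg (abs_nonneg _) (cut_nonneg _ _)
    exact (I.term_le hH cu hu l j).trans
      ((mul_le_of_le_one_left h0 (I.inv_le_one l j)).trans hmono)
  refine summable_of_sum_le (fun j => I.term_nonneg hH.le l j)
    (c := (∫ y in (0 : ℝ)..H, |u y|) / (9 / 16 * H)) fun s => ?_
  rw [le_div_iff₀ (by positivity), mul_comm, Finset.mul_sum]
  exact (Finset.sum_le_sum fun j _ => hle j).trans
    (I.sum_integral_le hH.le s (by fun_prop) fun y _ => abs_nonneg _)

/-- Passage from finite subfamilies to the full sums. -/
theorem tsum_le_of_finite (I : SignedIntervals H u₀ ι) (hH : 0 < H) {u : ℝ → ℝ}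
    (cu : Continuous u) (hu : ∀ y ∈ Icc 0 H, u₀ y = u y) {l D : ℝ} (hD : 0 ≤ D)
    (hfin : ∀ P M : Finset ι, (∀ j ∈ P, j ∈ I.Dplus) → (∀ j ∈ M, j ∈ I.Dminus) →
      (∑ j ∈ M, I.weight l j) * (∑ j ∈ P, I.term l j) +
        (∑ j ∈ P, I.weight l j) * (∑ j ∈ M, I.term l j) ≤
      D * ((∑ j ∈ P, I.weight l j) + ∑ j ∈ M, I.weight l j)) :
    I.cplus l * (∑' j : I.Dplus, I.term l j) + I.cminus l * (∑' j : I.Dminus, I.term l j) ≤ D := by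
  classical
  have sw := I.summable_weight hH.le l
  have st := I.summable_term hH cu hu l
  set N := ∑' j, I.weight l j with hN
  have hN0 : 0 ≤ N := tsum_nonneg fun j => I.weight_nonneg l j
  have hlim : (∑' j : I.Dminus, I.weight l j) * (∑' j : I.Dplus, I.term l j) +
      (∑' j : I.Dplus, I.weight l j) * (∑' j : I.Dminus, I.term l j) ≤ D * N := by
    have t1 : Tendsto (fun s : Finset I.Dplus × Finset I.Dminus => ∑ j ∈ s.1, I.term l j)
      (atTop ×ˢ atTop) (𝓝 (∑' j : I.Dplus, I.term l j)) :=
      (st.subtype I.Dplus).hasSum.comp tendsto_fst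
    have t2 : Tendsto (fun s : Finset I.Dplus × Finset I.Dminus => ∑ j ∈ s.1, I.weight l j)
      (atTop ×ˢ atTop) (𝓝 (∑' j : I.Dplus, I.weight l j)) :=
      (sw.subtype I.Dplus).hasSum.comp tendsto_fst
    have t3 : Tendsto (fun s : Finset I.Dplus × Finset I.Dminus => ∑ j ∈ s.2, I.term l j)
      (atTop ×ˢ atTop) (𝓝 (∑' j : I.Dminus, I.term l j)) :=
      (st.subtype I.Dminus).hasSum.comp tendsto_snd
    have t4 : Tendsto (fun s : Finset I.Dplus × Finset I.Dminus => ∑ j ∈ s.2, I.weight l j)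
      (atTop ×ˢ atTop) (𝓝 (∑' j : I.Dminus, I.weight l j)) :=
      (sw.subtype I.Dminus).hasSum.comp tendsto_snd
    refine le_of_tendsto' ((t4.mul t1).add (t2.mul t3)) fun s => ?_
    have h1 := hfin (s.1.map (Function.Embedding.subtype _))
      (s.2.map (Function.Embedding.subtype _))
      (by simp +contextual) (by simp +contextual)
    simp only [Finset.sum_map, Function.Embedding.subtype_apply] at h1
    refine h1.trans (mul_le_mul_of_nonneg_left ?_ hD)
    have hdisj : Disjoint (s.1.map (Function.Embedding.subtype (· ∈ I.Dplus)))
        (s.2.map (Function.Embedding.subtype (· ∈ I.Dminus))) := by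
      rw [Finset.disjoint_left]
      intro j hj hj'
      simp only [Finset.mem_map, Function.Embedding.subtype_apply] at hj hj'
      obtain ⟨x, -, rfl⟩ := hj
      obtain ⟨y, -, hy⟩ := hj'
      exact Set.disjoint_left.1 I.disjoint x.2 (hy ▸ y.2)
    have h2 := sw.sum_le_tsum (s.1.map (Function.Embedding.subtype (· ∈ I.Dplus)) ∪
      s.2.map (Function.Embedding.subtype (· ∈ I.Dminus))) fun j _ => I.weight_nonneg l j
    rw [Finset.sum_union hdisj] at h2
    simpa only [Finset.sum_map, Function.Embedding.subtype_apply] using h2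
  have e : I.cplus l * (∑' j : I.Dplus, I.term l j) + I.cminus l * (∑' j : I.Dminus, I.term l j) =
      ((∑' j : I.Dminus, I.weight l j) * (∑' j : I.Dplus, I.term l j) +
      (∑' j : I.Dplus, I.weight l j) * (∑' j : I.Dminus, I.term l j)) * N⁻¹ := by
    rw [cplus, cminus]; ring
  rw [e]
  rcases hN0.eq_or_lt with h0 | h0
  · rw [← h0, inv_zero, mul_zero]; exact hD
  · rw [← div_eq_mul_inv, div_le_iff₀ h0]; exact hlim

end SignedIntervals

/-- Solution, decay and boundedness data give the burning rate as the total reaction, and the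
lower bound of the theorem with an explicit constant. -/
theorem burning_rate_lower_bound {f u : ℝ → ℝ} {κ v₀ H c L : ℝ} {T : ℝ → ℝ → ℝ → ℝ}
    (hfc : ContinuousOn f (Icc 0 1)) (hc : 0 < c) (hL : 0 < L)
    (hf : ∀ s ∈ Icc (0 : ℝ) 1, c * (s * (1 - s)) ≤ f s ∧ f s ≤ L * (s * (1 - s)))
    (hκ : 0 < κ) (hv : 0 < v₀) (hH : 0 < H) (hu : ContinuousOn u (Icc 0 H))
    (hmean : ∫ y in (0 : ℝ)..H, u y = 0) (hT : IsClassicalSolution f κ v₀ H u T)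
    (hbc : NeumannBC H T ∨ PeriodicBC H T) (hinit : InitiallyLocalized H T)
    {ι : Type} (I : SignedIntervals H u ι) {τ : ℝ} (hτ : max (κ / v₀ ^ 2) (H / v₀) ≤ τ) :
    (∀ᵐ t ∂(volume.restrict (Ioc 0 τ)),
      IntegrableOn (fun p : ℝ × ℝ => dt T t p.1 p.2) (strip H)) ∧
    IntervalIntegrable (V H T) volume 0 τ ∧
    I.cplus (κ / v₀) * (∑' j : I.Dplus, I.term (κ / v₀) j) +
      I.cminus (κ / v₀) * (∑' j : I.Dminus, I.term (κ / v₀) j) ≤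
        43 * (35 + 34 / c) * (8 / c + 2) * avgV H T τ := by
  have hτκ := (le_max_left _ _).trans hτ
  have hτH := (le_max_right _ _).trans hτ
  have hτ0 : 0 < τ := lt_of_lt_of_le (by positivity) hτH
  set k := v₀ ^ 2 / (4 * κ) with hk
  have hk0 : 0 < k := by positivity
  have hf0 : ∀ s ∈ Icc (0 : ℝ) 1, 0 ≤ f s := fun s hs =>
    (mul_nonneg hc.le (mul_one_sub_mem hs).1).trans (hf s hs).1
  obtain ⟨A, hA, lam, hlam, hdecay⟩ := hT.exists_decay hκ hH hu hL.le hf0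
    (fun s hs => (hf s hs).2.trans (mul_le_mul_of_nonneg_left (by nlinarith [hs.1, hs.2]) hL.le))
    hbc hinit τ
  set η := lam / 2 with hη
  have hη0 : 0 < η := by positivity
  have hη2 : 2 * η = lam := by rw [hη]; ring
  obtain ⟨U, hUb⟩ := isCompact_Icc.exists_bound_of_continuousOn hu
  have hU : ∀ y, |u (clamp H y)| ≤ U := fun y => hUb _ (clamp_mem hH.le y)
  have hext := fun a (ha : 0 < a) => hT.isExtendedSolution hfc hH hu hbc ha
  have hmemT : ∀ a, 0 ≤ a → ∀ q, extend a H T q ∈ Icc (0 : ℝ) 1 := fun a ha q =>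
    hT.mem_Icc _ (ha.trans (le_max_right _ _)) _ _ (clamp_mem hH.le _)
  have hdec : ∀ a, 0 ≤ a → a ≤ τ → ∀ t ≤ τ, ∀ x y,
      extend a H T (t, x, y) ≤ A * Real.exp (-(2 * η) * x) ∧
      1 - extend a H T (t, x, y) ≤ A * Real.exp (2 * η * x) := by
    intro a ha haτ t ht x y
    rw [hη2]
    exact hdecay _ (ha.trans (le_max_right _ _)) (max_le ht haτ) x _ (clamp_mem hH.le y)
  have hr : ∀ a, 0 ≤ a → ∀ q, 0 ≤ k * f (extend a H T q) := fun a ha q =>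
    mul_nonneg hk0.le (hf0 _ (hmemT a ha q))
  have hrK : ∀ a, 0 ≤ a → ∀ q, k * f (extend a H T q) ≤
      k * L * (extend a H T q * (1 - extend a H T q)) := fun a ha q => by
    rw [mul_assoc]
    exact mul_le_mul_of_nonneg_left (hf _ (hmemT a ha q)).2 hk0.le
  have hrc : ∀ a, 0 ≤ a → ∀ q, c * (k * (extend a H T q * (1 - extend a H T q))) ≤
      k * f (extend a H T q) := fun a ha q => by
    rw [mul_left_comm]
    exact mul_le_mul_of_nonneg_left (hf _ (hmemT a ha q)).1 hk0.le
  have hmean' : ∫ y in (0 : ℝ)..H, u (clamp H y) = 0 := by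
    refine Eq.trans (intervalIntegral.integral_congr (g := u) fun y hy => ?_) hmean
    rw [uIcc_of_le hH.le] at hy
    simp only [clamp_of_mem hy]
  -- the total reaction
  let F : ℝ → ℝ := fun t => ∫ p in strip H, k * f (extend 0 H T (t, p))
  have hFa : ∀ a t, 0 ≤ a → a ≤ t →
      ∫ p in strip H, k * f (extend a H T (t, p)) = F t := by
    intro a t ha hat
    simp only [F, extend, max_eq_left hat, max_eq_left (ha.trans hat)]
  have hdt : ∀ a t, a ≤ t → ∀ p ∈ strip H, extend a H (dt T) (t, p) = dt T t p.1 p.2 :=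
    fun a t hat p hp => extend_of_mem hat hp.2
  have hae : ∀ᵐ t ∂(volume.restrict (Ioc 0 τ)),
      IntegrableOn (fun p : ℝ × ℝ => dt T t p.1 p.2) (strip H) ∧ V H T t = F t / H := by
    have hsub : Ioc 0 τ ⊆ ⋃ n : ℕ, Icc (τ / (n + 1)) τ := by
      intro t ht
      obtain ⟨n, hn⟩ := exists_nat_gt (τ / t)
      refine mem_iUnion.2 ⟨n, ?_, ht.2⟩
      rw [div_le_iff₀ (by positivity)]
      rw [div_lt_iff₀ ht.1] at hn
      nlinarith [ht.1]
    refine ae_restrict_of_ae_restrict_of_subset hsub ?_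
    rw [ae_restrict_iUnion_iff]
    intro n
    set s := τ / ((n : ℝ) + 1) with hs
    have hs0 : 0 < s := by positivity
    have hsτ : s ≤ τ := div_le_self hτ0.le (by have : (0 : ℝ) ≤ n := n.cast_nonneg
                                               linarith)
    have ha0 : 0 < s / 2 := by positivity
    have h := hext (s / 2) ha0
    have hd := hdec (s / 2) ha0.le (by linarith)
    have hItg := h.ae_integrableOn_time_deriv hκ hH.le hU (hr _ ha0.le) (by positivity)
      (hrK _ ha0.le) hη0 hA.le hd (by linarith : s / 2 < s) hsτ le_rfl
    filter_upwards [hItg, ae_restrict_mem measurableSet_Icc] with t hti htm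
    have hat : s / 2 ≤ t := by linarith [htm.1]
    refine ⟨hti.congr_fun (fun p hp => hdt _ t hat p hp) (measurableSet_strip H), ?_⟩
    have e := h.integral_time_deriv_eq hH.le hU hmean' (hr _ ha0.le) (by positivity)
      (hrK _ ha0.le) hη0 hA.le hd htm.2 hti
    rw [hFa _ t ha0.le hat, setIntegral_congr_fun (measurableSet_strip H)
      (fun p hp => hdt _ t hat p hp)] at e
    rw [V, e]
  have cr0 : Continuous fun q => k * f (extend 0 H T q) :=
    continuous_const.mul (hfc.comp_continuous
      (continuous_extend hH.le (fun t => le_max_right _ _) hT.continuousOn) (hmemT 0 le_rfl))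
  have hFm : StronglyMeasurable F :=
    (cr0.stronglyMeasurable (α := ℝ × ℝ × ℝ)).integral_prod_right'
      (ν := volume.restrict (strip H))
  have hF0 : ∀ t, 0 ≤ F t := fun t => integral_nonneg fun p => hr 0 le_rfl _
  have hreact : ∀ t, 0 < t → t ≤ τ → IntegrableOn (fun p => k * f (extend t H T (t, p))) (strip H) ∧
      F t ≤ ∫ p in strip H, k * L * (A * Real.exp (-(2 * η) * |p.1|)) := by
    intro t ht htτ
    have := (hext t ht).integrableOn_strip_reaction hH.le (hr t ht.le) (by positivity)
      (hrK t ht.le) hη0 (hdec t ht.le htτ) htτ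
    rwa [hFa t t ht.le le_rfl] at this
  have hFi : IntervalIntegrable F volume 0 τ := by
    rw [intervalIntegrable_iff_integrableOn_Ioc_of_le hτ0.le]
    refine Measure.integrableOn_of_bounded (s := Ioc 0 τ) (by simp) hFm.aestronglyMeasurable
      (M := ∫ p in strip H, k * L * (A * Real.exp (-(2 * η) * |p.1|))) ?_
    filter_upwards [ae_restrict_mem measurableSet_Ioc] with t ht
    rw [Real.norm_eq_abs, abs_of_nonneg (hF0 t)]
    exact (hreact t ht.1 ht.2).2
  have hVF : V H T =ᵐ[volume.restrict (Ioc 0 τ)] fun t => F t / H := by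
    filter_upwards [hae] with t ht using ht.2
  have hVi : IntervalIntegrable (V H T) volume 0 τ := by
    rw [intervalIntegrable_iff_integrableOn_Ioc_of_le hτ0.le] at hFi ⊢
    exact (hFi.div_const H).congr hVF.symm
  set J := ∫ t in (0 : ℝ)..τ, F t with hJdef
  have havg : avgV H T τ = J / (τ * H) := by
    have : ∫ t in (0 : ℝ)..τ, V H T t = J / H := by
      rw [hJdef, ← intervalIntegral.integral_div, intervalIntegral.integral_of_le hτ0.le,
        intervalIntegral.integral_of_le hτ0.le]
      exact integral_congr_ae hVF
    rw [avgV, this]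
    field_simp
  have hJ0 : 0 ≤ J := intervalIntegral.integral_nonneg hτ0.le fun t _ => hF0 t
  have ha0 : 0 < τ / 8 := by positivity
  have h := hext (τ / 8) ha0
  have hJ : ∀ R, 1 ≤ R → ∫ z in (τ / 8)..τ, ∫ p in box R 0 H,
      cut R p.1 * (k * f (extend (τ / 8) H T (z, p))) ≤ J := by
    intro R hR
    have hRpos : 0 < R := by linarith
    have := h.cr; have := (isCutoff_cut hRpos).cont
    have hmono : ∫ z in (τ / 8)..τ, F z ≤ J :=
      intervalIntegral.integral_mono_interval ha0.le (by linarith) le_rfl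
        (Eventually.of_forall hF0) hFi
    refine le_trans ?_ hmono
    refine intervalIntegral.integral_mono_on (by linarith)
      ((continuous_integral_box
        (F := fun z p => cut R p.1 * (k * f (extend (τ / 8) H T (z, p))))
        (by fun_prop)).intervalIntegrable _ _)
      (hFi.mono_set (by
        rw [uIcc_of_le (by linarith), uIcc_of_le hτ0.le]
        exact Icc_subset_Icc_left ha0.le)) fun z hz => ?_
    have hi := (h.integrableOn_strip_reaction hH.le (hr _ ha0.le) (by positivity)
      (hrK _ ha0.le) hη0 (hdec _ ha0.le (by linarith)) hz.2).1
    rw [← hFa _ z ha0.le hz.1]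
    have crz : Continuous fun p : ℝ × ℝ => k * f (extend (τ / 8) H T (z, p)) :=
      h.cr.comp (by fun_prop : Continuous fun p : ℝ × ℝ => ((z, p) : ℝ × ℝ × ℝ))
    calc _ ≤ ∫ p in box R 0 H, k * f (extend (τ / 8) H T (z, p)) := by
          refine integral_box_mono (Continuous.mul (by fun_prop) crz) crz fun p hp => ?_
          exact mul_le_of_le_one_left (hr _ ha0.le _) (cut_le_one hRpos hp.1)
      _ ≤ _ := setIntegral_mono_set hi (Eventually.of_forall fun p => hr _ ha0.le _)
          (LE.le.eventuallyLE (box_subset_strip R H))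
  refine ⟨hae.mono fun t ht => ht.1, hVi, ?_⟩
  have huc : ∀ y ∈ Icc 0 H, u y = u (clamp H y) := fun y hy => by rw [clamp_of_mem hy]
  refine I.tsum_le_of_finite hH h.cu huc (by rw [havg]; positivity) fun P M hP hM => ?_
  have hest := h.burning_estimate hκ hH hc hv (hrc _ ha0.le) (hr _ ha0.le) hU hη0 hA.le hτ0
    (hdec _ ha0.le (by linarith)) hτκ hτH hJ huc I P M hP hM
  rw [havg]
  have hτHpos : 0 < τ * H := by positivity
  rw [mul_comm, ← le_div_iff₀ hτHpos] at hest
  refine hest.trans_eq ?_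
  ring

end BulkBurning

end

theorem theorem4 (f : ℝ → ℝ) (hf : BulkBurning.IsConcaveKPP f) :
    ∃ C : ℝ, 0 < C ∧
      ∀ (κ v₀ H : ℝ), 0 < κ → 0 < v₀ → 0 < H →
      ∀ u : ℝ → ℝ, ContDiffOn ℝ 1 u (Set.Icc 0 H) → ∫ y in (0 : ℝ)..H, u y = 0 →
      ∀ T : ℝ → ℝ → ℝ → ℝ, BulkBurning.IsClassicalSolution f κ v₀ H u T →
      (BulkBurning.NeumannBC H T ∨ BulkBurning.PeriodicBC H T) →
      BulkBurning.InitiallyLocalized H T →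
      ∀ (ι : Type) (I : BulkBurning.SignedIntervals H u ι),
      ∀ τ : ℝ, max (κ / v₀ ^ 2) (H / v₀) ≤ τ →
        (∀ᵐ t ∂(MeasureTheory.volume.restrict (Set.Ioc 0 τ)),
          MeasureTheory.IntegrableOn (fun p : ℝ × ℝ => BulkBurning.dt T t p.1 p.2)
            (BulkBurning.strip H)) ∧
        IntervalIntegrable (BulkBurning.V H T) MeasureTheory.volume 0 τ ∧
        C * (I.cplus (κ / v₀) * ∑' j : I.Dplus, I.term (κ / v₀) j +
            I.cminus (κ / v₀) * ∑' j : I.Dminus, I.term (κ / v₀) j) ≤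
          BulkBurning.avgV H T τ := by
  obtain ⟨c, hc, L, hL, hb⟩ := hf.exists_bounds
  have hC : 0 < 43 * (35 + 34 / c) * (8 / c + 2) := by positivity
  refine ⟨(43 * (35 + 34 / c) * (8 / c + 2))⁻¹, inv_pos.2 hC, ?_⟩
  intro κ v₀ H hκ hv hH u hu hmean T hT hbc hinit ι I τ hτ
  obtain ⟨h1, h2, h3⟩ := BulkBurning.burning_rate_lower_bound hf.contDiffOn.continuousOn hc hL hb
    hκ hv hH hu.continuousOn hmean hT hbc hinit I hτ
  exact ⟨h1, h2, (inv_mul_le_iff₀ hC).2 h3⟩
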